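/- **Conventions.** Let $\Theta$ be a measurable space, $\bar H$ a probability measure on $\Theta$, $L\ge 0$, and $\alpha^l,\gamma^l>0$ for $0\le l\le L$. Put $X_0=\Theta$ and let $X_{l+1}$ be the space of probability measures on $X_l$, with the $\sigma$-algebra generated by the evaluations $\mu\mapsto\mu(A)$. For $\alpha>0$ and a probability measure $\mu$ on a measurable space, $DP(\alpha,\mu)$ is the law of a random probability measure $G$ with $(G(A_1),\dots,G(A_n))\sim \mathrm{Dir}(\alpha\mu(A_1),\dots,\alpha\mu(A_n))$ for every finite measurable partition $(A_1,\dots,A_n)$; coordinates with parameter $0$ are $0$. **Nested HDP.** Random measures $G^l_0$ and $G^l_r$ ($r\ge 1$) on $X_l$, $0\le l\le L$, form a nested hierarchical Dirichlet process (nHDP) if $G^0_0\sim DP(\gamma^0,\bar H)$; for each $l\le L$, conditionally on $G^l_0$, the $G^l_r$, $r\ge1$, are i.i.d. $DP(\alpha^l,G^l_0)$; and for each $l<L$, conditionally on $G^l_0$, $G^{l+1}_0\sim DP(\gamma^{l+1},DP(\alpha^l,G^l_0))$. (No further condition is put on the coupling of different levels.) **Finite mixture.** Let $K^0,\dots,K^L\ge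 1$. Let $\phi_1,\phi_2,\dots$ be i.i.d. with law $\bar H$. For each $l\le L$ let $\beta^l\sim\mathrm{Dir}(\gamma^l/K^l,\dots,\gamma^l/K^l)$ and, given $\beta^l$, let $\pi^l_r$ ($r\ge 1$) be i.i.d. $\mathrm{Dir}(\alpha^l\beta^l)$; the weights $(\beta^l,(\pi^l_r)_r)$ of the different levels are independent of each other and of the $\phi_k$. With atoms $a^0_k=\phi_k$ and $a^{l}_k=G^{l-1}_{k|K^{l-1}}$ for $l\ge 1$, put $$G^l_{0|K^l}=\sum_{k=1}^{K^l}\beta^l_k\,\delta_{a^l_k},\qquad G^l_{r|K^l}=\sum_{k=1}^{K^l}\pi^l_{rk}\,\delta_{a^l_k}\quad(r\ge 1).$$ **Test functions.** A test function of level $0$ is a measurable $\bar H$-integrable $g:\Theta\to\mathbb R$. A test function of level $l+1$ is a function $\mu\mapsto F\left(\int f_1\,d\mu,\dots,\int f_m\,d\mu\right)$ on $X_{l+1}$ with $m\ge 0$, $F:\mathbb R^m\to\mathbb R$ bounded and continuous, and $f_1,\dots,f_m$ test functions of level $l$. **Theorem.** Let $(G^l_0,(G^l_r)_{r\ge1})_{l\le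 L}$ be an nHDP. 1. (Joint limit.) For each $l\le L$, all $n\ge 0$, all indices $r_1,\dots,r_n\in\{0,1,2,\dots\}$ and all test functions $g_1,\dots,g_n$ of level $l$, as $K^{l'}\to\infty$ jointly for all $l'\le L$, $$\left(\int g_i\,dG^l_{r_i|K^l}\right)_{i\le n}\ \xrightarrow{\ D\ }\ \left(\int g_i\,dG^l_{r_i}\right)_{i\le n}.$$ That is, level by level, $G^l_{0|K^l}\to G^l_0$, and the group measures $G^l_{r|K^l}$, jointly with $G^l_{0|K^l}$, tend to independent draws from $DP(\alpha^l,G^l_0)$ given $G^l_0$. 2. (Successive limits.) Let $0\le l<L$, and let the finite mixture of level $l+1$, with weights $\beta^{l+1},\pi^{l+1}_r$ as above, be built on the atoms $a^{l+1}_k=G^l_k$, where the $G^l_k$ are the level-$l$ group measures of an nHDP and are independent of the weights. Then, as $K^{l+1}\to\infty$, the convergence in distribution of part 1 holds at level $l+1$ for all measurable $g_1,\dots,g_n:X_{l+1}\to\mathbb R$ that are integrable with respect to the law of $G^l_1$. -/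

import Mathlib

open MeasureTheory ProbabilityTheory Filter
open scoped ENNReal NNReal BoundedContinuousFunction

universe u v w

noncomputable section

/-! ### Dirichlet distributions and Dirichlet processes -/

/-- The Gamma distribution with shape `a` and rate `1`, read as the point mass at `0` for `a ≤ 0`
(its weak limit as the shape tends to `0`). -/
def unitGamma (a : ℝ) : Measure ℝ :=
  if 0 < a then gammaMeasure a 1 else Measure.dirac 0

/-- The Dirichlet distribution with parameters `a i ≥ 0`, not all zero: the law of
`(x i / ∑ j, x j) i` for independent `x i` with law Gamma(`a i`, 1). Coordinates with parameter
zero are almost surely zero. -/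
def dirichlet {ι : Type*} [Fintype ι] (a : ι → ℝ) : Measure (ι → ℝ) :=
  (Measure.pi fun i => unitGamma (a i)).map fun x i => x i / ∑ j, x j

/-- `Q` is the law `DP(α, H)` of the Dirichlet process: under `Q`, for every finite measurable
partition `A 0, …, A (n - 1)` of the space, the vector of the random masses of the `A i` has the
Dirichlet distribution with parameters `α * H (A i)`. -/
def IsDirichletProcess {X : Type*} [MeasurableSpace X] (α : ℝ) (H : Measure X)
    (Q : Measure (ProbabilityMeasure X)) : Prop :=
  ∀ (n : ℕ) (A : Fin n → Set X), (∀ i, MeasurableSet (A i)) →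
    Pairwise (fun i j => Disjoint (A i) (A j)) → (⋃ i, A i) = Set.univ →
    Q.map (fun (G : ProbabilityMeasure X) i => (G : Measure X).real (A i)) =
      dirichlet fun i => α * H.real (A i)

/-- `κ` is the kernel `μ ↦ DP(α, μ)`. -/
def IsDPKernel {X : Type*} [MeasurableSpace X] (α : ℝ)
    (κ : Kernel (ProbabilityMeasure X) (ProbabilityMeasure X)) : Prop :=
  ∀ μ : ProbabilityMeasure X, IsDirichletProcess α (μ : Measure X) (κ μ)

/-- Conditionally on `Y`, the random elements `X 0, X 1, …` are independent, each with
conditional law `κ Y`. -/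
def CondIID {Ω S T : Type*} [MeasurableSpace Ω] [MeasurableSpace S] [MeasurableSpace T]
    (P : Measure Ω) (Y : Ω → S) (X : ℕ → Ω → T) (κ : S → Measure T) : Prop :=
  ∀ (s : Finset ℕ) (A : Set S) (B : ℕ → Set T), MeasurableSet A → (∀ r, MeasurableSet (B r)) →
    P (Y ⁻¹' A ∩ ⋂ r ∈ s, X r ⁻¹' B r) = ∫⁻ ω in Y ⁻¹' A, ∏ r ∈ s, κ (Y ω) (B r) ∂P

/-! ### The spaces of the levels -/

/-- Iterated spaces of probability measures, with their σ-algebras. -/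
def levelSpace (Θ : Type u) [m : MeasurableSpace Θ] : ℕ → (X : Type u) × MeasurableSpace X
  | 0 => ⟨Θ, m⟩
  | l + 1 =>
    letI := (levelSpace Θ l).2
    ⟨ProbabilityMeasure (levelSpace Θ l).1, inferInstance⟩

/-- The space in which the atoms of level `l` live: `Θ` for `l = 0`, and the probability measures
on `Level Θ l` for level `l + 1`. The σ-algebra on probability measures is generated by the
evaluations at measurable sets. -/
def Level (Θ : Type u) [MeasurableSpace Θ] (l : ℕ) : Type u := (levelSpace Θ l).1

instance Level.instMeasurableSpace (Θ : Type u) [MeasurableSpace Θ] (l : ℕ) :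
    MeasurableSpace (Level Θ l) := (levelSpace Θ l).2

/-- A probability measure on `Level Θ l` is a point of `Level Θ (l + 1)`. -/
def asPoint {Θ : Type u} [MeasurableSpace Θ] {l : ℕ} (μ : ProbabilityMeasure (Level Θ l)) :
    Level Θ (l + 1) := μ

/-- A point of `Level Θ (l + 1)` is a probability measure on `Level Θ l`. -/
def asMeasure {Θ : Type u} [MeasurableSpace Θ] {l : ℕ} (x : Level Θ (l + 1)) :
    ProbabilityMeasure (Level Θ l) := x

/-- A measure on `Θ`, seen as a measure on `Level Θ 0`. -/
def asBase {Θ : Type u} [MeasurableSpace Θ] (H : Measure Θ) : Measure (Level Θ 0) := H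

/-- The atoms of level `l`: the `φ k` for `l = 0`, and the group measures of level `l` for
level `l + 1`. -/
def atoms {Θ : Type u} [MeasurableSpace Θ] {Ω : Type v} (φ : ℕ → Ω → Θ)
    (G : (l : ℕ) → ℕ → Ω → ProbabilityMeasure (Level Θ l)) : (l : ℕ) → ℕ → Ω → Level Θ l
  | 0 => φ
  | l + 1 => fun k ω => asPoint (G l k ω)

/-! ### The nested hierarchical Dirichlet process -/

/-- Conditionally on `Y`, the random measure `Z` has law `DP(γ, DP(α, Y))`. -/
def IsNestedStep {X Ω : Type*} [MeasurableSpace X] [MeasurableSpace Ω] (γ α : ℝ)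
    (P : Measure Ω) (Y : Ω → ProbabilityMeasure X)
    (Z : Ω → ProbabilityMeasure (ProbabilityMeasure X)) : Prop :=
  ∃ (κ : Kernel (ProbabilityMeasure X) (ProbabilityMeasure X))
    (ρ : Kernel (ProbabilityMeasure X) (ProbabilityMeasure (ProbabilityMeasure X))),
    IsDPKernel α κ ∧ (∀ μ, IsDirichletProcess γ (κ μ) (ρ μ)) ∧ HasCondDistrib Z Y ρ P

/-- `(G₀ l, G l 0, G l 1, …)`, `l ≤ L`, are the base measures and the group measures of a nested
hierarchical Dirichlet process with levels `0, …, L`: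
`G₀ 0 ∼ DP(γ 0, H)`; given `G₀ l`, the groups `G l r` are i.i.d. `DP(α l, G₀ l)`; and the base
distribution of the next level is the law of these groups, that is, given `G₀ l`,
`G₀ (l + 1) ∼ DP(γ (l + 1), DP(α l, G₀ l))`. Nothing else is asked of the coupling between
different levels, so that `G₀ (l + 1)` may, but need not, be built on the atoms `G l r`. -/
structure IsNestedHDP {Θ : Type u} [MeasurableSpace Θ] (L : ℕ) (γ α : ℕ → ℝ) (H : Measure Θ)
    {Ω : Type v} [MeasurableSpace Ω] (P : Measure Ω)
    (G₀ : (l : ℕ) → Ω → ProbabilityMeasure (Level Θ l))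
    (G : (l : ℕ) → ℕ → Ω → ProbabilityMeasure (Level Θ l)) : Prop where
  measurable_base : ∀ l ≤ L, Measurable (G₀ l)
  measurable_group : ∀ l ≤ L, ∀ r, Measurable (G l r)
  base_zero : IsDirichletProcess (γ 0) (asBase H) (P.map (G₀ 0))
  group : ∀ l ≤ L, ∃ κ : Kernel (ProbabilityMeasure (Level Θ l)) (ProbabilityMeasure (Level Θ l)),
    IsDPKernel (α l) κ ∧ CondIID P (G₀ l) (G l) κ
  base_succ : ∀ l < L, IsNestedStep (X := Level Θ l) (γ (l + 1)) (α l) P (G₀ l) (G₀ (l + 1))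

/-! ### The multi-level finite mixture -/

/-- One level of the finite mixture, with `K` atoms `a 0, …, a (K - 1)`:
`β ∼ Dir(γ / K, …, γ / K)`; given `β`, the `π r` are i.i.d. `Dir(α β)`;
`B = ∑ k < K, β k δ_(a k)` and `D r = ∑ k < K, π r k δ_(a k)`. -/
structure IsFiniteLevel {X Ω : Type*} [MeasurableSpace X] [MeasurableSpace Ω]
    (K : ℕ) (γ α : ℝ) (P : Measure Ω) (a : ℕ → Ω → X)
    (β : Ω → Fin K → ℝ) (π : ℕ → Ω → Fin K → ℝ)
    (B : Ω → ProbabilityMeasure X) (D : ℕ → Ω → ProbabilityMeasure X) : Prop where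
  measurable_weight : Measurable β
  measurable_groupWeight : ∀ r, Measurable (π r)
  measurable_base : Measurable B
  measurable_group : ∀ r, Measurable (D r)
  weight_law : P.map β = dirichlet fun _ => γ / K
  groupWeight_law : CondIID P β π fun b => dirichlet fun k => α * b k
  base_eq : ∀ᵐ ω ∂P, (B ω : Measure X) = ∑ k : Fin K, ENNReal.ofReal (β ω k) • Measure.dirac (a k ω)
  group_eq : ∀ r, ∀ᵐ ω ∂P,
    (D r ω : Measure X) = ∑ k : Fin K, ENNReal.ofReal (π r ω k) • Measure.dirac (a k ω)

/-- The multi-level finite mixture with levels `0, …, L` and `K l` atoms at level `l`: the `φ k`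
are i.i.d. with law `H`, the weights of the different levels are independent of each other and of
the `φ k`, and the group measures of level `l` are the atoms of level `l + 1` (which only uses the
first `K (l + 1)` of them; the groups are indexed by all of `ℕ` for convenience). -/
structure IsFiniteMixture {Θ : Type u} [MeasurableSpace Θ] (L : ℕ) (K : ℕ → ℕ) (γ α : ℕ → ℝ)
    (H : Measure Θ) {Ω : Type v} [MeasurableSpace Ω] (P : Measure Ω) (φ : ℕ → Ω → Θ)
    (β : (l : ℕ) → Ω → Fin (K l) → ℝ) (π : (l : ℕ) → ℕ → Ω → Fin (K l) → ℝ)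
    (G₀ : (l : ℕ) → Ω → ProbabilityMeasure (Level Θ l))
    (G : (l : ℕ) → ℕ → Ω → ProbabilityMeasure (Level Θ l)) : Prop where
  measurable_atom : ∀ k, Measurable (φ k)
  atom_law : ∀ k, P.map (φ k) = H
  atom_indep : iIndepFun φ P
  level : ∀ l ≤ L,
    IsFiniteLevel (K l) (γ l) (α l) P (atoms φ G l) (β l) (π l) (G₀ l) (G l)
  weight_indep : ∀ l ≤ L, IndepFun
    (fun ω => (β l ω, fun r => π l r ω))
    (fun ω => ((fun k => φ k ω), fun j : Fin l => (β j ω, fun r => π j r ω))) P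

/-! ### Test functions and convergence -/

/-- Test functions of level `l`. At level `0`: measurable `H`-integrable functions. At level
`l + 1`: functions `μ ↦ F (∫ f 0 ∂μ, …, ∫ f (m - 1) ∂μ)` with `F` bounded and continuous and the
`f i` test functions of level `l`. -/
def IsTestFunction {Θ : Type u} [MeasurableSpace Θ] (H : Measure Θ) :
    (l : ℕ) → (Level Θ l → ℝ) → Prop
  | 0, g => Measurable g ∧ Integrable g (asBase H)
  | l + 1, g => ∃ (m : ℕ) (f : Fin m → Level Θ l → ℝ) (F : (Fin m → ℝ) →ᵇ ℝ),
      (∀ i, IsTestFunction H l (f i)) ∧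
      ∀ x : Level Θ (l + 1), g x = F fun i => ∫ y, f i y ∂(asMeasure x : Measure (Level Θ l))

/-- The integrals of `g i` against the base measure `B` (if `r i = none`) or against the group
measure `D s` (if `r i = some s`), as a random vector. -/
def integrals {X : Type*} {Ω : Type*} [MeasurableSpace X] {n : ℕ} (B : Ω → ProbabilityMeasure X)
    (D : ℕ → Ω → ProbabilityMeasure X) (r : Fin n → Option ℕ) (g : Fin n → X → ℝ) (ω : Ω) :
    Fin n → ℝ :=
  fun i => ∫ x, g i x ∂((r i).elim (B ω) fun s => D s ω : ProbabilityMeasure X).toMeasure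

end

open scoped Topology

/-! ### Gamma distributions -/

/-! Everything is reduced to mixed moments `E ∏ ∫ g j dG` with bounded `g j`, and the engine is the
Pólya urn. If `w` has law `Dir(a)` with `|a| = ∑ a k`, then for linear functionals `(|a| + n) E[⟨h,
w⟩ ∏ ⟨c j, w⟩] = ⟨h, a⟩ E[∏ ⟨c j, w⟩] + ∑ j, E[∏ with c j replaced by c j * h]`, the product running
over `n` factors (`integral_dirichlet_linear`). Applied to the masses of a partition and extended
from step functions to bounded measurable ones, this becomes a recursion for every Dirichlet process
(`IsDirichletProcess.polyaRecursion`). It lowers the number of factors, so it determines all mixed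
moments and thereby the law (`PolyaRecursion.unique`). No topology on the underlying space is
needed.

Groups. For fixed atoms `x k` and `p ∼ Dir(α b)`, the measure `∑ p k δ_(x k)` satisfies the
recursion with base `∑ b k δ_(x k)`, so it is a Dirichlet process around that base. Hence already
for finite `K` the group measures are, given the base measure, exactly i.i.d. `DP(α, base)`
(`IsFiniteLevel.condIID`). The recursion also shows that averaging over `DP(α, μ)` turns polynomials
in integrals against `G` into polynomials in integrals against `μ`. Convergence of the moments of
the base measures therefore gives joint convergence of base and groups
(`tendstoInDistribution_integrals`).

Base measure. With `β ∼ Dir(γ/K, …, γ/K)` the finite base measure obeys the recursion of `DP(γ, ν)`,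
except that `∫ f dν` is replaced by the empirical mean of `f` over the `K` atoms. If the atoms are
conditionally i.i.d. with random law `κ Y`, this mean is within `O(1/√K)` of `∫ f d(κ Y)` in `L¹`.
Induction on the number of factors gives the moments of `DP(γ, κ Y')` in the limit, provided that
the moments of `κ Y` converge to those of `κ Y'` (`tendsto_integral_prod_integral_mixture`).

Levels. The atoms of level `l + 1` are the groups of level `l`, conditionally i.i.d. given the base
measure there. A product `∏ ∫ h k d(κ Y)` is the conditional expectation of `∏ h k (A k)` over
distinct groups `A k`. For cylinder functions `h k` its mean is thus the mean of a bounded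
continuous function of group integrals, which converges by the result at level `l`
(`tendsto_integral_prod_cylinder`).

At level `0`, and in the successive limit, the law of `κ Y` does not depend on `K`. Then all bounded
measurable functions are admissible, and truncation reaches integrable ones, because all the random
measures share one mean measure `m` and `E |∫ g dG - ∫ g' dG| ≤ ∫ |g - g'| dm`. -/

instance unitGamma.instIsProbabilityMeasure (a : ℝ) : IsProbabilityMeasure (unitGamma a) := by
  unfold unitGamma
  split_ifs with h
  · exact isProbabilityMeasure_gammaMeasure h one_pos
  · infer_instance

lemma unitGamma_of_pos {a : ℝ} (h : 0 < a) : unitGamma a = gammaMeasure a 1 := if_pos h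

lemma unitGamma_zero : unitGamma 0 = Measure.dirac 0 := if_neg (lt_irrefl _)

lemma measurable_gammaPDF (a r : ℝ) : Measurable (gammaPDF a r) :=
  (measurable_gammaPDFReal a r).ennreal_ofReal

lemma ae_pos_unitGamma {a : ℝ} (h : 0 < a) : ∀ᵐ x ∂unitGamma a, 0 < x := by
  rw [unitGamma_of_pos h, gammaMeasure, ae_withDensity_iff (measurable_gammaPDF a 1)]
  have h0 : ∀ᵐ x : ℝ, x ≠ 0 := by simp [ae_iff]
  filter_upwards [h0] with x hx h'
  by_contra hneg
  exact h' (gammaPDF_of_neg (lt_of_le_of_ne (not_lt.mp hneg) hx))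

lemma ae_nonneg_unitGamma (a : ℝ) : ∀ᵐ x ∂unitGamma a, 0 ≤ x := by
  by_cases h : 0 < a
  · filter_upwards [ae_pos_unitGamma h] with x hx using hx.le
  · rw [unitGamma, if_neg h, ae_dirac_iff measurableSet_Ici]

/-- Size biasing raises the shape by one, because `Γ(a + 1) = a Γ(a)`. For `a = 0` both sides
vanish. -/
lemma withDensity_unitGamma_self {a : ℝ} (ha : 0 ≤ a) :
    (unitGamma a).withDensity (fun x => ENNReal.ofReal x) =
      ENNReal.ofReal a • unitGamma (a + 1) := by
  rcases ha.eq_or_lt with rfl | ha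
  · rw [unitGamma_zero]
    ext s hs
    rw [withDensity_apply _ hs, ← lintegral_indicator hs, lintegral_dirac']
    · simp [Set.indicator]
    · exact ENNReal.measurable_ofReal.indicator hs
  · rw [unitGamma_of_pos ha, unitGamma_of_pos (by linarith), gammaMeasure, gammaMeasure,
      ← withDensity_mul _ (measurable_gammaPDF a 1) ENNReal.measurable_ofReal,
      ← withDensity_smul _ (measurable_gammaPDF (a + 1) 1)]
    refine withDensity_congr_ae ?_
    have h0 : ∀ᵐ x : ℝ, x ≠ 0 := by simp [ae_iff]
    filter_upwards [h0] with x hx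
    simp only [Pi.mul_apply, Pi.smul_apply, smul_eq_mul]
    rcases lt_or_ge x 0 with h | h
    · simp [gammaPDF_of_neg h]
    · have hx' : 0 < x := lt_of_le_of_ne h hx.symm
      rw [gammaPDF_of_nonneg h, gammaPDF_of_nonneg h, ← ENNReal.ofReal_mul (by positivity),
        ← ENNReal.ofReal_mul ha.le, Real.Gamma_add_one ha.ne', Real.rpow_sub_one hx]
      congr 1
      have := (Real.Gamma_pos_of_pos ha).ne'
      simp only [Real.one_rpow, add_sub_cancel_right]
      field_simp

/-- Exponential tilting changes the rate from `1` to `1 + t`, which is a rescaling of the variable;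
the constant is the Laplace transform. The scale does not depend on the shape `a`, and this is what
makes normalised vectors insensitive to tilting. -/
lemma withDensity_unitGamma_exp {a t : ℝ} (ha : 0 ≤ a) (ht : 0 ≤ t) :
    (unitGamma a).withDensity (fun x => ENNReal.ofReal (Real.exp (-(t * x)))) =
      ENNReal.ofReal ((1 + t) ^ (-a)) • (unitGamma a).map (fun x => x / (1 + t)) := by
  have hc : 0 < 1 + t := by linarith
  have hm : Measurable fun x : ℝ => ENNReal.ofReal (Real.exp (-(t * x))) := by fun_prop
  rcases ha.eq_or_lt with rfl | ha
  · rw [unitGamma_zero, Measure.map_dirac' (by fun_prop)]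
    ext s hs
    rw [withDensity_apply _ hs, ← lintegral_indicator hs, lintegral_dirac' _ (hm.indicator hs)]
    simp [Set.indicator, hs]
  · rw [unitGamma_of_pos ha, gammaMeasure]
    ext s hs
    rw [← withDensity_mul _ (measurable_gammaPDF a 1) hm, withDensity_apply _ hs,
      ← lintegral_indicator hs, Measure.smul_apply, Measure.map_apply (by fun_prop) hs,
      withDensity_apply _ ((by fun_prop : Measurable fun x : ℝ => x / (1 + t)) hs),
      ← lintegral_indicator ((by fun_prop : Measurable fun x : ℝ => x / (1 + t)) hs)]
    -- The substitution `x ↦ x / (1 + t)` is made on the left, so that both sides become Lebesgue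
    -- integrals in the same variable.
    conv_lhs => rw [← Real.smul_map_volume_mul_left (inv_ne_zero hc.ne')]
    rw [lintegral_smul_measure,
      lintegral_map ((measurable_gammaPDF a 1).mul hm |>.indicator hs) (by fun_prop),
      smul_eq_mul, smul_eq_mul, ← lintegral_const_mul' _ _ (by simp),
      ← lintegral_const_mul' _ _ (by simp)]
    congr 1 with x
    have e (x : ℝ) : (1 + t)⁻¹ * x = x / (1 + t) := by field_simp
    rw [e]
    by_cases hx : x / (1 + t) ∈ s
    · rw [Set.indicator_of_mem hx, Set.indicator_of_mem (by exact hx)]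
      simp only [Pi.mul_apply]
      rcases lt_or_ge x 0 with h | h
      · rw [gammaPDF_of_neg h, gammaPDF_of_neg (div_neg_of_neg_of_pos h hc)]; simp
      · have h' : 0 ≤ x / (1 + t) := by positivity
        have := (Real.Gamma_pos_of_pos ha)
        rw [gammaPDF_of_nonneg h, gammaPDF_of_nonneg h', ← ENNReal.ofReal_mul (by positivity),
          ← ENNReal.ofReal_mul (by positivity), ← ENNReal.ofReal_mul (by positivity)]
        congr 1
        have e2 : Real.exp (-(1 * (x / (1 + t)))) * Real.exp (-(t * (x / (1 + t)))) =
            Real.exp (-(1 * x)) := by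
          rw [← Real.exp_add]; congr 1; field_simp; ring
        rw [← e2, abs_of_pos (by positivity), Real.div_rpow h hc.le, Real.rpow_sub_one hc.ne',
          Real.rpow_neg hc.le]
        field_simp
    · rw [Set.indicator_of_notMem hx, Set.indicator_of_notMem (by exact hx)]
      simp

/-! ### Products of measures with densities -/

section Pi

variable {ι : Type*} [Fintype ι]

lemma pi_withDensity {X : ι → Type*} [∀ i, MeasurableSpace (X i)] (μ : ∀ i, Measure (X i))
    [∀ i, IsProbabilityMeasure (μ i)] (f : ∀ i, X i → ℝ≥0∞) (hf : ∀ i, Measurable (f i))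
    [∀ i, SigmaFinite ((μ i).withDensity (f i))] :
    (Measure.pi μ).withDensity (fun x => ∏ i, f i (x i)) =
      Measure.pi fun i => (μ i).withDensity (f i) := by
  refine (Measure.pi_eq fun s hs => ?_).symm
  rw [withDensity_apply _ (MeasurableSet.univ_pi hs), ← lintegral_indicator (MeasurableSet.univ_pi hs)]
  have h : ∀ x : ∀ i, X i, (Set.univ.pi s).indicator (fun x => ∏ i, f i (x i)) x =
      ∏ i, (s i).indicator (f i) (x i) := by
    intro x
    by_cases hx : x ∈ Set.univ.pi s
    · rw [Set.indicator_of_mem hx]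
      refine Finset.prod_congr rfl fun i _ => ?_
      rw [Set.indicator_of_mem (hx i (Set.mem_univ i))]
    · rw [Set.indicator_of_notMem hx]
      simp only [Set.mem_univ_pi, not_forall] at hx
      obtain ⟨i, hi⟩ := hx
      exact (Finset.prod_eq_zero (Finset.mem_univ i) (Set.indicator_of_notMem hi _)).symm
  simp_rw [h]
  have hind : iIndepFun (fun i (x : ∀ i, X i) => (s i).indicator (f i) (x i)) (Measure.pi μ) :=
    iIndepFun_pi fun i => ((hf i).indicator (hs i)).aemeasurable
  rw [lintegral_prod_eq_prod_lintegral_of_indepFun _ _ hind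
    fun i => ((hf i).indicator (hs i)).comp (measurable_pi_apply i)]
  refine Finset.prod_congr rfl fun i _ => ?_
  rw [withDensity_apply _ (hs i), ← lintegral_indicator (hs i)]
  exact (measurePreserving_eval μ i).lintegral_comp ((hf i).indicator (hs i))

lemma pi_smul {X : ι → Type*} [∀ i, MeasurableSpace (X i)] (μ : ∀ i, Measure (X i))
    [∀ i, IsProbabilityMeasure (μ i)] (c : ι → ℝ≥0∞) [∀ i, SigmaFinite (c i • μ i)] :
    Measure.pi (fun i => c i • μ i) = (∏ i, c i) • Measure.pi μ := by
  refine Measure.pi_eq fun s hs => ?_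
  simp [Finset.prod_mul_distrib]

lemma sigmaFinite_smul_of_ne_top {X : Type*} [MeasurableSpace X] (μ : Measure X) [IsFiniteMeasure μ]
    {c : ℝ≥0∞} (hc : c ≠ ∞) : SigmaFinite (c • μ) := by
  have : IsFiniteMeasure (c • μ) := Measure.smul_finite μ hc
  infer_instance

end Pi

/-! ### Moments of the Dirichlet distribution -/

lemma add_single_nonneg {ι : Type*} [DecidableEq ι] {a : ι → ℝ} (ha : ∀ i, 0 ≤ a i) (k i : ι) :
    0 ≤ (a + Pi.single k (1 : ℝ) : ι → ℝ) i :=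
  add_nonneg (ha i) (by by_cases hik : i = k <;> [subst hik; skip] <;> simp [*])

section Dirichlet

variable {ι : Type*} [Fintype ι]

/-- The independent Gamma variables of which the Dirichlet distribution is made. -/
noncomputable def gammaPi (a : ι → ℝ) : Measure (ι → ℝ) := Measure.pi fun i => unitGamma (a i)

instance (a : ι → ℝ) : IsProbabilityMeasure (gammaPi a) := by unfold gammaPi; infer_instance

/-- Division of a vector by the sum of its coordinates. -/
noncomputable def normalizeSum (x : ι → ℝ) : ι → ℝ := fun i => x i / ∑ j, x j

@[fun_prop]
lemma measurable_normalizeSum : Measurable (normalizeSum : (ι → ℝ) → ι → ℝ) := by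
  unfold normalizeSum; fun_prop

lemma dirichlet_eq_map (a : ι → ℝ) : dirichlet a = (gammaPi a).map normalizeSum := rfl

instance dirichlet.instIsProbabilityMeasure (a : ι → ℝ) : IsProbabilityMeasure (dirichlet a) :=
  Measure.isProbabilityMeasure_map measurable_normalizeSum.aemeasurable

lemma normalizeSum_div {c : ℝ} (hc : c ≠ 0) (x : ι → ℝ) :
    normalizeSum (fun i => x i / c) = normalizeSum x := by
  funext i
  simp only [normalizeSum, ← Finset.sum_div]
  exact div_div_div_cancel_right₀ hc _ _

lemma ae_nonneg_gammaPi (a : ι → ℝ) :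
    ∀ᵐ x ∂gammaPi a, ∀ i, 0 ≤ x i := by
  rw [ae_all_iff]
  exact fun i => (measurePreserving_eval (fun i => unitGamma (a i)) i).quasiMeasurePreserving.ae
    (ae_nonneg_unitGamma (a i))

lemma ae_sum_pos_gammaPi {a : ι → ℝ} (h : 0 < ∑ i, a i) :
    ∀ᵐ x ∂gammaPi a, 0 < ∑ i, x i := by
  obtain ⟨i, -, hi⟩ := Finset.exists_lt_of_sum_lt (s := Finset.univ) (f := fun _ => (0 : ℝ))
    (g := a) (by simpa using h)
  have h1 : ∀ᵐ x ∂gammaPi a, 0 < x i :=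
    (measurePreserving_eval (fun i => unitGamma (a i)) i).quasiMeasurePreserving.ae
      (ae_pos_unitGamma hi)
  filter_upwards [ae_nonneg_gammaPi a, h1] with x hx hxi
  exact Finset.sum_pos' (fun j _ => hx j) ⟨i, Finset.mem_univ i, hxi⟩

/-- By independence the bias by `x k` acts on the `k`-th factor alone, where it is size biasing of a
Gamma law. -/
lemma lintegral_gammaPi_smul [DecidableEq ι] {a : ι → ℝ} (ha : ∀ i, 0 ≤ a i) (k : ι)
    {f : (ι → ℝ) → ℝ≥0∞} (hf : Measurable f) :
    ∫⁻ x, ENNReal.ofReal (x k) * f x ∂gammaPi a =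
      ENNReal.ofReal (a k) * ∫⁻ x, f x ∂gammaPi (a + Pi.single k 1) := by
  have hw : ∀ i, (unitGamma (a i)).withDensity
      (fun x => if i = k then ENNReal.ofReal x else 1) =
      (if i = k then ENNReal.ofReal (a k) else 1) • unitGamma ((a + Pi.single k (1 : ℝ) : ι → ℝ) i) := by
    intro i
    by_cases h : i = k
    · subst h
      simp [withDensity_unitGamma_self (ha i)]
    · simp [h]
  have hs : ∀ i, SigmaFinite ((if i = k then ENNReal.ofReal (a k) else 1) •
      unitGamma ((a + Pi.single k (1 : ℝ) : ι → ℝ) i)) := fun i =>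
    sigmaFinite_smul_of_ne_top _ (by split_ifs <;> simp)
  have hs' : ∀ i, SigmaFinite ((unitGamma (a i)).withDensity
      (fun x => if i = k then ENNReal.ofReal x else 1)) := fun i => by rw [hw]; exact hs i
  have key : (gammaPi a).withDensity (fun x => ENNReal.ofReal (x k)) =
      ENNReal.ofReal (a k) • gammaPi (a + Pi.single k 1) := by
    have h1 := pi_withDensity (fun i => unitGamma (a i))
      (fun i x => if i = k then ENNReal.ofReal x else 1)
      (fun i => by split_ifs <;> fun_prop)
    simp_rw [hw] at h1
    rw [pi_smul] at h1
    simpa [gammaPi] using h1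
  rw [← smul_eq_mul, ← lintegral_smul_measure, ← key,
    lintegral_withDensity_eq_lintegral_mul _ (by fun_prop) hf]
  rfl

/-- Tilting by the total rescales all coordinates by the same factor, and normalisation does not see
it. This is the independence of the total and the normalised vector, expressed through Laplace
transforms. -/
lemma lintegral_gammaPi_exp {a : ι → ℝ} (ha : ∀ i, 0 ≤ a i) {t : ℝ} (ht : 0 ≤ t)
    {f : (ι → ℝ) → ℝ≥0∞} (hf : Measurable f) :
    ∫⁻ x, ENNReal.ofReal (Real.exp (-(t * ∑ i, x i))) * f (normalizeSum x) ∂gammaPi a =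
      ENNReal.ofReal ((1 + t) ^ (-∑ i, a i)) * ∫⁻ x, f (normalizeSum x) ∂gammaPi a := by
  have hc : 0 < 1 + t := by linarith
  have hw := fun i => withDensity_unitGamma_exp (ha i) ht
  have : ∀ i, IsProbabilityMeasure ((unitGamma (a i)).map fun x => x / (1 + t)) := fun i =>
    Measure.isProbabilityMeasure_map (by fun_prop)
  have hs : ∀ i, SigmaFinite (ENNReal.ofReal ((1 + t) ^ (-a i)) •
      (unitGamma (a i)).map fun x => x / (1 + t)) := fun i =>
    sigmaFinite_smul_of_ne_top _ (by simp)
  have hs' : ∀ i, SigmaFinite ((unitGamma (a i)).withDensity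
      fun x => ENNReal.ofReal (Real.exp (-(t * x)))) := fun i => by rw [hw]; exact hs i
  have key : (gammaPi a).withDensity (fun x => ENNReal.ofReal (Real.exp (-(t * ∑ i, x i)))) =
      ENNReal.ofReal ((1 + t) ^ (-∑ i, a i)) • (gammaPi a).map (fun x i => x i / (1 + t)) := by
    have h1 := pi_withDensity (fun i => unitGamma (a i))
      (fun i x => ENNReal.ofReal (Real.exp (-(t * x)))) (fun i => by fun_prop)
    simp_rw [hw] at h1
    rw [pi_smul, ← Measure.pi_map_pi (fun i => by fun_prop)] at h1
    rw [gammaPi]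
    convert h1 using 2
    · funext x
      rw [← ENNReal.ofReal_prod_of_nonneg (fun i _ => (Real.exp_pos _).le), ← Real.exp_sum,
        Finset.mul_sum, Finset.sum_neg_distrib]
    · rw [← ENNReal.ofReal_prod_of_nonneg (fun i _ => by positivity), ← Real.rpow_sum_of_pos hc,
        Finset.sum_neg_distrib]
  have hfn : Measurable fun x : ι → ℝ => f (normalizeSum x) := hf.comp measurable_normalizeSum
  have h2 := lintegral_withDensity_eq_lintegral_mul (gammaPi a)
    (f := fun x => ENNReal.ofReal (Real.exp (-(t * ∑ i, x i)))) (by fun_prop) hfn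
  simp only [Pi.mul_apply] at h2
  rw [← h2, key, lintegral_smul_measure, lintegral_map hfn (by fun_prop), smul_eq_mul]
  simp [normalizeSum_div hc.ne']

lemma lintegral_Ioi_exp_neg_mul {s : ℝ} (hs : 0 < s) :
    ∫⁻ t in Set.Ioi (0 : ℝ), ENNReal.ofReal (Real.exp (-(t * s))) = ENNReal.ofReal s⁻¹ := by
  have h := integral_exp_mul_Ioi (a := -s) (by linarith) 0
  have e : ∀ t : ℝ, -(t * s) = -s * t := fun t => by ring
  simp_rw [e]
  have hi : IntegrableOn (fun t : ℝ => Real.exp (-s * t)) (Set.Ioi 0) :=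
    integrableOn_exp_mul_Ioi (a := -s) (by linarith) 0
  rw [← ofReal_integral_eq_lintegral_ofReal hi (ae_of_all _ fun t => (Real.exp_pos _).le)]
  rw [h, mul_zero, Real.exp_zero, neg_div_neg_eq, one_div]

lemma lintegral_Ioi_one_add_rpow {b : ℝ} (hb : 1 < b) :
    ∫⁻ t in Set.Ioi (0 : ℝ), ENNReal.ofReal ((1 + t) ^ (-b)) = ENNReal.ofReal (b - 1)⁻¹ := by
  have h1 : ∫⁻ t in Set.Ioi (0 : ℝ), ENNReal.ofReal ((1 + t) ^ (-b)) =
      ∫⁻ t in Set.Ioi (1 : ℝ), ENNReal.ofReal (t ^ (-b)) := by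
    have := (measurePreserving_add_left (volume : Measure ℝ) 1).setLIntegral_comp_preimage
      (s := Set.Ioi (1 : ℝ)) measurableSet_Ioi (f := fun t : ℝ => ENNReal.ofReal (t ^ (-b)))
      (by fun_prop)
    rw [← this]
    simp
  rw [h1, ← ofReal_integral_eq_lintegral_ofReal
    (integrableOn_Ioi_rpow_of_lt (by linarith) one_pos)
    ((ae_restrict_iff' measurableSet_Ioi).mpr (ae_of_all _ fun t ht => by
      have : (0 : ℝ) < t := one_pos.trans ht
      positivity)),
    integral_Ioi_rpow_of_lt (by linarith) one_pos]
  congr 1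
  rw [Real.one_rpow, show -b + 1 = -(b - 1) by ring, neg_div_neg_eq, one_div]

/-- Writes `s⁻¹` as the integral of `exp (-(t * s))` over `t > 0` and exchanges integrals; what
remains is the integral of `(1 + t) ^ (-∑ a i)`, finite because the exponent exceeds one. -/
lemma lintegral_gammaPi_inv_sum {a : ι → ℝ} (ha : ∀ i, 0 ≤ a i) (h : 1 < ∑ i, a i)
    {f : (ι → ℝ) → ℝ≥0∞} (hf : Measurable f) :
    ∫⁻ x, ENNReal.ofReal (∑ i, x i)⁻¹ * f (normalizeSum x) ∂gammaPi a =
      ENNReal.ofReal ((∑ i, a i) - 1)⁻¹ * ∫⁻ x, f (normalizeSum x) ∂gammaPi a := by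
  have hfn : Measurable fun x : ι → ℝ => f (normalizeSum x) := hf.comp measurable_normalizeSum
  have h1 : ∫⁻ x, ENNReal.ofReal (∑ i, x i)⁻¹ * f (normalizeSum x) ∂gammaPi a =
      ∫⁻ x, (∫⁻ t in Set.Ioi (0 : ℝ),
        ENNReal.ofReal (Real.exp (-(t * ∑ i, x i))) * f (normalizeSum x)) ∂gammaPi a := by
    refine lintegral_congr_ae ?_
    filter_upwards [ae_sum_pos_gammaPi (by linarith)] with x hx
    rw [lintegral_mul_const _ (by fun_prop), lintegral_Ioi_exp_neg_mul hx]
  rw [h1, lintegral_lintegral_swap]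
  · rw [setLIntegral_congr_fun measurableSet_Ioi
      fun t ht => lintegral_gammaPi_exp ha (le_of_lt ht) hf,
      lintegral_mul_const _ (by fun_prop), lintegral_Ioi_one_add_rpow h]
  · refine Measurable.aemeasurable ?_
    exact (by fun_prop : Measurable fun p : (ι → ℝ) × ℝ =>
      ENNReal.ofReal (Real.exp (-(p.2 * ∑ i, p.1 i)))).mul (hfn.comp measurable_fst)

/-- Conjugacy of the Dirichlet distribution: biasing by a coordinate raises its parameter. -/
lemma lintegral_dirichlet_mul [DecidableEq ι] {a : ι → ℝ} (ha : ∀ i, 0 ≤ a i) (h : 0 < ∑ i, a i)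
    (k : ι) {f : (ι → ℝ) → ℝ≥0∞} (hf : Measurable f) :
    ∫⁻ w, ENNReal.ofReal (w k) * f w ∂dirichlet a =
      ENNReal.ofReal (a k / ∑ i, a i) * ∫⁻ w, f w ∂dirichlet (a + Pi.single k 1) := by
  have hfn : Measurable fun x : ι → ℝ => f (normalizeSum x) := hf.comp measurable_normalizeSum
  rw [dirichlet_eq_map, dirichlet_eq_map, lintegral_map (by fun_prop) measurable_normalizeSum,
    lintegral_map hf measurable_normalizeSum]
  have h1 : ∫⁻ x, ENNReal.ofReal (normalizeSum x k) * f (normalizeSum x) ∂gammaPi a =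
      ∫⁻ x, ENNReal.ofReal (x k) * (ENNReal.ofReal (∑ i, x i)⁻¹ * f (normalizeSum x))
        ∂gammaPi a := by
    refine lintegral_congr_ae ?_
    filter_upwards [ae_nonneg_gammaPi a] with x hx
    rw [← mul_assoc, ← ENNReal.ofReal_mul (hx k), normalizeSum, div_eq_mul_inv]
  have hsum : ∑ i, (a + Pi.single k (1 : ℝ) : ι → ℝ) i = ∑ i, a i + 1 := by
    simp [Finset.sum_add_distrib]
  -- The bias by `x k` comes first: it raises the parameter sum to `∑ a i + 1 > 1`. The inverse sum
  -- is then integrable, and its factor is exactly `(∑ a i)⁻¹`.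
  rw [h1, lintegral_gammaPi_smul ha k (f := fun x => ENNReal.ofReal (∑ i, x i)⁻¹ *
    f (normalizeSum x)) (by fun_prop),
    lintegral_gammaPi_inv_sum (a := a + Pi.single k 1) (fun i => add_nonneg (ha i) (by
      by_cases hik : i = k
      · subst hik; simp
      · simp [hik])) (by rw [hsum]; linarith) hf, hsum, add_sub_cancel_right,
    ← mul_assoc, ← ENNReal.ofReal_mul (ha k), div_eq_mul_inv]

lemma ae_nonneg_dirichlet (a : ι → ℝ) : ∀ᵐ w ∂dirichlet a, ∀ i, 0 ≤ w i := by
  rw [dirichlet_eq_map, ae_map_iff measurable_normalizeSum.aemeasurable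
    (by
      simp_rw [Set.ofPred_forall]
      exact MeasurableSet.iInter fun i => measurableSet_le measurable_const (measurable_pi_apply i))]
  filter_upwards [ae_nonneg_gammaPi a] with x hx i
  exact div_nonneg (hx i) (Finset.sum_nonneg fun j _ => hx j)

lemma ae_le_one_dirichlet (a : ι → ℝ) : ∀ᵐ w ∂dirichlet a, ∀ i, w i ≤ 1 := by
  rw [dirichlet_eq_map, ae_map_iff measurable_normalizeSum.aemeasurable
    (by
      simp_rw [Set.ofPred_forall]
      exact MeasurableSet.iInter fun i => measurableSet_le (measurable_pi_apply i) measurable_const)]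
  filter_upwards [ae_nonneg_gammaPi a] with x hx i
  exact div_le_one_of_le₀ (Finset.single_le_sum (fun j _ => hx j) (Finset.mem_univ i))
    (Finset.sum_nonneg fun j _ => hx j)

lemma ae_sum_eq_one_dirichlet {a : ι → ℝ} (h : 0 < ∑ i, a i) :
    ∀ᵐ w ∂dirichlet a, ∑ i, w i = 1 := by
  rw [dirichlet_eq_map, ae_map_iff measurable_normalizeSum.aemeasurable
    (measurableSet_eq_fun (by fun_prop) measurable_const)]
  filter_upwards [ae_sum_pos_gammaPi h] with x hx
  simp only [normalizeSum, ← Finset.sum_div]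
  exact div_self hx.ne'

lemma integral_dirichlet_mul [DecidableEq ι] {a : ι → ℝ} (ha : ∀ i, 0 ≤ a i) (h : 0 < ∑ i, a i)
    (k : ι) {f : (ι → ℝ) → ℝ} (hf : Measurable f) (hf0 : ∀ w : ι → ℝ, (∀ i, 0 ≤ w i) → 0 ≤ f w) :
    ∫ w, w k * f w ∂dirichlet a =
      a k / (∑ i, a i) * ∫ w, f w ∂dirichlet (a + Pi.single k 1) := by
  rw [integral_eq_lintegral_of_nonneg_ae, integral_eq_lintegral_of_nonneg_ae]
  · have h1 : ∫⁻ w, ENNReal.ofReal (w k * f w) ∂dirichlet a =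
        ∫⁻ w, ENNReal.ofReal (w k) * ENNReal.ofReal (f w) ∂dirichlet a := by
      refine lintegral_congr_ae ?_
      filter_upwards [ae_nonneg_dirichlet a] with w hw
      rw [ENNReal.ofReal_mul (hw k)]
    rw [h1, lintegral_dirichlet_mul ha h k hf.ennreal_ofReal, ENNReal.toReal_mul,
      ENNReal.toReal_ofReal (div_nonneg (ha k) h.le)]
  · filter_upwards [ae_nonneg_dirichlet (a + Pi.single k 1)] with w hw using hf0 w hw
  · exact hf.aestronglyMeasurable
  · filter_upwards [ae_nonneg_dirichlet a] with w hw using mul_nonneg (hw k) (hf0 w hw)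
  · exact ((measurable_pi_apply k).mul hf).aestronglyMeasurable

lemma sum_add_single [DecidableEq ι] (a : ι → ℝ) (k : ι) :
    ∑ i, (a + Pi.single k (1 : ℝ) : ι → ℝ) i = ∑ i, a i + 1 := by
  simp [Finset.sum_add_distrib]

/-- The last step of the Pólya urn, for monomials. -/
lemma integral_dirichlet_monomial [DecidableEq ι] {n : ℕ} (i : Fin n → ι) (k : ι) {a : ι → ℝ}
    (ha : ∀ i, 0 ≤ a i) (h : 0 < ∑ i, a i) :
    (∑ i, a i + n) * ∫ w, w k * ∏ j, w (i j) ∂dirichlet a =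
      (a k + ∑ j, if i j = k then 1 else 0) * ∫ w, ∏ j, w (i j) ∂dirichlet a := by
  induction n generalizing a with
  | zero =>
    have h1 := integral_dirichlet_mul ha h k (f := fun _ => 1) (by fun_prop) (fun _ _ => zero_le_one)
    simp only [Finset.univ_eq_empty, Finset.prod_empty, h1, Finset.sum_empty]
    simp [mul_div_cancel₀ _ h.ne']
  | succ n ih =>
    have hm : Measurable fun w : ι → ℝ => ∏ j : Fin n, w (i j.succ) := by fun_prop
    have h0 : ∀ w : ι → ℝ, (∀ i, 0 ≤ w i) → 0 ≤ ∏ j : Fin n, w (i j.succ) :=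
      fun w hw => Finset.prod_nonneg fun j _ => hw _
    have e : ∀ w : ι → ℝ, w k * (w (i 0) * ∏ j : Fin n, w (i j.succ)) =
        w (i 0) * (w k * ∏ j : Fin n, w (i j.succ)) := fun w => by ring
    -- Conjugacy absorbs the factor `w (i 0)` into the parameters. The raised parameter at `k`
    -- accounts for the summand `j = 0`, and the raised total for the extra `1` in `n + 1`.
    have ih' := ih (fun j => i j.succ) (add_single_nonneg ha (i 0))
      (by rw [sum_add_single]; linarith)
    rw [sum_add_single] at ih'
    simp_rw [Fin.prod_univ_succ, e]
    rw [integral_dirichlet_mul ha h (i 0) hm h0, integral_dirichlet_mul ha h (i 0)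
      (f := fun w => w k * ∏ j : Fin n, w (i j.succ)) (by fun_prop) (fun w hw => mul_nonneg (hw k) (h0 w hw)),
      Fin.sum_univ_succ]
    have e2 : (a + Pi.single (i 0) (1 : ℝ) : ι → ℝ) k = a k + if i 0 = k then 1 else 0 := by
      by_cases hk : i 0 = k
      · subst hk; simp
      · simp [hk, Ne.symm hk]
    rw [e2] at ih'
    push_cast
    linear_combination (a (i 0) / ∑ i, a i) * ih'

lemma integrable_dirichlet_monomial {n : ℕ} (i : Fin n → ι) (a : ι → ℝ) :
    Integrable (fun w : ι → ℝ => ∏ j, w (i j)) (dirichlet a) := by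
  refine Integrable.of_bound (Measurable.aestronglyMeasurable (by fun_prop)) 1 ?_
  filter_upwards [ae_nonneg_dirichlet a, ae_le_one_dirichlet a] with w h0 h1
  rw [Real.norm_of_nonneg (Finset.prod_nonneg fun j _ => h0 _)]
  exact Finset.prod_le_one (fun j _ => h0 _) fun j _ => h1 _

/-- The last step of the Pólya urn, for products of linear functionals. -/
lemma integral_dirichlet_linear {n : ℕ} (h : ι → ℝ) (c : Fin n → ι → ℝ) {a : ι → ℝ}
    (ha : ∀ i, 0 ≤ a i) (hpos : 0 < ∑ i, a i) :
    (∑ i, a i + n) * ∫ w, (∑ k, h k * w k) * ∏ j, ∑ k, c j k * w k ∂dirichlet a =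
      (∑ k, h k * a k) * ∫ w, ∏ j, ∑ k, c j k * w k ∂dirichlet a +
      ∑ j, ∫ w, ∏ j', ∑ k, Function.update c j (fun k => c j k * h k) j' k * w k ∂dirichlet a := by
  classical
  set m : (Fin n → ι) → ℝ := fun i => ∫ w, ∏ j, w (i j) ∂dirichlet a with hm
  have hexp : ∀ (c : Fin n → ι → ℝ) (w : ι → ℝ), ∏ j, ∑ k, c j k * w k =
      ∑ i : Fin n → ι, (∏ j, c j (i j)) * ∏ j, w (i j) := by
    intro c w
    rw [Finset.prod_univ_sum, Fintype.piFinset_univ]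
    simp_rw [Finset.prod_mul_distrib]
  have hI : ∀ c : Fin n → ι → ℝ, ∫ w, ∏ j, ∑ k, c j k * w k ∂dirichlet a =
      ∑ i : Fin n → ι, (∏ j, c j (i j)) * m i := by
    intro c
    simp_rw [hexp]
    rw [integral_finsetSum _ fun i _ => (integrable_dirichlet_monomial i a).const_mul _]
    simp_rw [integral_const_mul, hm]
  have hL : ∫ w, (∑ k, h k * w k) * ∏ j, ∑ k, c j k * w k ∂dirichlet a =
      ∑ k, ∑ i : Fin n → ι, (h k * ∏ j, c j (i j)) * ∫ w, w k * ∏ j, w (i j) ∂dirichlet a := by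
    have hint : ∀ k (i : Fin n → ι), Integrable (fun w : ι → ℝ => w k * ∏ j, w (i j))
        (dirichlet a) := by
      intro k i
      simpa [Fin.prod_univ_succ] using integrable_dirichlet_monomial (Fin.cons k i : Fin (n+1) → ι) a
    have e : ∀ w : ι → ℝ, (∑ k, h k * w k) * ∏ j, ∑ k, c j k * w k =
        ∑ k, ∑ i : Fin n → ι, (h k * ∏ j, c j (i j)) * (w k * ∏ j, w (i j)) := by
      intro w
      rw [hexp, Finset.sum_mul_sum]
      exact Finset.sum_congr rfl fun k _ => Finset.sum_congr rfl fun i _ => by ring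
    simp_rw [e]
    rw [integral_finsetSum _ fun k _ => integrable_finsetSum _ fun i _ => (hint k i).const_mul _]
    refine Finset.sum_congr rfl fun k _ => ?_
    rw [integral_finsetSum _ fun i _ => (hint k i).const_mul _]
    simp_rw [integral_const_mul]
  -- The update at `j` multiplies the coefficient of the monomial `i` by `h (i j)`. Summed over `j`,
  -- this is the urn's count of the `j` with `i j = k`, weighted by `h k`.
  have hu : ∀ (j : Fin n) (i : Fin n → ι),
      ∏ j', Function.update c j (fun k => c j k * h k) j' (i j') = h (i j) * ∏ j, c j (i j) := by
    intro j i
    have : ∀ j', Function.update c j (fun k => c j k * h k) j' (i j') =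
        (if j' = j then h (i j) else 1) * c j' (i j') := by
      intro j'
      by_cases hj : j' = j
      · subst hj; simp [mul_comm]
      · simp [hj]
    simp_rw [this, Finset.prod_mul_distrib]
    simp
  rw [hL, hI]
  simp_rw [hI, hu]
  rw [Finset.mul_sum]
  simp_rw [Finset.mul_sum, mul_left_comm _ (h _ * _),
    integral_dirichlet_monomial _ _ ha hpos]
  conv_lhs => rw [Finset.sum_comm]
  conv_rhs => arg 2; rw [Finset.sum_comm]
  rw [← Finset.sum_add_distrib]
  refine Finset.sum_congr rfl fun i _ => ?_
  have hsel : ∑ k, h k * ∑ j, (if i j = k then (1 : ℝ) else 0) = ∑ j, h (i j) := by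
    simp_rw [Finset.mul_sum]
    rw [Finset.sum_comm]
    simp
  calc _ = (∏ j, c j (i j)) * m i *
        (∑ k, h k * a k + ∑ k, h k * ∑ j, if i j = k then (1 : ℝ) else 0) := by
        rw [← Finset.sum_add_distrib, Finset.mul_sum]
        exact Finset.sum_congr rfl fun k _ => by ring
    _ = _ := by
        rw [hsel, mul_add, Finset.mul_sum (s := Finset.univ) (f := fun j => h (i j))]
        congr 1
        · ring
        · exact Finset.sum_congr rfl fun j _ => by ring

end Dirichlet

/-! ### The method of moments on a cube -/

section Moments

lemma integrable_prod_of_bound {J : Type*} {Ω : Type*} [MeasurableSpace Ω] {P : Measure Ω} [IsFiniteMeasure P]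
    {V : Ω → J → ℝ} (hV : AEMeasurable V P) {C : ℝ} (hC : ∀ᵐ ω ∂P, ∀ j, |V ω j| ≤ C) {m : ℕ}
    (k : Fin m → J) : Integrable (fun ω => ∏ i, V ω (k i)) P := by
  have hm : Measurable fun x : J → ℝ => ∏ i, x (k i) := by fun_prop
  refine Integrable.of_bound (hm.comp_aemeasurable hV).aestronglyMeasurable (C ^ m) ?_
  filter_upwards [hC] with ω hω
  rw [Real.norm_eq_abs, Finset.abs_prod]
  calc _ ≤ ∏ _i : Fin m, C := Finset.prod_le_prod (fun i _ => abs_nonneg _) fun i _ => hω _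
    _ = C ^ m := by simp

variable {J : Type*} [Fintype J]

/-- Polynomials are dense in the continuous functions on a cube. -/
lemma exists_mvPolynomial_near {J : Type*} (C : ℝ) (F : (J → ℝ) →ᵇ ℝ) {ε : ℝ} (hε : 0 < ε) :
    ∃ p : MvPolynomial J ℝ, ∀ x : J → ℝ, (∀ j, |x j| ≤ C) → |MvPolynomial.eval x p - F x| < ε := by
  set S : Set (J → ℝ) := Set.univ.pi fun _ => Set.Icc (-C) C
  have hS : IsCompact S := isCompact_univ_pi fun _ => isCompact_Icc
  have : CompactSpace S := isCompact_iff_compactSpace.mp hS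
  let c : J → C(S, ℝ) := fun j => ⟨fun x => x.1 j, (continuous_apply j).comp continuous_subtype_val⟩
  let φ : MvPolynomial J ℝ →ₐ[ℝ] C(S, ℝ) := MvPolynomial.aeval c
  have hφ : ∀ p (x : S), φ p x = MvPolynomial.eval x.1 p := by
    intro p x
    induction p using MvPolynomial.induction_on with
    | C a => simp [φ]
    | add p q hp hq => simp [hp, hq]
    | mul_X p j hp => simp [hp, φ, c]
  have hsep : φ.range.SeparatesPoints := by
    intro x y hxy
    obtain ⟨j, hj⟩ := Function.ne_iff.mp (fun h => hxy (Subtype.ext h))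
    exact ⟨_, ⟨c j, ⟨MvPolynomial.X j, by simp [φ]⟩, rfl⟩, hj⟩
  obtain ⟨⟨_, p, rfl⟩, hg⟩ :=
    ContinuousMap.exists_mem_subalgebra_near_continuousMap_of_separatesPoints φ.range hsep
      ⟨fun x => F x.1, by fun_prop⟩ ε hε
  refine ⟨p, fun x hx => ?_⟩
  have hxS : x ∈ S := fun j _ => abs_le.mp (hx j)
  have := (ContinuousMap.norm_coe_le_norm _ ⟨x, hxS⟩).trans_lt hg
  simpa [hφ] using this

/-- Exponents become repeated indices, the form in which moments are indexed from here on. -/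
lemma prod_pow_eq_prod_fin (d : J → ℕ) :
    ∃ (m : ℕ) (k : Fin m → J), ∀ x : J → ℝ, ∏ j, x j ^ d j = ∏ i, x (k i) := by
  let e := Fintype.equivFin (Σ j, Fin (d j))
  refine ⟨_, fun i => (e.symm i).1, fun x => ?_⟩
  rw [Equiv.prod_comp e.symm (fun p : Σ j, Fin (d j) => x p.1), Fintype.prod_sigma]
  simp

lemma eval_mvPolynomial_eq_sum (p : MvPolynomial J ℝ) :
    ∃ (m : (J →₀ ℕ) → ℕ) (k : ∀ d, Fin (m d) → J), ∀ x : J → ℝ,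
      MvPolynomial.eval x p = ∑ d ∈ p.support, p.coeff d * ∏ i, x (k d i) := by
  choose m k h using fun d : J →₀ ℕ => prod_pow_eq_prod_fin (d : J → ℕ)
  exact ⟨m, k, fun x => by rw [MvPolynomial.eval_eq']; simp_rw [h]⟩

lemma integral_eval_mvPolynomial {Ω : Type*} [MeasurableSpace Ω] {P : Measure Ω}
    [IsProbabilityMeasure P] {V : Ω → J → ℝ} (hV : AEMeasurable V P) {C : ℝ}
    (hC : ∀ᵐ ω ∂P, ∀ j, |V ω j| ≤ C) {p : MvPolynomial J ℝ} {m : (J →₀ ℕ) → ℕ}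
    {k : ∀ d, Fin (m d) → J} (hmk : ∀ x : J → ℝ,
      MvPolynomial.eval x p = ∑ d ∈ p.support, p.coeff d * ∏ i, x (k d i))
    {F : (J → ℝ) →ᵇ ℝ} {ε : ℝ}
    (hp : ∀ x : J → ℝ, (∀ j, |x j| ≤ C) → |MvPolynomial.eval x p - F x| < ε) :
    ∫ ω, MvPolynomial.eval (V ω) p ∂P =
        ∑ d ∈ p.support, p.coeff d * ∫ ω, ∏ s, V ω (k d s) ∂P ∧
      |∫ ω, F (V ω) ∂P - ∫ ω, MvPolynomial.eval (V ω) p ∂P| ≤ ε := by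
  have hi : Integrable (fun ω => MvPolynomial.eval (V ω) p) P := by
    simp_rw [hmk]
    exact integrable_finsetSum _ fun d _ => (integrable_prod_of_bound hV hC (k d)).const_mul _
  refine ⟨?_, ?_⟩
  · simp_rw [hmk]
    rw [integral_finsetSum _ fun d _ => (integrable_prod_of_bound hV hC (k d)).const_mul _]
    simp_rw [integral_const_mul]
  · have hF : Integrable (fun ω => F (V ω)) P :=
      Integrable.of_bound (F.continuous.measurable.comp_aemeasurable hV).aestronglyMeasurable
        ‖F‖ (ae_of_all _ fun ω => F.norm_coe_le_norm _)
    rw [← integral_sub hF hi, ← Real.norm_eq_abs]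
    refine (norm_integral_le_of_norm_le_const (C := ε) ?_).trans (by simp)
    filter_upwards [hC] with ω hω
    rw [Real.norm_eq_abs, abs_sub_comm]
    exact (hp _ hω).le

variable {ι : Type*} {l : Filter ι} {Ω : ι → Type*} [∀ i, MeasurableSpace (Ω i)]
  {P : ∀ i, Measure (Ω i)} [∀ i, IsProbabilityMeasure (P i)]
  {Ω' : Type*} [MeasurableSpace Ω'] {P' : Measure Ω'} [IsProbabilityMeasure P']

/-- Convergence in distribution is convergence of the integrals of bounded continuous functions. -/
lemma tendstoInDistribution_iff_integral {E : Type*} [TopologicalSpace E] [MeasurableSpace E]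
    [OpensMeasurableSpace E] {V : ∀ i, Ω i → E} {V' : Ω' → E}
    (hV : ∀ i, AEMeasurable (V i) (P i)) (hV' : AEMeasurable V' P') :
    TendstoInDistribution V l V' P P' ↔ ∀ F : E →ᵇ ℝ,
      Tendsto (fun i => ∫ ω, F (V i ω) ∂P i) l (𝓝 (∫ ω, F (V' ω) ∂P')) := by
  have e : ∀ (F : E →ᵇ ℝ), (∫ x, F x ∂(P'.map V') = ∫ ω, F (V' ω) ∂P') ∧
      ∀ i, ∫ x, F x ∂((P i).map (V i)) = ∫ ω, F (V i ω) ∂P i := fun F =>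
    ⟨integral_map hV' F.continuous.measurable.aestronglyMeasurable,
      fun i => integral_map (hV i) F.continuous.measurable.aestronglyMeasurable⟩
  constructor
  · intro h F
    have := ProbabilityMeasure.tendsto_iff_forall_integral_tendsto.mp h.tendsto F
    simpa only [ProbabilityMeasure.coe_mk, e] using this
  · intro h
    refine ⟨hV, hV', ProbabilityMeasure.tendsto_iff_forall_integral_tendsto.mpr fun F => ?_⟩
    simpa only [ProbabilityMeasure.coe_mk, e] using h F

/-- All vectors live in one cube, where polynomials are uniformly dense in the continuous functions.
Hence neither tightness nor determinacy of the moment problem is an issue, and the filter is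
arbitrary. -/
theorem tendstoInDistribution_of_moments {V : ∀ i, Ω i → J → ℝ} {V' : Ω' → J → ℝ}
    (hV : ∀ i, AEMeasurable (V i) (P i)) (hV' : AEMeasurable V' P') (C : ℝ)
    (hC : ∀ i, ∀ᵐ ω ∂P i, ∀ j, |V i ω j| ≤ C) (hC' : ∀ᵐ ω ∂P', ∀ j, |V' ω j| ≤ C)
    (h : ∀ (m : ℕ) (k : Fin m → J), Tendsto (fun i => ∫ ω, ∏ s, V i ω (k s) ∂P i) l
      (𝓝 (∫ ω, ∏ s, V' ω (k s) ∂P'))) :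
    TendstoInDistribution V l V' P P' := by
  refine (tendstoInDistribution_iff_integral hV hV').mpr fun F => ?_
  rw [Metric.tendsto_nhds]
  intro ε hε
  obtain ⟨p, hp⟩ := exists_mvPolynomial_near C F (ε := ε / 4) (by linarith)
  obtain ⟨m, k, hmk⟩ := eval_mvPolynomial_eq_sum p
  have hlim : Tendsto (fun i => ∫ ω, MvPolynomial.eval (V i ω) p ∂P i) l
      (𝓝 (∫ ω, MvPolynomial.eval (V' ω) p ∂P')) := by
    rw [(integral_eval_mvPolynomial hV' hC' hmk hp).1]
    simp_rw [fun i => (integral_eval_mvPolynomial (hV i) (hC i) hmk hp).1]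
    exact tendsto_finsetSum _ fun d _ => (h _ (k d)).const_mul _
  filter_upwards [Metric.tendsto_nhds.mp hlim (ε / 4) (by linarith)] with i hi
  rw [Real.dist_eq] at hi ⊢
  have h1 := abs_le.mp (integral_eval_mvPolynomial (hV i) (hC i) hmk hp).2
  have h2 := abs_le.mp (integral_eval_mvPolynomial hV' hC' hmk hp).2
  rw [abs_lt] at hi ⊢
  constructor <;> linarith [hi.1, hi.2, h1.1, h1.2, h2.1, h2.2]

/-- A constant family converges both to itself and, by its moments, to the other law; limits in
distribution are unique. -/
lemma map_eq_map_of_moments {Ω Ω' : Type*} [MeasurableSpace Ω] [MeasurableSpace Ω']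
    {P : Measure Ω} {P' : Measure Ω'} [IsProbabilityMeasure P] [IsProbabilityMeasure P']
    {V : Ω → J → ℝ} {V' : Ω' → J → ℝ}
    (hV : AEMeasurable V P) (hV' : AEMeasurable V' P') (C : ℝ)
    (hC : ∀ᵐ ω ∂P, ∀ j, |V ω j| ≤ C) (hC' : ∀ᵐ ω ∂P', ∀ j, |V' ω j| ≤ C)
    (h : ∀ (m : ℕ) (k : Fin m → J), ∫ ω, ∏ s, V ω (k s) ∂P = ∫ ω, ∏ s, V' ω (k s) ∂P') :
    P.map V = P'.map V' :=
  tendstoInDistribution_unique (l := (⊤ : Filter Unit)) (fun _ => V)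
    (μ := fun _ => P) (tendstoInDistribution_const hV)
    (tendstoInDistribution_of_moments (fun _ => hV) hV' C (fun _ => hC) hC'
      fun m k => by rw [h]; exact tendsto_const_nhds)

end Moments

/-! ### Random probability measures -/

section RandomMeasure

variable {X : Type*} [MeasurableSpace X]

lemma measurable_toMeasure : Measurable (ProbabilityMeasure.toMeasure : ProbabilityMeasure X → _) :=
  measurable_subtype_coe

lemma measurable_integral_probabilityMeasure {f : X → ℝ} (hf : Measurable f) :
    Measurable fun G : ProbabilityMeasure X => ∫ x, f x ∂(G : Measure X) := by
  let κ : Kernel (ProbabilityMeasure X) X := ⟨_, measurable_toMeasure⟩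
  have : IsMarkovKernel κ := ⟨fun G => G.2⟩
  have := (hf.stronglyMeasurable.comp_measurable measurable_snd).integral_kernel_prod_right'
    (κ := κ) (f := fun p : ProbabilityMeasure X × X => f p.2)
  exact this.measurable

lemma measurable_real_probabilityMeasure {A : Set X} (hA : MeasurableSet A) :
    Measurable fun G : ProbabilityMeasure X => (G : Measure X).real A :=
  ((Measure.measurable_coe hA).comp measurable_toMeasure).ennreal_toReal

/-- The law of a random probability measure is determined by the mixed moments of the masses of
measurable sets. -/
theorem ext_of_moments {Q Q' : Measure (ProbabilityMeasure X)} [IsProbabilityMeasure Q]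
    [IsProbabilityMeasure Q']
    (h : ∀ (m : ℕ) (A : Fin m → Set X), (∀ i, MeasurableSet (A i)) →
      ∫ G, ∏ i, (G : Measure X).real (A i) ∂Q = ∫ G, ∏ i, (G : Measure X).real (A i) ∂Q') :
    Q = Q' := by
  let 𝒜 := {A : Set X // MeasurableSet A}
  let E : ProbabilityMeasure X → 𝒜 → ℝ := fun G A => (G : Measure X).real A.1
  have hE : Measurable E := measurable_pi_lambda _ fun A => measurable_real_probabilityMeasure A.2
  -- The evaluations at measurable sets generate the σ-algebra, so it suffices to compare the laws
  -- of the process `E`, whose finite-dimensional marginals take values in a cube.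
  have hcomap : (inferInstance : MeasurableSpace (ProbabilityMeasure X)) ≤
      MeasurableSpace.comap E inferInstance := by
    have key : @Measurable _ _ (MeasurableSpace.comap E inferInstance) _
        (ProbabilityMeasure.toMeasure : ProbabilityMeasure X → _) := by
      refine @Measure.measurable_of_measurable_coe _ _ _ (MeasurableSpace.comap E inferInstance) _
        fun A hA => ?_
      have h1 : @Measurable _ _ (MeasurableSpace.comap E inferInstance) _ E := comap_measurable E
      have h2 := ((measurable_pi_apply (⟨A, hA⟩ : 𝒜)).comp h1).ennreal_ofReal
      simpa [E] using h2
    exact key.comap_le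
  have hmap : Q.map E = Q'.map E := by
    have hI : ∀ I : Finset 𝒜, (Q.map E).map I.restrict = (Q'.map E).map I.restrict := by
      intro I
      rw [Measure.map_map (by fun_prop) hE, Measure.map_map (by fun_prop) hE]
      have hm : Measurable (I.restrict ∘ E) := (Finset.measurable_restrict I).comp hE
      have hb : ∀ G : ProbabilityMeasure X, ∀ j, |(I.restrict ∘ E) G j| ≤ 1 := fun G j => by
        simp only [Function.comp_apply, Finset.restrict, E]
        rw [abs_of_nonneg measureReal_nonneg]
        exact measureReal_le_one
      refine map_eq_map_of_moments hm.aemeasurable hm.aemeasurable 1 (ae_of_all _ hb)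
        (ae_of_all _ hb) fun m k => ?_
      exact h m (fun i => (k i).1.1) fun i => (k i).1.2
    have : IsProbabilityMeasure (Q.map E) := Measure.isProbabilityMeasure_map hE.aemeasurable
    have : IsProbabilityMeasure (Q'.map E) := Measure.isProbabilityMeasure_map hE.aemeasurable
    exact IsProjectiveLimit.unique (P := fun I => (Q'.map E).map I.restrict)
      (fun I => hI I) (fun I => rfl)
  ext s hs
  obtain ⟨T, hT, rfl⟩ := hcomap s hs
  rw [← Measure.map_apply hE hT, hmap, Measure.map_apply hE hT]

end RandomMeasure

/-! ### Bounded measurable functions -/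

section BoundedMeasurable

variable {X : Type*} [MeasurableSpace X]

/-- Bounded measurable real functions. -/
structure IsBoundedMeasurable (f : X → ℝ) : Prop where
  measurable : Measurable f
  bounded : ∃ C, ∀ x, |f x| ≤ C

namespace IsBoundedMeasurable

variable {f g : X → ℝ}

lemma const (c : ℝ) : IsBoundedMeasurable fun _ : X => c := ⟨measurable_const, |c|, fun _ => le_rfl⟩

lemma mul (hf : IsBoundedMeasurable f) (hg : IsBoundedMeasurable g) :
    IsBoundedMeasurable fun x => f x * g x := by
  obtain ⟨C, hC⟩ := hf.bounded
  obtain ⟨D, hD⟩ := hg.bounded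
  refine ⟨hf.measurable.mul hg.measurable, C * D, fun x => ?_⟩
  rw [abs_mul]
  exact mul_le_mul (hC x) (hD x) (abs_nonneg _) ((abs_nonneg _).trans (hC x))

lemma add (hf : IsBoundedMeasurable f) (hg : IsBoundedMeasurable g) :
    IsBoundedMeasurable fun x => f x + g x := by
  obtain ⟨C, hC⟩ := hf.bounded
  obtain ⟨D, hD⟩ := hg.bounded
  exact ⟨hf.measurable.add hg.measurable, C + D,
    fun x => (abs_add_le _ _).trans (add_le_add (hC x) (hD x))⟩

lemma sub (hf : IsBoundedMeasurable f) (hg : IsBoundedMeasurable g) :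
    IsBoundedMeasurable fun x => f x - g x := by
  simpa [sub_eq_add_neg] using hf.add ((const (-1)).mul hg)

lemma prod {J : Type*} (s : Finset J) {f : J → X → ℝ} (hf : ∀ j, IsBoundedMeasurable (f j)) :
    IsBoundedMeasurable fun x => ∏ j ∈ s, f j x := by
  classical
  induction s using Finset.induction_on with
  | empty => simpa using const 1
  | insert a s ha ih => simpa [Finset.prod_insert ha] using (hf a).mul ih

lemma sum {J : Type*} (s : Finset J) {f : J → X → ℝ} (hf : ∀ j, IsBoundedMeasurable (f j)) :
    IsBoundedMeasurable fun x => ∑ j ∈ s, f j x := by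
  classical
  induction s using Finset.induction_on with
  | empty => simpa using const 0
  | insert a s ha ih => simpa [Finset.sum_insert ha] using (hf a).add ih

lemma indicator_one {A : Set X} (hA : MeasurableSet A) :
    IsBoundedMeasurable (A.indicator fun _ => (1 : ℝ)) := by
  refine ⟨measurable_const.indicator hA, 1, fun x => ?_⟩
  by_cases hx : x ∈ A <;> simp [hx]

lemma integrable (hf : IsBoundedMeasurable f) (μ : Measure X) [IsFiniteMeasure μ] :
    Integrable f μ := by
  obtain ⟨C, hC⟩ := hf.bounded
  exact Integrable.of_bound hf.measurable.aestronglyMeasurable C (ae_of_all _ hC)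

lemma comp {Y : Type*} [MeasurableSpace Y] (hf : IsBoundedMeasurable f) {u : Y → X}
    (hu : Measurable u) : IsBoundedMeasurable fun y => f (u y) :=
  ⟨hf.measurable.comp hu, hf.bounded.imp fun _ hC y => hC (u y)⟩

lemma integrable_comp {Y : Type*} [MeasurableSpace Y] (hf : IsBoundedMeasurable f) {u : Y → X}
    {μ : Measure Y} [IsFiniteMeasure μ] (hu : AEMeasurable u μ) :
    Integrable (fun y => f (u y)) μ := by
  obtain ⟨C, hC⟩ := hf.bounded
  exact Integrable.of_bound (hf.measurable.comp_aemeasurable hu).aestronglyMeasurable C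
    (ae_of_all _ fun y => hC (u y))

end IsBoundedMeasurable

lemma abs_integral_le_of_bound {f : X → ℝ} {C : ℝ} (hC : ∀ x, |f x| ≤ C) (μ : Measure X)
    [IsProbabilityMeasure μ] : |∫ x, f x ∂μ| ≤ C := by
  simpa using norm_integral_le_of_norm_le_const (μ := μ) (f := f) (ae_of_all _ hC)

/-- Integration of a bounded measurable function is a bounded measurable function of the
measure. -/
lemma IsBoundedMeasurable.integral {f : X → ℝ} (hf : IsBoundedMeasurable f) :
    IsBoundedMeasurable fun G : ProbabilityMeasure X => ∫ x, f x ∂(G : Measure X) :=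
  ⟨measurable_integral_probabilityMeasure hf.measurable,
    hf.bounded.imp fun _ hC _ => abs_integral_le_of_bound hC _⟩

lemma IsBoundedMeasurable.integral_kernel {S : Type*} [MeasurableSpace S] {f : X → ℝ}
    (hf : IsBoundedMeasurable f) (κ : Kernel S X) [IsMarkovKernel κ] :
    IsBoundedMeasurable fun y => ∫ x, f x ∂κ y :=
  ⟨((hf.measurable.stronglyMeasurable.comp_measurable measurable_snd).integral_kernel_prod_right'
      (κ := κ) (f := fun p : S × X => f p.2)).measurable,
    hf.bounded.imp fun _ hC _ => abs_integral_le_of_bound hC _⟩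

end BoundedMeasurable

/-! ### The Pólya urn recursion of a Dirichlet process -/

section DirichletProcess

variable {X : Type*} [MeasurableSpace X]

/-- Replace the `j`-th function by its product with `h`. -/
def mulAt {X : Type*} {n : ℕ} (g : Fin n → X → ℝ) (j : Fin n) (h : X → ℝ) : Fin n → X → ℝ :=
  Function.update g j fun x => g j x * h x

/-- The predicate is arbitrary because the lemma serves for measurability, for uniform bounds and
for membership in a class `𝒜`. -/
lemma mulAt_mem {X : Type*} {n : ℕ} {g : Fin n → X → ℝ} {h : X → ℝ} {p : (X → ℝ) → Prop}
    (hg : ∀ j, p (g j)) (j : Fin n) (hh : p fun x => g j x * h x) (j' : Fin n) :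
    p (mulAt g j h j') := by
  by_cases hj : j' = j
  · subst hj; simpa [mulAt] using hh
  · simpa [mulAt, hj] using hg j'

lemma IsBoundedMeasurable.mulAt {n : ℕ} {g : Fin n → X → ℝ} {h : X → ℝ}
    (hg : ∀ j, IsBoundedMeasurable (g j)) (hh : IsBoundedMeasurable h) (j j' : Fin n) :
    IsBoundedMeasurable (mulAt g j h j') := mulAt_mem hg j ((hg j).mul hh) j'

/-- The recursion of the mixed moments of a Dirichlet process. -/
def PolyaRecursion (α : ℝ) (μ : Measure X) (Q : Measure (ProbabilityMeasure X)) : Prop :=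
  ∀ (n : ℕ) (h : X → ℝ) (g : Fin n → X → ℝ), IsBoundedMeasurable h →
    (∀ j, IsBoundedMeasurable (g j)) →
    (α + n) * ∫ G, (∫ x, h x ∂(G : Measure X)) * ∏ j, ∫ x, g j x ∂(G : Measure X) ∂Q =
      α * (∫ x, h x ∂μ) * ∫ G, ∏ j, ∫ x, g j x ∂(G : Measure X) ∂Q +
      ∑ j, ∫ G, ∏ j', ∫ x, mulAt g j h j' x ∂(G : Measure X) ∂Q

/-- The partition with one block already decides: the image of `Q` is then a Dirichlet law, which
has total mass one. -/
lemma IsDirichletProcess.isProbabilityMeasure {α : ℝ} {H : Measure X}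
    {Q : Measure (ProbabilityMeasure X)} (h : IsDirichletProcess α H Q) :
    IsProbabilityMeasure Q := by
  have h1 := h 1 (fun _ => Set.univ) (fun _ => MeasurableSet.univ)
    (fun i j hij => (hij (Subsingleton.elim i j)).elim) (Set.iUnion_const _)
  have h2 : IsProbabilityMeasure (Q.map fun (G : ProbabilityMeasure X) (_ : Fin 1) =>
      (G : Measure X).real Set.univ) := by rw [h1]; infer_instance
  exact (Measure.isProbabilityMeasure_map_iff (measurable_pi_lambda _ fun _ =>
    measurable_real_probabilityMeasure MeasurableSet.univ).aemeasurable).mp h2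

/-- The step function with value `c k` on `A k`. -/
noncomputable def stepFunction {X : Type*} {N : ℕ} (A : Fin N → Set X) (c : Fin N → ℝ) (x : X) : ℝ :=
  ∑ k, c k * (A k).indicator (fun _ => 1) x

lemma integral_stepFunction {N : ℕ} {A : Fin N → Set X} (hA : ∀ k, MeasurableSet (A k))
    (c : Fin N → ℝ) (μ : Measure X) [IsFiniteMeasure μ] :
    ∫ x, stepFunction A c x ∂μ = ∑ k, c k * μ.real (A k) := by
  unfold stepFunction
  rw [integral_finsetSum _ fun k _ =>
    ((IsBoundedMeasurable.indicator_one (hA k)).integrable μ).const_mul _]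
  simp_rw [integral_const_mul]
  refine Finset.sum_congr rfl fun k _ => ?_
  rw [integral_indicator (hA k)]
  simp

lemma stepFunction_mul {X : Type*} {N : ℕ} {A : Fin N → Set X}
    (hd : Pairwise fun i j => Disjoint (A i) (A j)) (c d : Fin N → ℝ) (x : X) :
    stepFunction A c x * stepFunction A d x = stepFunction A (fun k => c k * d k) x := by
  unfold stepFunction
  rw [Finset.sum_mul_sum]
  refine Finset.sum_congr rfl fun k _ => ?_
  rw [Finset.sum_eq_single k]
  · by_cases hx : x ∈ A k <;> simp [hx]
  · intro j _ hj
    by_cases hx : x ∈ A k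
    · have : x ∉ A j := fun hxj => Set.disjoint_left.mp (hd hj) hxj hx
      simp [this]
    · simp [hx]
  · simp

/-- One simple function with vector values puts all coordinates on a common partition, that of its
fibres. -/
lemma exists_stepFunction_eq {J : Type*} [Fintype J] (s : SimpleFunc X (J → ℝ)) :
    ∃ (N : ℕ) (A : Fin N → Set X) (v : J → Fin N → ℝ), (∀ k, MeasurableSet (A k)) ∧
      (Pairwise fun i j => Disjoint (A i) (A j)) ∧ (⋃ k, A k) = Set.univ ∧
      ∀ x j, s x j = stepFunction A (v j) x := by
  let e := Fintype.equivFin s.range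
  refine ⟨_, fun k => s ⁻¹' {(e.symm k).1}, fun j k => (e.symm k).1 j,
    fun k => s.measurableSet_fiber _, ?_, ?_, ?_⟩
  · intro i j hij
    refine Set.disjoint_left.mpr fun x hi hj => hij ?_
    exact e.symm.injective (Subtype.ext (hi.symm.trans hj))
  · refine Set.eq_univ_of_forall fun x => Set.mem_iUnion.mpr ⟨e ⟨s x, s.mem_range_self x⟩, ?_⟩
    simp
  · intro x j
    unfold stepFunction
    rw [Finset.sum_eq_single (e ⟨s x, s.mem_range_self x⟩)]
    · simp
    · intro k _ hk
      have : x ∉ s ⁻¹' {(e.symm k).1} := fun hx => hk (by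
        rw [← Equiv.symm_apply_eq]
        exact Subtype.ext hx.symm)
      simp [this]
    · simp

/-- Integrals of step functions on one partition are linear functionals of the Dirichlet vector of
masses. Since the blocks are disjoint, products of step functions correspond to products of
coefficients. -/
lemma polyaRecursion_stepFunction {α : ℝ} (hα : 0 < α) {H : Measure X} [IsProbabilityMeasure H]
    {Q : Measure (ProbabilityMeasure X)} (hQ : IsDirichletProcess α H Q) {N : ℕ}
    {A : Fin N → Set X} (hA : ∀ k, MeasurableSet (A k))
    (hd : Pairwise fun i j => Disjoint (A i) (A j)) (hu : (⋃ k, A k) = Set.univ)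
    {n : ℕ} (h : Fin N → ℝ) (c : Fin n → Fin N → ℝ) :
    (α + n) * ∫ G, (∫ x, stepFunction A h x ∂(G : Measure X)) *
        ∏ j, ∫ x, stepFunction A (c j) x ∂(G : Measure X) ∂Q =
      α * (∫ x, stepFunction A h x ∂H) *
        ∫ G, ∏ j, ∫ x, stepFunction A (c j) x ∂(G : Measure X) ∂Q +
      ∑ j, ∫ G, ∏ j', ∫ x, mulAt (fun j => stepFunction A (c j)) j (stepFunction A h) j' x
        ∂(G : Measure X) ∂Q := by
  have hsum : ∑ k, α * H.real (A k) = α := by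
    rw [← Finset.mul_sum, ← measureReal_iUnion_fintype hd hA, hu]
    simp
  have hmap := hQ N A hA hd hu
  have hm : Measurable fun (G : ProbabilityMeasure X) i => (G : Measure X).real (A i) :=
    measurable_pi_lambda _ fun k => measurable_real_probabilityMeasure (hA k)
  have hup : ∀ j j', mulAt (fun j => stepFunction A (c j)) j (stepFunction A h) j' =
      stepFunction A (Function.update c j (fun k => c j k * h k) j') := by
    intro j j'
    by_cases hj : j' = j
    · subst hj
      simp only [mulAt, Function.update_self]
      funext x
      exact stepFunction_mul hd _ _ x
    · simp [mulAt, hj]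
  have key := integral_dirichlet_linear h c (a := fun k => α * H.real (A k))
    (fun k => mul_nonneg hα.le measureReal_nonneg) (by rw [hsum]; exact hα)
  rw [hsum, ← hmap, integral_map hm.aemeasurable
    (Measurable.aestronglyMeasurable (by fun_prop)),
    integral_map hm.aemeasurable
    (Measurable.aestronglyMeasurable (by fun_prop))] at key
  simp_rw [hup, integral_stepFunction hA]
  rw [key]
  congr 1
  · congr 1
    rw [Finset.mul_sum]
    exact Finset.sum_congr rfl fun k _ => by ring
  · refine Finset.sum_congr rfl fun j _ => ?_
    rw [integral_map hm.aemeasurable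
    (Measurable.aestronglyMeasurable (by fun_prop))]

lemma tendsto_integral_prod_integral {Q : Measure (ProbabilityMeasure X)} [IsFiniteMeasure Q]
    {n : ℕ} {f : ℕ → Fin n → X → ℝ} {f' : Fin n → X → ℝ} (hf : ∀ m j, Measurable (f m j)) {C : ℝ}
    (hC : ∀ m j x, |f m j x| ≤ C)
    (hlim : ∀ j x, Tendsto (fun m => f m j x) atTop (𝓝 (f' j x))) :
    Tendsto (fun m => ∫ G, ∏ j, ∫ x, f m j x ∂(G : Measure X) ∂Q) atTop
      (𝓝 (∫ G, ∏ j, ∫ x, f' j x ∂(G : Measure X) ∂Q)) := by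
  refine tendsto_integral_of_dominated_convergence (fun _ => C ^ n) (fun m => ?_)
    (integrable_const _) (fun m => ae_of_all _ fun G => ?_) (ae_of_all _ fun G => ?_)
  · exact (Finset.measurable_fun_prod _ fun j _ =>
      measurable_integral_probabilityMeasure (hf m j)).aestronglyMeasurable
  · rw [Real.norm_eq_abs, Finset.abs_prod]
    calc _ ≤ ∏ _j : Fin n, C := Finset.prod_le_prod (fun j _ => abs_nonneg _)
          fun j _ => abs_integral_le_of_bound (hC m j) _
      _ = C ^ n := by simp
  · refine tendsto_finsetProd _ fun j _ => ?_
    exact tendsto_integral_of_dominated_convergence (fun _ => C)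
      (fun m => (hf m j).aestronglyMeasurable) (integrable_const _)
      (fun m => ae_of_all _ (hC m j)) (ae_of_all _ (hlim j))

theorem IsDirichletProcess.polyaRecursion {α : ℝ} (hα : 0 < α) {H : Measure X}
    [IsProbabilityMeasure H] {Q : Measure (ProbabilityMeasure X)}
    (hQ : IsDirichletProcess α H Q) : PolyaRecursion α H Q := by
  intro n h g hh hg
  have := hQ.isProbabilityMeasure
  -- `h` and the `g j` are packed into one vector-valued function, so that each simple approximation
  -- uses a single partition for all of them.
  let v : X → Fin (n + 1) → ℝ := fun x => Fin.cons (h x) fun j => g j x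
  have hvb : ∀ k, IsBoundedMeasurable fun x => v x k := by
    intro k
    refine Fin.cases ?_ (fun j => ?_) k
    · simpa [v] using hh
    · simpa [v] using hg j
  have hv : Measurable v := measurable_pi_lambda _ fun k => (hvb k).measurable
  choose C hC using fun k => (hvb k).bounded
  have hD : ∀ x k, |v x k| ≤ ∑ k, |C k| := fun x k =>
    ((hC k x).trans (le_abs_self _)).trans
      (Finset.single_le_sum (f := fun k => |C k|) (fun i _ => abs_nonneg _) (Finset.mem_univ k))
  set D := ∑ k, |C k| with hDdef
  have hD0 : 0 ≤ D := Finset.sum_nonneg fun _ _ => abs_nonneg _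
  have hvn : ∀ x, ‖v x‖ ≤ D := fun x => (pi_norm_le_iff_of_nonneg hD0).mpr (hD x)
  let s := hv.stronglyMeasurable.approxBounded D
  have hs : ∀ x, Tendsto (fun m => s m x) atTop (𝓝 (v x)) := fun x =>
    hv.stronglyMeasurable.tendsto_approxBounded_of_norm_le (hvn x)
  have hsn : ∀ m x k, |s m x k| ≤ D := fun m x k =>
    (norm_le_pi_norm (s m x) k).trans (hv.stronglyMeasurable.norm_approxBounded_le hD0 m x)
  have hsm : ∀ m k, Measurable fun x => s m x k := fun m k =>
    (measurable_pi_apply k).comp (s m).measurable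
  have hsk : ∀ k x, Tendsto (fun m => s m x k) atTop (𝓝 (v x k)) := fun k x =>
    (tendsto_pi_nhds.mp (hs x)) k
  have hrec : ∀ m, (α + n) * ∫ G, ∏ k : Fin (n + 1), ∫ x, s m x k ∂(G : Measure X) ∂Q =
      α * (∫ x, s m x 0 ∂H) * ∫ G, ∏ j : Fin n, ∫ x, s m x j.succ ∂(G : Measure X) ∂Q +
      ∑ j : Fin n, ∫ G, ∏ j', ∫ x, mulAt (fun j x => s m x (Fin.succ j)) j (fun x => s m x 0) j' x
        ∂(G : Measure X) ∂Q := by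
    intro m
    obtain ⟨N, A, w, hA, hd, hu, hw⟩ := exists_stepFunction_eq (s m)
    simp_rw [hw, Fin.prod_univ_succ]
    exact polyaRecursion_stepFunction hα hQ hA hd hu (w 0) fun j => w j.succ
  have l1 := (tendsto_integral_prod_integral (Q := Q) (f := fun m k x => s m x k)
    hsm (fun m k x => hsn m x k) hsk).const_mul (α + n)
  have l2 : Tendsto (fun m => ∫ x, s m x 0 ∂H) atTop (𝓝 (∫ x, v x 0 ∂H)) :=
    tendsto_integral_of_dominated_convergence (fun _ => D)
      (fun m => (hsm m 0).aestronglyMeasurable) (integrable_const _)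
      (fun m => ae_of_all _ fun x => hsn m x 0) (ae_of_all _ (hsk 0))
  have l3 := tendsto_integral_prod_integral (Q := Q) (f := fun m (j : Fin n) x => s m x j.succ)
    (fun m j => hsm m _) (fun m j x => hsn m x _) (fun j x => hsk _ x)
  -- The entry at `j` is a product of two functions bounded by `D`, the others are bounded by `D`;
  -- hence the common bound `max D (D * D)`.
  have l4 := fun j : Fin n => tendsto_integral_prod_integral (Q := Q)
    (f := fun m => mulAt (fun j x => s m x (Fin.succ j)) j (fun x => s m x 0))
    (f' := mulAt (fun j x => v x (Fin.succ j)) j (fun x => v x 0)) (C := max D (D * D))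
    (fun m => mulAt_mem (p := Measurable) (fun j => hsm m _) j ((hsm m _).mul (hsm m _)))
    (fun m => mulAt_mem (p := fun f => ∀ x, |f x| ≤ max D (D * D))
      (fun j x => (hsn m x _).trans (le_max_left _ _)) j
      (fun x => by
        rw [abs_mul]
        exact (mul_le_mul (hsn m x _) (hsn m x _) (abs_nonneg _) hD0).trans (le_max_right _ _)))
    (fun j' x => by
      by_cases hj : j' = j
      · subst hj
        simpa [mulAt] using (hsk _ x).mul (hsk 0 x)
      · simpa [mulAt, hj] using hsk _ x)
  have lr := ((l2.const_mul α).mul l3).add (tendsto_finsetSum Finset.univ fun j _ => l4 j)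
  have := tendsto_nhds_unique (l1.congr hrec) lr
  simpa [v, Fin.prod_univ_succ] using this

/-- The recursion expresses moments of order `n + 1` through moments of order `n` and the base
measure. Merged functions stay bounded and measurable, so the induction closes; it starts from total
mass one. -/
lemma PolyaRecursion.integral_eq {α : ℝ} (hα : 0 < α) {H : Measure X}
    {Q Q' : Measure (ProbabilityMeasure X)} [IsProbabilityMeasure Q] [IsProbabilityMeasure Q']
    (h : PolyaRecursion α H Q) (h' : PolyaRecursion α H Q') {n : ℕ} (g : Fin n → X → ℝ)
    (hg : ∀ j, IsBoundedMeasurable (g j)) :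
    ∫ G, ∏ j, ∫ x, g j x ∂(G : Measure X) ∂Q = ∫ G, ∏ j, ∫ x, g j x ∂(G : Measure X) ∂Q' := by
  induction n with
  | zero => simp
  | succ n ih =>
    have h1 := h n (g 0) (fun j => g j.succ) (hg 0) fun j => hg _
    have h2 := h' n (g 0) (fun j => g j.succ) (hg 0) fun j => hg _
    simp_rw [Fin.prod_univ_succ]
    have hn : (0 : ℝ) < α + n := by positivity
    refine mul_left_cancel₀ hn.ne' ?_
    rw [h1, h2, ih _ fun j => hg _]
    congr 1
    exact Finset.sum_congr rfl fun j _ => ih _ fun j' =>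
      IsBoundedMeasurable.mulAt (fun j => hg _) (hg 0) j j'

theorem PolyaRecursion.unique {α : ℝ} (hα : 0 < α) {H : Measure X}
    {Q Q' : Measure (ProbabilityMeasure X)} [IsProbabilityMeasure Q] [IsProbabilityMeasure Q']
    (h : PolyaRecursion α H Q) (h' : PolyaRecursion α H Q') : Q = Q' := by
  refine ext_of_moments fun m A hA => ?_
  have := h.integral_eq hα h' (fun i => (A i).indicator fun _ => (1 : ℝ))
    fun i => IsBoundedMeasurable.indicator_one (hA i)
  simpa [integral_indicator, hA] using this

/-- The definition prescribes joint laws over partitions only; the recursion supplies the moments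
over overlapping sets as well. -/
theorem IsDirichletProcess.unique {α : ℝ} (hα : 0 < α) {H : Measure X} [IsProbabilityMeasure H]
    {Q Q' : Measure (ProbabilityMeasure X)} (h : IsDirichletProcess α H Q)
    (h' : IsDirichletProcess α H Q') : Q = Q' := by
  have := h.isProbabilityMeasure
  have := h'.isProbabilityMeasure
  exact (h.polyaRecursion hα).unique hα (h'.polyaRecursion hα)

/-- The mean of a Dirichlet process is its base distribution. -/
lemma PolyaRecursion.integral_integral {α : ℝ} (hα : 0 < α) {H : Measure X}
    {Q : Measure (ProbabilityMeasure X)} [IsProbabilityMeasure Q] (h : PolyaRecursion α H Q)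
    {f : X → ℝ} (hf : IsBoundedMeasurable f) :
    ∫ G, ∫ x, f x ∂(G : Measure X) ∂Q = ∫ x, f x ∂H := by
  have := h 0 f Fin.elim0 hf fun j => j.elim0
  simp at this
  exact this.resolve_right hα.ne'

lemma IsDPKernel.isMarkovKernel {α : ℝ}
    {κ : Kernel (ProbabilityMeasure X) (ProbabilityMeasure X)} (hκ : IsDPKernel α κ) :
    IsMarkovKernel κ := ⟨fun μ => (hκ μ).isProbabilityMeasure⟩

/-- Identifies the kernels which different hypotheses provide existentially. -/
lemma IsDPKernel.unique {α : ℝ} (hα : 0 < α)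
    {κ κ' : Kernel (ProbabilityMeasure X) (ProbabilityMeasure X)} (hκ : IsDPKernel α κ)
    (hκ' : IsDPKernel α κ') : κ = κ' := by
  ext1 μ
  exact (hκ μ).unique hα (hκ' μ)

end DirichletProcess

/-! ### Conditionally i.i.d. sequences -/

section CondIID

variable {S T : Type*} [MeasurableSpace S] [MeasurableSpace T]

/-- The kernel of finitely many independent draws from a Markov kernel. -/
noncomputable def piKernel (κ : Kernel S T) [IsMarkovKernel κ] (J : Type*) [Fintype J] :
    Kernel S (J → T) where
  toFun y := Measure.pi fun _ => κ y
  measurable' := by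
    have : ∀ y : S, IsProbabilityMeasure (Measure.pi fun _ : J => κ y) := fun y => inferInstance
    refine .measure_of_isPiSystem_of_isProbabilityMeasure generateFrom_pi.symm isPiSystem_pi ?_
    rintro _ ⟨B, hB, rfl⟩
    simp_rw [Measure.pi_pi]
    exact Finset.measurable_fun_prod _ fun j _ => κ.measurable_coe (hB j (Set.mem_univ j))

lemma piKernel_apply (κ : Kernel S T) [IsMarkovKernel κ] (J : Type*) [Fintype J] (y : S) :
    piKernel κ J y = Measure.pi fun _ => κ y := rfl

instance (κ : Kernel S T) [IsMarkovKernel κ] (J : Type*) [Fintype J] :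
    IsMarkovKernel (piKernel κ J) :=
  ⟨fun y => by rw [piKernel_apply]; infer_instance⟩

variable {Ω : Type*} [MeasurableSpace Ω] {P : Measure Ω} [IsProbabilityMeasure P] {Y : Ω → S}
  {X : ℕ → Ω → T} {κ : Kernel S T} [IsMarkovKernel κ]

/-- The definition gives the identity on boxes. For a fixed event of `Y` both sides are finite
measures in the remaining variable, and boxes form a π-system. -/
lemma CondIID.map_eq_compProd (h : CondIID P Y X κ) (hY : Measurable Y)
    (hX : ∀ r, Measurable (X r)) (s : Finset ℕ) :
    P.map (fun ω => (Y ω, fun r : s => X r ω)) = P.map Y ⊗ₘ piKernel κ s := by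
  have hXs : Measurable fun ω => fun r : s => X r ω := measurable_pi_lambda _ fun r => hX r
  refine Measure.ext_prod fun {A} {t} hA ht => ?_
  rw [Measure.map_apply (hY.prodMk hXs) (hA.prod ht), Measure.compProd_apply_prod hA ht,
    setLIntegral_map hA ((piKernel κ s).measurable_coe ht) hY]
  have key : (P.restrict (Y ⁻¹' A)).map (fun ω => fun r : s => X r ω) =
      (P.restrict (Y ⁻¹' A)).bind fun ω => piKernel κ s (Y ω) := by
    have hm : Measurable fun ω => piKernel κ s (Y ω) := (piKernel κ s).measurable.comp hY
    refine ext_of_generate_finite _ generateFrom_pi.symm isPiSystem_pi ?_ ?_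
    · rintro _ ⟨B, hB, rfl⟩
      have hB' : ∀ r, MeasurableSet (B r) := fun r => hB r (Set.mem_univ r)
      rw [Measure.map_apply hXs (MeasurableSet.univ_pi hB'),
        Measure.bind_apply (MeasurableSet.univ_pi hB') hm.aemeasurable]
      simp_rw [piKernel_apply, Measure.pi_pi]
      -- The value outside `s` is a mere default; those indices enter neither side.
      have := h s A (fun r => if hr : r ∈ s then B ⟨r, hr⟩ else Set.univ) hA
        (fun r => by by_cases hr : r ∈ s <;> simp [hr, hB'])
      rw [Measure.restrict_apply (hXs (MeasurableSet.univ_pi hB')), Set.inter_comm]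
      convert this using 1
      · congr 2
        ext ω
        simp only [Set.mem_preimage, Set.mem_univ_pi, Set.mem_iInter]
        refine ⟨fun hω r hr => by simpa [hr] using hω ⟨r, hr⟩, fun hω r => ?_⟩
        simpa using hω r.1 r.2
      · refine lintegral_congr fun ω => ?_
        rw [← Finset.prod_attach s]
        refine Finset.prod_congr rfl fun r _ => ?_
        simp
    · rw [Measure.map_apply hXs MeasurableSet.univ,
        Measure.bind_apply MeasurableSet.univ hm.aemeasurable]
      simp
  have h2 := congrArg (fun ν => ν t) key
  rw [Measure.map_apply hXs ht, Measure.restrict_apply (hXs ht), Measure.bind_apply ht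
    (by exact ((piKernel κ s).measurable.comp hY).aemeasurable)] at h2
  rw [← h2, Set.inter_comm]
  rfl

lemma CondIID.integral_prod (h : CondIID P Y X κ) (hY : Measurable Y)
    (hX : ∀ r, Measurable (X r)) (s : Finset ℕ) {u₀ : S → ℝ} {u : ℕ → T → ℝ}
    (hu₀ : IsBoundedMeasurable u₀) (hu : ∀ r, IsBoundedMeasurable (u r)) :
    ∫ ω, u₀ (Y ω) * ∏ r ∈ s, u r (X r ω) ∂P =
      ∫ ω, u₀ (Y ω) * ∏ r ∈ s, ∫ x, u r x ∂κ (Y ω) ∂P := by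
  have hXs : Measurable fun ω => fun r : s => X r ω := measurable_pi_lambda _ fun r => hX r
  have hf : IsBoundedMeasurable fun p : S × (s → T) => u₀ p.1 * ∏ r : s, u r (p.2 r) :=
    (hu₀.comp measurable_fst).mul (IsBoundedMeasurable.prod _ fun r : s =>
      (hu r).comp ((measurable_pi_apply r).comp measurable_snd))
  have h1 := integral_map (μ := P) (hY.prodMk hXs).aemeasurable
    hf.measurable.aestronglyMeasurable
  rw [h.map_eq_compProd hY hX s, Measure.integral_compProd (hf.integrable _),
    integral_map hY.aemeasurable] at h1
  · simp only [← Finset.prod_attach s]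
    refine h1.symm.trans (integral_congr_ae (ae_of_all _ fun ω => ?_))
    simp only [piKernel_apply]
    rw [integral_const_mul, integral_fintype_prod_eq_prod (fun (r : s) x => u r x)]
    rfl
  · exact (hf.measurable.stronglyMeasurable.integral_kernel_prod_right'
      (κ := piKernel κ s)).aestronglyMeasurable

end CondIID

/-! ### Finite mixtures -/

section FiniteMixture

variable {X : Type*} [MeasurableSpace X]

/-- Replace measures that are not probability measures by a fixed one. -/
lemma exists_measurable_retraction [Nonempty (ProbabilityMeasure X)] :
    ∃ ρ : Measure X → ProbabilityMeasure X, Measurable ρ ∧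
      ∀ G : ProbabilityMeasure X, ρ (G : Measure X) = G := by
  have hemb : MeasurableEmbedding (ProbabilityMeasure.toMeasure : ProbabilityMeasure X → _) :=
    MeasurableEmbedding.subtype_coe ProbabilityMeasure.measurableSet_isProbabilityMeasure
  obtain ⟨ρ, hρ, h⟩ := hemb.exists_measurable_extend measurable_id fun _ => inferInstance
  exact ⟨ρ, hρ, fun G => congrFun h G⟩

/-- The measure with mass `p k` at `x k`. -/
noncomputable def atomicMeasure {K : ℕ} (x : ℕ → X) (p : Fin K → ℝ) : Measure X :=
  ∑ k : Fin K, ENNReal.ofReal (p k) • Measure.dirac (x k)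

lemma measurable_atomicMeasure {K : ℕ} :
    Measurable fun q : (ℕ → X) × (Fin K → ℝ) => atomicMeasure q.1 q.2 := by
  refine Measure.measurable_of_measurable_coe _ fun s hs => ?_
  have : ∀ q : (ℕ → X) × (Fin K → ℝ), atomicMeasure q.1 q.2 s =
      ∑ k : Fin K, ENNReal.ofReal (q.2 k) * s.indicator 1 (q.1 k) := by
    intro q
    simp [atomicMeasure, Measure.finsetSum_apply, hs]
  simp_rw [this]
  refine Finset.measurable_fun_sum _ fun k _ => Measurable.mul (by fun_prop) ?_
  exact (measurable_const.indicator hs).comp ((measurable_pi_apply _).comp measurable_fst)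

lemma isProbabilityMeasure_atomicMeasure {K : ℕ} (x : ℕ → X) {p : Fin K → ℝ} (hp : ∀ k, 0 ≤ p k)
    (hp1 : ∑ k, p k = 1) : IsProbabilityMeasure (atomicMeasure x p) := by
  constructor
  simp only [atomicMeasure, Measure.finsetSum_apply, Measure.smul_apply, measure_univ, smul_eq_mul,
    mul_one]
  rw [← ENNReal.ofReal_sum_of_nonneg fun k _ => hp k, hp1, ENNReal.ofReal_one]

lemma integral_atomicMeasure {K : ℕ} (x : ℕ → X) {p : Fin K → ℝ} (hp : ∀ k, 0 ≤ p k) {f : X → ℝ}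
    (hf : Measurable f) : ∫ y, f y ∂atomicMeasure x p = ∑ k : Fin K, f (x k) * p k := by
  unfold atomicMeasure
  rw [integral_finsetSum_measure]
  · refine Finset.sum_congr rfl fun k _ => ?_
    rw [integral_smul_measure, integral_dirac' _ _ hf.stronglyMeasurable, smul_eq_mul,
      ENNReal.toReal_ofReal (hp k), mul_comm]
  · intro k _
    refine Integrable.smul_measure ?_ ENNReal.ofReal_ne_top
    exact integrable_dirac' hf.stronglyMeasurable (by simp)

/-- Aggregation of Dirichlet weights: `∑ p k δ_(x k)` with `p ∼ Dir(α b)` is a Dirichlet process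
with base distribution `∑ b k δ_(x k)`. -/
lemma polyaRecursion_atomicMeasure {K : ℕ} {α : ℝ} (hα : 0 < α) (x : ℕ → X) {b : Fin K → ℝ}
    (hb : ∀ k, 0 ≤ b k) (hb1 : ∑ k, b k = 1) {Φ : (Fin K → ℝ) → ProbabilityMeasure X}
    (hΦ : Measurable Φ) (hΦ' : ∀ p : Fin K → ℝ, (∀ k, 0 ≤ p k) → ∑ k, p k = 1 →
      (Φ p : Measure X) = atomicMeasure x p) :
    PolyaRecursion α (Φ b : Measure X) ((dirichlet fun k => α * b k).map Φ) := by
  intro n h g hh hg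
  have hsum : ∑ k, α * b k = α := by rw [← Finset.mul_sum, hb1, mul_one]
  have hint : ∀ {f : X → ℝ}, Measurable f → ∀ᵐ p ∂dirichlet fun k => α * b k,
      ∫ y, f y ∂(Φ p : Measure X) = ∑ k : Fin K, f (x k) * p k := by
    intro f hf
    filter_upwards [ae_nonneg_dirichlet fun k => α * b k,
      ae_sum_eq_one_dirichlet (a := fun k => α * b k) (by rw [hsum]; exact hα)] with p h0 h1
    rw [hΦ' p h0 h1, integral_atomicMeasure x h0 hf]
  have hprod : ∀ g : Fin n → X → ℝ, (∀ j, IsBoundedMeasurable (g j)) →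
      ∫ G, ∏ j, ∫ y, g j y ∂(G : Measure X) ∂(dirichlet fun k => α * b k).map Φ =
      ∫ p, ∏ j, ∑ k : Fin K, g j (x k) * p k ∂dirichlet fun k => α * b k := by
    intro g hg
    rw [integral_map hΦ.aemeasurable (IsBoundedMeasurable.prod _
      fun j => (hg j).integral).measurable.aestronglyMeasurable]
    refine integral_congr_ae ?_
    filter_upwards [ae_all_iff.mpr fun j => hint (hg j).measurable] with p hp
    simp_rw [hp]
  have key := integral_dirichlet_linear (fun k : Fin K => h (x k)) (fun j k => g j (x k))
    (a := fun k => α * b k) (fun k => mul_nonneg hα.le (hb k)) (by rw [hsum]; exact hα)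
  rw [hsum] at key
  rw [integral_map hΦ.aemeasurable (hh.integral.mul (IsBoundedMeasurable.prod _
    fun j => (hg j).integral)).measurable.aestronglyMeasurable, hprod g hg]
  have e1 : ∫ p, (∫ y, h y ∂(Φ p : Measure X)) * ∏ j, ∫ y, g j y ∂(Φ p : Measure X)
      ∂(dirichlet fun k => α * b k) = ∫ p, (∑ k : Fin K, h (x k) * p k) *
        ∏ j, ∑ k : Fin K, g j (x k) * p k ∂dirichlet fun k => α * b k := by
    refine integral_congr_ae ?_
    filter_upwards [hint hh.measurable, ae_all_iff.mpr fun j => hint (hg j).measurable] with p h1 hp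
    simp_rw [h1, hp]
  rw [e1, key, hΦ' b hb hb1, integral_atomicMeasure x hb hh.measurable]
  congr 1
  · congr 1
    rw [Finset.mul_sum]
    exact Finset.sum_congr rfl fun k _ => by ring
  · refine Finset.sum_congr rfl fun j _ => ?_
    rw [hprod _ fun j' => IsBoundedMeasurable.mulAt hg hh j j']
    refine integral_congr_ae (ae_of_all _ fun p => ?_)
    refine Finset.prod_congr rfl fun j' _ => Finset.sum_congr rfl fun k _ => ?_
    by_cases hj : j' = j
    · subst hj; simp [mulAt]
    · simp [mulAt, hj]

variable {Ω : Type*} [MeasurableSpace Ω] {P : Measure Ω} {K : ℕ}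
  {γ α : ℝ} {a : ℕ → Ω → X} {β : Ω → Fin K → ℝ} {π : ℕ → Ω → Fin K → ℝ}
  {B : Ω → ProbabilityMeasure X} {D : ℕ → Ω → ProbabilityMeasure X}

/-- The sum is one because `B ω` is a probability measure, not because of the Dirichlet law. So
neither `0 < γ` nor `0 < K` is needed, and the latter follows, an empty sum being zero. -/
lemma IsFiniteLevel.ae_weight (h : IsFiniteLevel K γ α P a β π B D) :
    ∀ᵐ ω ∂P, (∀ k, 0 ≤ β ω k) ∧ ∑ k, β ω k = 1 := by
  have h0 : ∀ᵐ ω ∂P, ∀ k, 0 ≤ β ω k := by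
    have := ae_nonneg_dirichlet fun _ : Fin K => γ / K
    rw [← h.weight_law] at this
    exact ae_of_ae_map h.measurable_weight.aemeasurable this
  filter_upwards [h0, h.base_eq] with ω h0 h1
  refine ⟨h0, ?_⟩
  have h2 := congrArg (fun μ : Measure X => μ Set.univ) h1
  simp only [measure_univ, Measure.finsetSum_apply, Measure.smul_apply, smul_eq_mul, mul_one] at h2
  rw [← ENNReal.ofReal_sum_of_nonneg fun k _ => h0 k, eq_comm, ENNReal.ofReal_eq_one] at h2
  exact h2

lemma IsFiniteLevel.pos [IsProbabilityMeasure P] (h : IsFiniteLevel K γ α P a β π B D) : 0 < K := by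
  obtain ⟨ω, -, hω⟩ := h.ae_weight.exists
  by_contra hK
  obtain rfl : K = 0 := by omega
  simp at hω

set_option maxHeartbeats 1000000 in
/-- The group measures of a finite mixture are, given the base measure, independent draws from the
Dirichlet process around it. -/
theorem IsFiniteLevel.condIID [IsProbabilityMeasure P] (h : IsFiniteLevel K γ α P a β π B D) (hα : 0 < α)
    (ha : ∀ k, Measurable (a k))
    (hind : IndepFun (fun ω => (β ω, fun r => π r ω)) (fun ω k => a k ω) P)
    {κ : Kernel (ProbabilityMeasure X) (ProbabilityMeasure X)} (hκ : IsDPKernel α κ) :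
    CondIID P B D κ := by
  have hΩ : Nonempty Ω := nonempty_of_isProbabilityMeasure P
  have : Nonempty (ProbabilityMeasure X) := ⟨B hΩ.some⟩
  have := hκ.isMarkovKernel
  obtain ⟨ρ, hρ, hρ'⟩ := exists_measurable_retraction (X := X)
  -- The map from atoms and weights to the mixture, made total by the retraction so that it is
  -- jointly measurable.
  let Φ : (ℕ → X) → (Fin K → ℝ) → ProbabilityMeasure X := fun x p => ρ (atomicMeasure x p)
  have hΦm : Measurable fun q : (ℕ → X) × (Fin K → ℝ) => Φ q.1 q.2 :=
    hρ.comp measurable_atomicMeasure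
  have hΦ : ∀ x (p : Fin K → ℝ), (∀ k, 0 ≤ p k) → ∑ k, p k = 1 →
      (Φ x p : Measure X) = atomicMeasure x p := fun x p h0 h1 =>
    congrArg ProbabilityMeasure.toMeasure
      (hρ' ⟨atomicMeasure x p, isProbabilityMeasure_atomicMeasure x h0 h1⟩)
  have hB : ∀ᵐ ω ∂P, B ω = Φ (fun k => a k ω) (β ω) := by
    filter_upwards [h.base_eq] with ω hω
    rw [← hρ' (B ω), hω]
    rfl
  have hD : ∀ᵐ ω ∂P, ∀ r, D r ω = Φ (fun k => a k ω) (π r ω) := by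
    filter_upwards [ae_all_iff.mpr h.group_eq] with ω hω r
    rw [← hρ' (D r ω), hω r]
    rfl
  -- Both sides satisfy the Pólya recursion with base `Φ x b`, so they coincide.
  have hDir : ∀ x (b : Fin K → ℝ), (∀ k, 0 ≤ b k) → ∑ k, b k = 1 →
      (dirichlet fun k => α * b k).map (Φ x) = κ (Φ x b) := by
    intro x b h0 h1
    have hΦx : Measurable (Φ x) := hΦm.comp measurable_prodMk_left
    have : IsProbabilityMeasure ((dirichlet fun k => α * b k).map (Φ x)) :=
      Measure.isProbabilityMeasure_map hΦx.aemeasurable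
    exact (polyaRecursion_atomicMeasure hα x h0 h1 hΦx (hΦ x)).unique hα
      ((hκ _).polyaRecursion hα)
  intro s A C hA hC
  have ha' : Measurable fun ω k => a k ω := measurable_pi_lambda _ ha
  have hW : Measurable fun ω => (β ω, fun r => π r ω) :=
    h.measurable_weight.prodMk (measurable_pi_lambda _ h.measurable_groupWeight)
  set W : Ω → (Fin K → ℝ) × (ℕ → Fin K → ℝ) := fun ω => (β ω, fun r => π r ω) with hWdef
  have hlaw := (indepFun_iff_map_prod_eq_prod_map_map ha'.aemeasurable hW.aemeasurable).mp hind.symm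
  have hΦm1 : Measurable fun q : (ℕ → X) × ((Fin K → ℝ) × (ℕ → Fin K → ℝ)) => Φ q.1 q.2.1 :=
    hΦm.comp (measurable_fst.prodMk (measurable_fst.comp measurable_snd))
  have hΦm2 : ∀ r, Measurable fun q : (ℕ → X) × ((Fin K → ℝ) × (ℕ → Fin K → ℝ)) =>
      Φ q.1 (q.2.2 r) := fun r => hΦm.comp (measurable_fst.prodMk
        ((measurable_pi_apply r).comp (measurable_snd.comp measurable_snd)))
  let E : Set ((ℕ → X) × ((Fin K → ℝ) × (ℕ → Fin K → ℝ))) :=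
    (fun q => Φ q.1 q.2.1) ⁻¹' A ∩ ⋂ r ∈ s, (fun q => Φ q.1 (q.2.2 r)) ⁻¹' C r
  have hE : MeasurableSet E :=
    (hΦm1 hA).inter (Finset.measurableSet_biInter _ fun r _ => hΦm2 r (hC r))
  have hFA : Measurable (A.indicator fun μ => ∏ r ∈ s, κ μ (C r)) :=
    (Finset.measurable_fun_prod s fun r _ => κ.measurable_coe (hC r)).indicator hA
  set F := A.indicator fun μ => ∏ r ∈ s, κ μ (C r) with hFdef
  have hleft : P (B ⁻¹' A ∩ ⋂ r ∈ s, D r ⁻¹' C r) =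
      P ((fun ω => ((fun k => a k ω), W ω)) ⁻¹' E) := by
    refine measure_congr (eventuallyEq_set.mpr ?_)
    filter_upwards [hB, hD] with ω h1 h2
    simp [E, hWdef, h1, h2]
  rw [hleft, ← Measure.map_apply (ha'.prodMk hW) hE, hlaw, Measure.prod_apply hE]
  -- With the atoms frozen at `x`, the groups given `β` have law `κ (Φ x β)`, which depends on atoms
  -- and weights only through the base measure. Hence, after integration over the independent atoms,
  -- conditioning on `B` alone suffices.
  have hinner : ∀ x : ℕ → X, (P.map W) (Prod.mk x ⁻¹' E) =
      ∫⁻ w, F (Φ x w.1) ∂P.map W := by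
    intro x
    have hΦx : Measurable (Φ x) := hΦm.comp measurable_prodMk_left
    rw [Measure.map_apply hW (measurable_prodMk_left hE),
      lintegral_map (f := fun w : (Fin K → ℝ) × (ℕ → Fin K → ℝ) => F (Φ x w.1))
        (hFA.comp (hΦx.comp measurable_fst)) hW]
    have hc := h.groupWeight_law s (Φ x ⁻¹' A) (fun r => Φ x ⁻¹' C r) (hΦx hA) fun r => hΦx (hC r)
    have hset : W ⁻¹' (Prod.mk x ⁻¹' E) =
        β ⁻¹' (Φ x ⁻¹' A) ∩ ⋂ r ∈ s, π r ⁻¹' (Φ x ⁻¹' C r) := by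
      ext ω
      simp [E, hWdef]
    rw [hset, hc, ← lintegral_indicator (h.measurable_weight (hΦx hA))]
    refine lintegral_congr_ae ?_
    filter_upwards [h.ae_weight] with ω hω
    by_cases hωA : Φ x (β ω) ∈ A
    · simp only [hFdef, hWdef]
      rw [Set.indicator_of_mem (by exact hωA), Set.indicator_of_mem (by exact hωA)]
      refine Finset.prod_congr rfl fun r _ => ?_
      rw [← hDir x _ hω.1 hω.2, Measure.map_apply hΦx (hC r)]
    · simp only [hFdef, hWdef]
      rw [Set.indicator_of_notMem (by exact hωA), Set.indicator_of_notMem (by exact hωA)]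
  simp_rw [hinner]
  rw [← lintegral_prod (fun q : (ℕ → X) × ((Fin K → ℝ) × (ℕ → Fin K → ℝ)) => F (Φ q.1 q.2.1))
    (hFA.comp hΦm1).aemeasurable, ← hlaw, lintegral_map
    (f := fun q : (ℕ → X) × ((Fin K → ℝ) × (ℕ → Fin K → ℝ)) => F (Φ q.1 q.2.1))
    (hFA.comp hΦm1) (ha'.prodMk hW),
    ← lintegral_indicator (h.measurable_base hA)]
  refine lintegral_congr_ae ?_
  filter_upwards [hB] with ω hω
  simp only [hWdef, ← hω, hFdef]
  rfl

end FiniteMixture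

/-! ### Continuity of the Dirichlet process in its base distribution -/

section Continuity

variable {X : Type*} [MeasurableSpace X]

/-- The algebra of functions of a probability measure generated by the integrals of the functions
in `𝒜`. -/
noncomputable def integralAlgebra (𝒜 : Set (X → ℝ)) : Subalgebra ℝ (ProbabilityMeasure X → ℝ) :=
  Algebra.adjoin ℝ ((fun f (μ : ProbabilityMeasure X) => ∫ x, f x ∂(μ : Measure X)) '' 𝒜)

variable {𝒜 : Set (X → ℝ)}

lemma integral_mem_integralAlgebra {f : X → ℝ} (hf : f ∈ 𝒜) :
    (fun μ : ProbabilityMeasure X => ∫ x, f x ∂(μ : Measure X)) ∈ integralAlgebra 𝒜 :=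
  Algebra.subset_adjoin ⟨f, hf, rfl⟩

/-- The algebra is the linear span of the finite products of its generators. So `p` need not be
closed under multiplication, which matters because expectation is linear but not multiplicative. -/
lemma integralAlgebra_induction {p : (ProbabilityMeasure X → ℝ) → Prop}
    (hprod : ∀ (n : ℕ) (g : Fin n → X → ℝ), (∀ j, g j ∈ 𝒜) →
      p fun μ => ∏ j, ∫ x, g j x ∂(μ : Measure X))
    (hadd : ∀ u v, u ∈ integralAlgebra 𝒜 → v ∈ integralAlgebra 𝒜 → p u → p v →
      p fun μ => u μ + v μ)
    (hsmul : ∀ (c : ℝ) u, u ∈ integralAlgebra 𝒜 → p u → p fun μ => c * u μ)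
    {u : ProbabilityMeasure X → ℝ} (hu : u ∈ integralAlgebra 𝒜) : p u := by
  have hspan : ∀ v, v ∈ Submodule.span ℝ (Submonoid.closure
      ((fun f (μ : ProbabilityMeasure X) => ∫ x, f x ∂(μ : Measure X)) '' 𝒜) :
        Set (ProbabilityMeasure X → ℝ)) ↔ v ∈ integralAlgebra 𝒜 := fun v => by
    rw [← Algebra.adjoin_eq_span]; rfl
  rw [← hspan] at hu
  induction hu using Submodule.span_induction with
  | mem v hv =>
    suffices ∃ (n : ℕ) (g : Fin n → X → ℝ), (∀ j, g j ∈ 𝒜) ∧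
        v = fun μ : ProbabilityMeasure X => ∏ j, ∫ x, g j x ∂(μ : Measure X) by
      obtain ⟨n, g, hg, rfl⟩ := this
      exact hprod n g hg
    induction hv using Submonoid.closure_induction with
    | mem v hv =>
      obtain ⟨f, hf, rfl⟩ := hv
      exact ⟨1, fun _ => f, fun _ => hf, by funext μ; simp⟩
    | one => exact ⟨0, Fin.elim0, fun j => j.elim0, by funext μ; simp⟩
    | mul v w _ _ ihv ihw =>
      obtain ⟨n, g, hg, rfl⟩ := ihv
      obtain ⟨m, h, hh, rfl⟩ := ihw
      refine ⟨n + m, Fin.append g h, fun j => ?_, ?_⟩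
      · refine Fin.addCases (fun j => ?_) (fun j => ?_) j
        · simpa using hg j
        · simpa using hh j
      · funext μ
        simp [Fin.prod_univ_add]
  | zero =>
    have h1 : p fun _ => 1 := by simpa using hprod 0 Fin.elim0 fun j => j.elim0
    have h0 := hsmul 0 (fun _ => 1) (one_mem (integralAlgebra 𝒜)) h1
    simp only [zero_mul] at h0
    exact h0
  | add u v hu hv ihu ihv => exact hadd u v ((hspan u).mp hu) ((hspan v).mp hv) ihu ihv
  | smul c u hu ihu => exact hsmul c u ((hspan u).mp hu) ihu

lemma isBoundedMeasurable_of_mem_integralAlgebra (h𝒜 : ∀ f ∈ 𝒜, IsBoundedMeasurable f)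
    {u : ProbabilityMeasure X → ℝ} (hu : u ∈ integralAlgebra 𝒜) : IsBoundedMeasurable u :=
  integralAlgebra_induction
    (fun _ _ hg => IsBoundedMeasurable.prod _ fun j => (h𝒜 _ (hg j)).integral)
    (fun _ _ _ _ hu hv => hu.add hv) (fun c _ _ hu => (IsBoundedMeasurable.const c).mul hu) hu

/-- A Dirichlet process kernel preserves the algebra generated by the integrals. -/
lemma integral_kernel_mem_integralAlgebra (h𝒜 : ∀ f ∈ 𝒜, IsBoundedMeasurable f)
    (hmul : ∀ f ∈ 𝒜, ∀ g ∈ 𝒜, (fun x => f x * g x) ∈ 𝒜) {α : ℝ} (hα : 0 < α)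
    {κ : Kernel (ProbabilityMeasure X) (ProbabilityMeasure X)} (hκ : IsDPKernel α κ)
    {u : ProbabilityMeasure X → ℝ} (hu : u ∈ integralAlgebra 𝒜) :
    (fun μ => ∫ G, u G ∂κ μ) ∈ integralAlgebra 𝒜 := by
  have := hκ.isMarkovKernel
  refine integralAlgebra_induction (p := fun u => (fun μ => ∫ G, u G ∂κ μ) ∈ integralAlgebra 𝒜)
    ?_ ?_ ?_ hu
  · intro n
    induction n with
    | zero =>
      intro g _
      have h1 : (fun _ => (1 : ℝ)) ∈ integralAlgebra 𝒜 := one_mem (integralAlgebra 𝒜)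
      simpa using h1
    | succ n ih =>
      intro g hg
      have hn : (0 : ℝ) < α + n := by positivity
      -- The Pólya recursion solved for the moment of order `n + 1`. Its merged functions `g j * g
      -- 0` remain in `𝒜` by `hmul`.
      have e : (fun μ => ∫ G, ∏ j, ∫ x, g j x ∂(G : Measure X) ∂κ μ) =
          (α + n)⁻¹ • (α • ((fun μ : ProbabilityMeasure X => ∫ x, g 0 x ∂(μ : Measure X)) *
            fun μ => ∫ G, ∏ j : Fin n, ∫ x, g j.succ x ∂(G : Measure X) ∂κ μ) +
          ∑ j : Fin n, fun μ => ∫ G, ∏ j', ∫ x, mulAt (fun j => g (Fin.succ j)) j (g 0) j' x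
            ∂(G : Measure X) ∂κ μ) := by
        funext μ
        have := (hκ μ).polyaRecursion hα n (g 0) (fun j => g j.succ) (h𝒜 _ (hg 0))
          fun j => h𝒜 _ (hg _)
        simp only [Pi.smul_apply, Pi.add_apply, Pi.mul_apply, Finset.sum_apply, smul_eq_mul,
          Fin.prod_univ_succ]
        rw [eq_inv_mul_iff_mul_eq₀ hn.ne', this]
        ring
      rw [e]
      refine Subalgebra.smul_mem _ (Subalgebra.add_mem _ (Subalgebra.smul_mem _
        (Subalgebra.mul_mem _ (integral_mem_integralAlgebra (hg 0))
          (ih (fun j => g j.succ) fun j => hg _)) _) (Subalgebra.sum_mem _ fun j _ => ?_)) _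
      exact ih _ (mulAt_mem (p := (· ∈ 𝒜)) (fun j => hg j.succ) j (hmul _ (hg _) _ (hg _)))
  · intro u v hu hv hu' hv'
    have e : (fun μ => ∫ G, u G + v G ∂κ μ) = (fun μ => ∫ G, u G ∂κ μ) + fun μ => ∫ G, v G ∂κ μ := by
      funext μ
      exact integral_add ((isBoundedMeasurable_of_mem_integralAlgebra h𝒜 hu).integrable _)
        ((isBoundedMeasurable_of_mem_integralAlgebra h𝒜 hv).integrable _)
    rw [e]
    exact Subalgebra.add_mem _ hu' hv'
  · intro c u _ hu'
    have e : (fun μ => ∫ G, c * u G ∂κ μ) = c • fun μ => ∫ G, u G ∂κ μ := by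
      funext μ
      exact integral_const_mul _ _
    rw [e]
    exact Subalgebra.smul_mem _ hu' _

lemma measurable_integrals {Ω : Type*} [MeasurableSpace Ω] {n : ℕ}
    {B : Ω → ProbabilityMeasure X} {D : ℕ → Ω → ProbabilityMeasure X} (hB : Measurable B)
    (hD : ∀ r, Measurable (D r)) (r : Fin n → Option ℕ) {g : Fin n → X → ℝ}
    (hg : ∀ j, Measurable (g j)) : Measurable (integrals B D r g) := by
  refine measurable_pi_lambda _ fun j => ?_
  cases h : r j with
  | none => simpa [integrals, h, Function.comp_def] using
    (measurable_integral_probabilityMeasure (hg j)).comp hB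
  | some s => simpa [integrals, h, Function.comp_def] using
    (measurable_integral_probabilityMeasure (hg j)).comp (hD s)

/-- Sort the factors of a product of integrals by the measures to which they belong. -/
lemma prod_integrals_eq {Ω : Type*} {n m : ℕ} (B : Ω → ProbabilityMeasure X)
    (D : ℕ → Ω → ProbabilityMeasure X) (r : Fin n → Option ℕ) (g : Fin n → X → ℝ)
    (k : Fin m → Fin n) (ω : Ω) :
    ∏ s, integrals B D r g ω (k s) =
      (∏ s, if r (k s) = none then ∫ x, g (k s) x ∂(B ω : Measure X) else 1) *
      ∏ t ∈ Finset.univ.biUnion fun s => (r (k s)).toFinset,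
        ∏ s, if r (k s) = some t then ∫ x, g (k s) x ∂(D t ω : Measure X) else 1 := by
  rw [Finset.prod_comm, ← Finset.prod_mul_distrib]
  refine Finset.prod_congr rfl fun s _ => ?_
  cases h : r (k s) with
  | none => simp [integrals, h]
  | some t₀ =>
    have ht : t₀ ∈ Finset.univ.biUnion fun s => (r (k s)).toFinset :=
      Finset.mem_biUnion.mpr ⟨s, Finset.mem_univ s, by simp [h]⟩
    simp only [integrals, h, Option.elim, reduceCtorEq, if_false, one_mul, Option.some.injEq]
    rw [Finset.prod_ite_eq, if_pos ht]

/-- If the mixed moments of the base measures converge, then the base measures and independent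
draws from the Dirichlet processes around them converge jointly. -/
theorem tendstoInDistribution_integrals (h𝒜 : ∀ f ∈ 𝒜, IsBoundedMeasurable f)
    (hmul : ∀ f ∈ 𝒜, ∀ g ∈ 𝒜, (fun x => f x * g x) ∈ 𝒜) {α : ℝ} (hα : 0 < α)
    {κ : Kernel (ProbabilityMeasure X) (ProbabilityMeasure X)} (hκ : IsDPKernel α κ)
    {ι : Type*} {l : Filter ι} {Ω : ι → Type*} [∀ i, MeasurableSpace (Ω i)]
    {P : ∀ i, Measure (Ω i)} [∀ i, IsProbabilityMeasure (P i)]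
    {B : ∀ i, Ω i → ProbabilityMeasure X} {D : ∀ i, ℕ → Ω i → ProbabilityMeasure X}
    (hB : ∀ i, Measurable (B i)) (hD : ∀ i r, Measurable (D i r))
    (hBD : ∀ i, CondIID (P i) (B i) (D i) κ)
    {Ω' : Type*} [MeasurableSpace Ω'] {P' : Measure Ω'} [IsProbabilityMeasure P']
    {B' : Ω' → ProbabilityMeasure X} {D' : ℕ → Ω' → ProbabilityMeasure X}
    (hB' : Measurable B') (hD' : ∀ r, Measurable (D' r)) (hBD' : CondIID P' B' D' κ)
    (hlim : ∀ (n : ℕ) (g : Fin n → X → ℝ), (∀ j, g j ∈ 𝒜) →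
      Tendsto (fun i => ∫ ω, ∏ j, ∫ x, g j x ∂(B i ω : Measure X) ∂P i) l
        (𝓝 (∫ ω, ∏ j, ∫ x, g j x ∂(B' ω : Measure X) ∂P')))
    {n : ℕ} (r : Fin n → Option ℕ) (g : Fin n → X → ℝ) (hg : ∀ j, g j ∈ 𝒜) :
    TendstoInDistribution (fun i => integrals (B i) (D i) r g) l (integrals B' D' r g) P P' := by
  have := hκ.isMarkovKernel
  have hbm := fun {u} hu => isBoundedMeasurable_of_mem_integralAlgebra (u := u) h𝒜 hu
  have hlim' : ∀ u ∈ integralAlgebra 𝒜,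
      Tendsto (fun i => ∫ ω, u (B i ω) ∂P i) l (𝓝 (∫ ω, u (B' ω) ∂P')) := by
    intro u hu
    refine integralAlgebra_induction (p := fun u =>
      Tendsto (fun i => ∫ ω, u (B i ω) ∂P i) l (𝓝 (∫ ω, u (B' ω) ∂P'))) hlim ?_ ?_ hu
    · intro u v hu hv hu' hv'
      rw [integral_add ((hbm hu).integrable_comp hB'.aemeasurable)
        ((hbm hv).integrable_comp hB'.aemeasurable)]
      simp_rw [fun i => integral_add ((hbm hu).integrable_comp (hB i).aemeasurable (μ := P i))
        ((hbm hv).integrable_comp (hB i).aemeasurable)]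
      exact hu'.add hv'
    · intro c u _ hu'
      simp_rw [integral_const_mul]
      exact hu'.const_mul c
  choose C hC using fun j => (h𝒜 _ (hg j)).bounded
  refine tendstoInDistribution_of_moments
    (fun i => (measurable_integrals (hB i) (hD i) r fun j => (h𝒜 _ (hg j)).measurable).aemeasurable)
    (measurable_integrals hB' hD' r fun j => (h𝒜 _ (hg j)).measurable).aemeasurable
    (∑ j, |C j|)
    (fun i => ae_of_all _ fun ω j => ((abs_integral_le_of_bound (hC j) _).trans
      (le_abs_self _)).trans (Finset.single_le_sum (f := fun j => |C j|)
        (fun i _ => abs_nonneg _) (Finset.mem_univ j)))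
    (ae_of_all _ fun ω j => ((abs_integral_le_of_bound (hC j) _).trans
      (le_abs_self _)).trans (Finset.single_le_sum (f := fun j => |C j|)
        (fun i _ => abs_nonneg _) (Finset.mem_univ j))) fun m k => ?_
  set u₀ : ProbabilityMeasure X → ℝ :=
    fun μ => ∏ s, if r (k s) = none then ∫ x, g (k s) x ∂(μ : Measure X) else 1 with hu₀
  set u : ℕ → ProbabilityMeasure X → ℝ :=
    fun t μ => ∏ s, if r (k s) = some t then ∫ x, g (k s) x ∂(μ : Measure X) else 1 with hu
  have hmem : ∀ o : Option ℕ, (fun μ : ProbabilityMeasure X =>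
      ∏ s, if r (k s) = o then ∫ x, g (k s) x ∂(μ : Measure X) else 1) ∈ integralAlgebra 𝒜 := by
    intro o
    have e : (fun μ : ProbabilityMeasure X =>
        ∏ s, if r (k s) = o then ∫ x, g (k s) x ∂(μ : Measure X) else 1) =
        ∏ s, fun μ : ProbabilityMeasure X =>
          if r (k s) = o then ∫ x, g (k s) x ∂(μ : Measure X) else 1 := by
      funext μ; simp
    rw [e]
    refine Subalgebra.prod_mem _ fun s _ => ?_
    split_ifs
    · exact integral_mem_integralAlgebra (hg _)
    · exact one_mem _
  set T := Finset.univ.biUnion fun s => (r (k s)).toFinset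
  -- Given the base measure the groups are independent, so a joint moment of base and groups is the
  -- mean of this function of the base measure alone; it is again a polynomial in integrals.
  have hv : (fun μ => u₀ μ * ∏ t ∈ T, ∫ G, u t G ∂κ μ) ∈ integralAlgebra 𝒜 := by
    have e : (fun μ => u₀ μ * ∏ t ∈ T, ∫ G, u t G ∂κ μ) =
        u₀ * ∏ t ∈ T, fun μ => ∫ G, u t G ∂κ μ := by funext μ; simp
    rw [e]
    exact Subalgebra.mul_mem _ (hmem none) (Subalgebra.prod_mem _ fun t _ =>
      integral_kernel_mem_integralAlgebra h𝒜 hmul hα hκ (hmem (some t)))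
  simp_rw [prod_integrals_eq]
  have e' := hBD'.integral_prod hB' hD' T (hbm (hmem none)) (u := u) fun t => hbm (hmem (some t))
  have e := fun i => (hBD i).integral_prod (hB i) (hD i) T (hbm (hmem none)) (u := u)
    fun t => hbm (hmem (some t))
  rw [e']
  exact (hlim' _ hv).congr fun i => (e i).symm

end Continuity

/-! ### Finite mixtures over conditionally i.i.d. atoms -/

lemma IsBoundedMeasurable.list_prod {X J : Type*} [MeasurableSpace X] (f : J → X → ℝ) (hs : List J)
    (hf : ∀ h ∈ hs, IsBoundedMeasurable (f h)) :
    IsBoundedMeasurable fun x => (hs.map fun h => f h x).prod := by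
  induction hs with
  | nil => simpa using IsBoundedMeasurable.const 1
  | cons h hs ih =>
    simpa using (hf h (by simp)).mul (ih fun h' h'' => hf h' (by simp [h'']))

section Mixture

variable {T : Type*} [MeasurableSpace T]

/-- The empirical mean of `h` over the first `K` terms of a sequence. -/
noncomputable def empiricalMean (K : ℕ) (h : T → ℝ) (x : ℕ → T) : ℝ :=
  (∑ k : Fin K, h (x k)) / K

lemma IsBoundedMeasurable.empiricalMean {h : T → ℝ} (hh : IsBoundedMeasurable h) (K : ℕ) :
    IsBoundedMeasurable (empiricalMean K h) := by
  have := (IsBoundedMeasurable.sum Finset.univ fun k : Fin K =>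
    hh.comp (measurable_pi_apply (X := fun _ : ℕ => T) (k : ℕ))).mul
      (IsBoundedMeasurable.const ((K : ℝ)⁻¹))
  have e : _root_.empiricalMean K h = fun x : ℕ → T => (∑ k : Fin K, h (x k)) * (K : ℝ)⁻¹ :=
    funext fun x => div_eq_mul_inv _ _
  rw [e]
  exact this

lemma abs_empiricalMean_le {T : Type*} {h : T → ℝ} {C : ℝ} (hC : ∀ x, |h x| ≤ C) {K : ℕ} (hK : 0 < K)
    (x : ℕ → T) : |empiricalMean K h x| ≤ C := by
  have hK' : (0 : ℝ) < K := by exact_mod_cast hK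
  rw [empiricalMean, abs_div, abs_of_pos hK', div_le_iff₀ hK']
  calc |∑ k : Fin K, h (x k)| ≤ ∑ k : Fin K, |h (x k)| := Finset.abs_sum_le_sum_abs _ _
    _ ≤ ∑ _k : Fin K, C := Finset.sum_le_sum fun k _ => hC _
    _ = C * K := by simp [mul_comm]

section Single

variable {Ω : Type*} [MeasurableSpace Ω] {P : Measure Ω} {K : ℕ}
  {γ α : ℝ} {a : ℕ → Ω → T} {β : Ω → Fin K → ℝ} {π : ℕ → Ω → Fin K → ℝ}
  {B : Ω → ProbabilityMeasure T} {D : ℕ → Ω → ProbabilityMeasure T}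

lemma IsFiniteLevel.ae_integral_eq (h : IsFiniteLevel K γ α P a β π B D) {f : T → ℝ}
    (hf : Measurable f) :
    ∀ᵐ ω ∂P, ∫ x, f x ∂(B ω : Measure T) = ∑ k : Fin K, f (a k ω) * β ω k := by
  filter_upwards [h.ae_weight, h.base_eq] with ω h1 h2
  rw [h2]
  exact integral_atomicMeasure (fun k => a k ω) h1.1 hf

variable [IsProbabilityMeasure P]

lemma IsFiniteLevel.map_prod_eq (h : IsFiniteLevel K γ α P a β π B D) (ha : ∀ k, Measurable (a k))
    (hind : IndepFun (fun ω => (β ω, fun r => π r ω)) (fun ω k => a k ω) P) :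
    P.map (fun ω => ((fun k => a k ω), β ω)) =
      (P.map fun ω k => a k ω).prod (dirichlet fun _ : Fin K => γ / K) := by
  have h1 : IndepFun (fun ω k => a k ω) β P := hind.symm.comp measurable_id measurable_fst
  rw [← h.weight_law]
  exact (indepFun_iff_map_prod_eq_prod_map_map (measurable_pi_lambda _ ha).aemeasurable
    h.measurable_weight.aemeasurable).mp h1

/-- Integrate out the weights. -/
lemma IsFiniteLevel.integral_prod_eq (h : IsFiniteLevel K γ α P a β π B D)
    (ha : ∀ k, Measurable (a k))
    (hind : IndepFun (fun ω => (β ω, fun r => π r ω)) (fun ω k => a k ω) P) {n : ℕ}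
    {g : Fin n → T → ℝ} (hg : ∀ j, IsBoundedMeasurable (g j)) {U : (ℕ → T) → ℝ}
    (hU : IsBoundedMeasurable U) :
    Integrable (fun x => U x * ∫ w, ∏ j, ∑ k : Fin K, g j (x k) * w k ∂dirichlet fun _ => γ / K)
      (P.map fun ω k => a k ω) ∧
    ∫ ω, U (fun k => a k ω) * ∏ j, ∫ x, g j x ∂(B ω : Measure T) ∂P =
      ∫ x, U x * ∫ w, ∏ j, ∑ k : Fin K, g j (x k) * w k ∂dirichlet (fun _ => γ / K)
        ∂P.map fun ω k => a k ω := by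
  have ha' : Measurable fun ω k => a k ω := measurable_pi_lambda _ ha
  have : IsProbabilityMeasure (P.map fun ω k => a k ω) :=
    Measure.isProbabilityMeasure_map ha'.aemeasurable
  let V : (ℕ → T) × (Fin K → ℝ) → ℝ := fun q => U q.1 * ∏ j, ∑ k : Fin K, g j (q.1 k) * q.2 k
  have hV : Measurable V := by
    refine (hU.measurable.comp measurable_fst).mul (Finset.measurable_fun_prod _ fun j _ =>
      Finset.measurable_fun_sum _ fun k _ => Measurable.mul ?_ ?_)
    · exact (hg j).measurable.comp ((measurable_pi_apply _).comp measurable_fst)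
    · exact (measurable_pi_apply k).comp measurable_snd
  have haβ : Measurable fun ω => ((fun k => a k ω), β ω) := ha'.prodMk h.measurable_weight
  have hae : (fun ω => U (fun k => a k ω) * ∏ j, ∫ x, g j x ∂(B ω : Measure T)) =ᵐ[P]
      fun ω => V ((fun k => a k ω), β ω) := by
    filter_upwards [ae_all_iff.mpr fun j => h.ae_integral_eq (hg j).measurable] with ω hω
    simp [V, hω]
  have hint : Integrable (fun ω => V ((fun k => a k ω), β ω)) P :=
    (((hU.comp ha').mul (IsBoundedMeasurable.prod _ fun j =>
      ((hg j).integral.comp h.measurable_base))).integrable P).congr hae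
  have hint' : Integrable V ((P.map fun ω k => a k ω).prod (dirichlet fun _ : Fin K => γ / K)) := by
    rw [← h.map_prod_eq ha hind]
    exact (integrable_map_measure hV.aestronglyMeasurable haβ.aemeasurable).mpr hint
  have hin : ∀ x, ∫ w, V (x, w) ∂dirichlet (fun _ : Fin K => γ / K) =
      U x * ∫ w, ∏ j, ∑ k : Fin K, g j (x k) * w k ∂dirichlet fun _ : Fin K => γ / K :=
    fun x => by
      simp only [V]
      exact integral_const_mul _ _
  refine ⟨by simpa only [hin] using hint'.integral_prod_left, ?_⟩
  rw [integral_congr_ae hae, ← integral_map (f := V) haβ.aemeasurable hV.aestronglyMeasurable,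
    h.map_prod_eq ha hind, integral_prod _ hint']
  simp_rw [hin]

/-- The Pólya urn recursion for a finite mixture: the base distribution is replaced by the empirical
mean of the atoms. -/
lemma IsFiniteLevel.recursion (h : IsFiniteLevel K γ α P a β π B D) (hγ : 0 < γ)
    (ha : ∀ k, Measurable (a k))
    (hind : IndepFun (fun ω => (β ω, fun r => π r ω)) (fun ω k => a k ω) P) {n : ℕ}
    {f : T → ℝ} (hf : IsBoundedMeasurable f) {g : Fin n → T → ℝ}
    (hg : ∀ j, IsBoundedMeasurable (g j)) {U : (ℕ → T) → ℝ} (hU : IsBoundedMeasurable U) :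
    (γ + n) * ∫ ω, U (fun k => a k ω) *
        ((∫ x, f x ∂(B ω : Measure T)) * ∏ j, ∫ x, g j x ∂(B ω : Measure T)) ∂P =
      γ * ∫ ω, (empiricalMean K f (fun k => a k ω) * U (fun k => a k ω)) *
        ∏ j, ∫ x, g j x ∂(B ω : Measure T) ∂P +
      ∑ j, ∫ ω, U (fun k => a k ω) * ∏ j', ∫ x, mulAt g j f j' x ∂(B ω : Measure T) ∂P := by
  have hK : (0 : ℝ) < K := by exact_mod_cast h.pos
  have hc : ∀ j : Fin (n + 1), IsBoundedMeasurable ((Fin.cons f g : Fin (n + 1) → T → ℝ) j) :=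
    fun j => Fin.cases hf hg j
  have e1 := h.integral_prod_eq ha hind hc hU
  simp only [Fin.prod_univ_succ, Fin.cons_zero, Fin.cons_succ] at e1
  have e2 := h.integral_prod_eq ha hind hg ((hf.empiricalMean K).mul hU)
  have e3 := fun j => h.integral_prod_eq ha hind (IsBoundedMeasurable.mulAt hg hf j) hU
  rw [e1.2, e2.2]
  simp_rw [fun j => (e3 j).2]
  rw [← integral_const_mul, ← integral_const_mul, ← integral_finsetSum _ fun j _ => (e3 j).1,
    ← integral_add (e2.1.const_mul γ) (integrable_finsetSum _ fun j _ => (e3 j).1)]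
  refine integral_congr_ae (ae_of_all _ fun x => ?_)
  have hsum : ∑ _k : Fin K, γ / (K : ℝ) = γ := by
    simp [mul_div_cancel₀ _ hK.ne']
  -- The atoms are frozen. Since all parameters equal `γ / K`, the base term `∑ f (x k) * (γ / K)`
  -- is `γ` times the empirical mean.
  have key := integral_dirichlet_linear (fun k : Fin K => f (x k)) (fun j k => g j (x k))
    (a := fun _ => γ / K) (fun k => by positivity) (by rw [hsum]; exact hγ)
  rw [hsum] at key
  have hup : ∀ (j j' : Fin n) (k : Fin K), mulAt g j f j' (x k) =
      Function.update (fun j (k : Fin K) => g j (x k)) j (fun k => g j (x k) * f (x k)) j' k := by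
    intro j j' k
    by_cases hj : j' = j
    · subst hj; simp [mulAt]
    · simp [mulAt, hj]
  simp only [hup]
  rw [mul_left_comm, key, empiricalMean, mul_add, Finset.mul_sum, ← Finset.sum_mul]
  congr 1
  field_simp

variable {S : Type*} [MeasurableSpace S] {Y : Ω → S} {κ : Kernel S T} [IsMarkovKernel κ]

/-- Given `Y`, the deviations of two distinct atoms are independent and centred, hence uncorrelated.
-/
lemma CondIID.integral_mul_self (h : CondIID P Y a κ) (hY : Measurable Y)
    (ha : ∀ r, Measurable (a r)) {f : T → ℝ} (hf : IsBoundedMeasurable f) {k k' : ℕ}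
    (hk : k ≠ k') :
    ∫ ω, (f (a k ω) - ∫ x, f x ∂κ (Y ω)) * (f (a k' ω) - ∫ x, f x ∂κ (Y ω)) ∂P = 0 := by
  have hκ := hf.integral_kernel κ
  have e1 := h.integral_prod hY ha {k, k'} (IsBoundedMeasurable.const 1) (u := fun _ => f) fun _ => hf
  have e2 := fun k => h.integral_prod hY ha {k} hκ (u := fun _ => f) fun _ => hf
  simp only [Finset.prod_pair hk, Finset.prod_singleton, one_mul] at e1 e2
  have i1 := fun k => hf.comp (ha k)
  have i2 := hκ.comp hY
  have e : ∀ ω, (f (a k ω) - ∫ x, f x ∂κ (Y ω)) * (f (a k' ω) - ∫ x, f x ∂κ (Y ω)) =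
      (f (a k ω) * f (a k' ω) - (∫ x, f x ∂κ (Y ω)) * f (a k ω)) -
      ((∫ x, f x ∂κ (Y ω)) * f (a k' ω) - (∫ x, f x ∂κ (Y ω)) * (∫ x, f x ∂κ (Y ω))) :=
    fun ω => by ring
  simp_rw [e]
  rw [integral_sub ((((i1 k).mul (i1 k')).sub (i2.mul (i1 k))).integrable P)
      (((i2.mul (i1 k')).sub (i2.mul i2)).integrable P),
    integral_sub (((i1 k).mul (i1 k')).integrable P) ((i2.mul (i1 k)).integrable P),
    integral_sub ((i2.mul (i1 k')).integrable P) ((i2.mul i2).integrable P), e1, e2, e2]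
  ring

/-- A weak law of large numbers with a rate. -/
lemma CondIID.integral_abs_empiricalMean_sub_le (h : CondIID P Y a κ) (hY : Measurable Y)
    (ha : ∀ r, Measurable (a r)) {f : T → ℝ} (hf : IsBoundedMeasurable f) {C : ℝ}
    (hC : ∀ x, |f x| ≤ C) (hK : 0 < K) :
    ∫ ω, |empiricalMean K f (fun k => a k ω) - ∫ x, f x ∂κ (Y ω)| ∂P ≤
      (1 + (2 * C) ^ 2) / √K := by
  have hK' : (0 : ℝ) < K := by exact_mod_cast hK
  have hs : 0 < √(K : ℝ) := Real.sqrt_pos.mpr hK'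
  have ha' : Measurable fun ω k => a k ω := measurable_pi_lambda _ ha
  set d : ℕ → Ω → ℝ := fun k ω => f (a k ω) - ∫ x, f x ∂κ (Y ω) with hd
  have hdb : ∀ k, IsBoundedMeasurable (d k) := fun k =>
    (hf.comp (ha k)).sub ((hf.integral_kernel κ).comp hY)
  have hdC : ∀ k ω, |d k ω| ≤ 2 * C := fun k ω => by
    have h1 := hC (a k ω)
    have h2 := abs_integral_le_of_bound hC (κ (Y ω))
    exact (abs_sub _ _).trans (by linarith)
  have he : ∀ ω, empiricalMean K f (fun k => a k ω) - ∫ x, f x ∂κ (Y ω) =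
      (∑ k : Fin K, d k ω) / K := by
    intro ω
    simp only [hd, empiricalMean, Finset.sum_sub_distrib, sub_div]
    simp [mul_div_cancel_left₀ _ hK'.ne']
  -- Only the `K` diagonal terms of the square survive.
  have hsq : ∫ ω, (∑ k : Fin K, d k ω) ^ 2 ∂P ≤ K * (2 * C) ^ 2 := by
    have e : ∀ ω, (∑ k : Fin K, d k ω) ^ 2 = ∑ k : Fin K, ∑ k' : Fin K, d k ω * d k' ω := by
      intro ω
      rw [sq, Finset.sum_mul_sum]
    simp_rw [e]
    have hI : ∀ k : Fin K, Integrable (fun ω => ∑ k' : Fin K, d k ω * d k' ω) P := fun k =>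
      (IsBoundedMeasurable.sum _ fun k' : Fin K => (hdb k).mul (hdb k')).integrable P
    rw [integral_finsetSum _ fun k _ => hI k]
    have : ∀ k : Fin K, ∫ ω, ∑ k' : Fin K, d k ω * d k' ω ∂P ≤ (2 * C) ^ 2 := by
      intro k
      rw [integral_finsetSum _ fun (k' : Fin K) _ => ((hdb k).mul (hdb k')).integrable P,
        Finset.sum_eq_single k]
      · have hb : ∀ ω, d k ω * d k ω ≤ (2 * C) ^ 2 := fun ω => by
          rw [← sq, ← sq_abs]
          exact pow_le_pow_left₀ (abs_nonneg _) (hdC k ω) 2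
        calc _ ≤ ∫ _ω, (2 * C) ^ 2 ∂P :=
              integral_mono (((hdb k).mul (hdb k)).integrable P) (integrable_const _) hb
          _ = _ := by simp
      · intro k' _ hk'
        exact h.integral_mul_self hY ha hf (fun hkk => hk' (Fin.ext hkk).symm)
      · simp
    calc _ ≤ ∑ _k : Fin K, (2 * C) ^ 2 := Finset.sum_le_sum fun k _ => this k
      _ = _ := by simp
  have hb := IsBoundedMeasurable.sum Finset.univ fun k : Fin K => hdb k
  -- This is `u ≤ 1 + u ^ 2` for `u = |s| / √K`, divided by `√K`; it bounds the first moment by the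
  -- second without Cauchy–Schwarz.
  have hpt : ∀ ω, |(∑ k : Fin K, d k ω) / K| ≤
      (1 / √K + (∑ k : Fin K, d k ω) ^ 2 * (1 / (K * √K))) := by
    intro ω
    set s := ∑ k : Fin K, d k ω
    rw [abs_div, abs_of_pos hK', ← sq_abs s]
    have e1 : |s| / K = (|s| / √K) * (1 / √K) := by
      rw [div_mul_div_comm, mul_one, Real.mul_self_sqrt hK'.le]
    have e2 : |s| ^ 2 * (1 / (K * √K)) = (|s| / √K) ^ 2 * (1 / √K) := by
      rw [div_pow, Real.sq_sqrt hK'.le]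
      field_simp
    rw [e1, e2, show 1 / √(K : ℝ) = 1 * (1 / √K) by ring, ← mul_assoc, ← mul_assoc, ← add_mul]
    refine mul_le_mul_of_nonneg_right ?_ (by positivity)
    nlinarith [sq_nonneg (|s| / √K - 1), sq_nonneg (|s| / √K + 1)]
  simp_rw [he]
  have hint1 : Integrable (fun ω => |(∑ k : Fin K, d k ω) / K|) P := by
    simpa [div_eq_mul_inv] using ((hb.mul (IsBoundedMeasurable.const (K : ℝ)⁻¹)).integrable P).abs
  have hint2 : Integrable (fun ω => (∑ k : Fin K, d k ω) ^ 2) P := by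
    simpa [sq] using (hb.mul hb).integrable P
  calc _ ≤ ∫ ω, (1 / √K + (∑ k : Fin K, d k ω) ^ 2 * (1 / (K * √K))) ∂P :=
        integral_mono hint1 ((integrable_const _).add (hint2.mul_const _)) hpt
    _ = 1 / √K + (∫ ω, (∑ k : Fin K, d k ω) ^ 2 ∂P) * (1 / (K * √K)) := by
        rw [integral_add (integrable_const _) (hint2.mul_const _), integral_mul_const]
        simp
    _ ≤ 1 / √K + (K * (2 * C) ^ 2) * (1 / (K * √K)) := by gcongr
    _ = _ := by field_simp

end Single

end Mixture

/-! ### The limit of a finite mixture over conditionally i.i.d. atoms -/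

lemma HasCondDistrib.integral_mul {S T Ω : Type*} [MeasurableSpace S] [MeasurableSpace T]
    [MeasurableSpace Ω] {P : Measure Ω} [IsProbabilityMeasure P] {Y : Ω → S} {Z : Ω → T}
    {ρ : Kernel S T} [IsMarkovKernel ρ] (h : HasCondDistrib Z Y ρ P) {V : S → ℝ} {F : T → ℝ}
    (hV : IsBoundedMeasurable V) (hF : IsBoundedMeasurable F) :
    ∫ ω, V (Y ω) * F (Z ω) ∂P = ∫ ω, V (Y ω) * ∫ z, F z ∂ρ (Y ω) ∂P := by
  have hY := h.aemeasurable_fst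
  have := Measure.isProbabilityMeasure_map hY
  have hm : IsBoundedMeasurable fun q : S × T => V q.1 * F q.2 :=
    (hV.comp measurable_fst).mul (hF.comp measurable_snd)
  have hV' := hV.mul (hF.integral_kernel ρ)
  calc ∫ ω, V (Y ω) * F (Z ω) ∂P
      = ∫ q, V q.1 * F q.2 ∂P.map fun ω => (Y ω, Z ω) :=
        (integral_map (f := fun q : S × T => V q.1 * F q.2) h.aemeasurable
          hm.measurable.aestronglyMeasurable).symm
    _ = ∫ y, ∫ z, V y * F z ∂ρ y ∂P.map Y := by
        rw [h.map_eq, Measure.integral_compProd (hm.integrable _)]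
    _ = ∫ y, V y * (∫ z, F z ∂ρ y) ∂P.map Y := by simp_rw [integral_const_mul]
    _ = _ := integral_map (f := fun y => V y * ∫ z, F z ∂ρ y) hY
        hV'.measurable.aestronglyMeasurable

/-- The Pólya urn recursion for a Dirichlet process with a random base distribution. -/
lemma HasCondDistrib.recursion {S T Ω : Type*} [MeasurableSpace S] [MeasurableSpace T]
    [MeasurableSpace Ω] {P : Measure Ω} [IsProbabilityMeasure P] {Y : Ω → S}
    {Z : Ω → ProbabilityMeasure T} {κ : Kernel S T} [IsMarkovKernel κ]
    {ρ : Kernel S (ProbabilityMeasure T)} {γ : ℝ} (hγ : 0 < γ)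
    (hρ : ∀ y, IsDirichletProcess γ (κ y) (ρ y)) (h : HasCondDistrib Z Y ρ P) {n : ℕ}
    {f : T → ℝ} (hf : IsBoundedMeasurable f) {g : Fin n → T → ℝ}
    (hg : ∀ j, IsBoundedMeasurable (g j)) {V : S → ℝ} (hV : IsBoundedMeasurable V) :
    (γ + n) * ∫ ω, V (Y ω) *
        ((∫ x, f x ∂(Z ω : Measure T)) * ∏ j, ∫ x, g j x ∂(Z ω : Measure T)) ∂P =
      γ * ∫ ω, ((∫ x, f x ∂κ (Y ω)) * V (Y ω)) * ∏ j, ∫ x, g j x ∂(Z ω : Measure T) ∂P +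
      ∑ j, ∫ ω, V (Y ω) * ∏ j', ∫ x, mulAt g j f j' x ∂(Z ω : Measure T) ∂P := by
  have : IsMarkovKernel ρ := ⟨fun y => (hρ y).isProbabilityMeasure⟩
  have hp : ∀ {m : ℕ} {g : Fin m → T → ℝ}, (∀ j, IsBoundedMeasurable (g j)) →
      IsBoundedMeasurable fun G : ProbabilityMeasure T => ∏ j, ∫ x, g j x ∂(G : Measure T) :=
    fun hg => IsBoundedMeasurable.prod _ fun j => (hg j).integral
  have hm := fun j => IsBoundedMeasurable.mulAt hg hf j
  have hκ := hf.integral_kernel κ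
  have e1 := HasCondDistrib.integral_mul h hV (hf.integral.mul (hp hg))
  have e2 := HasCondDistrib.integral_mul h (hκ.mul hV) (hp hg)
  have e3 := fun j => HasCondDistrib.integral_mul h hV (hp (hm j))
  rw [e1, e2]
  simp_rw [e3]
  have hY := h.aemeasurable_fst
  have i2 := (((hκ.mul hV).mul ((hp hg).integral_kernel ρ))).integrable_comp hY (μ := P)
  have i3 := fun j => ((hV.mul ((hp (hm j)).integral_kernel ρ))).integrable_comp hY (μ := P)
  rw [← integral_const_mul, ← integral_const_mul, ← integral_finsetSum _ fun j _ => i3 j,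
    ← integral_add (i2.const_mul γ) (integrable_finsetSum _ fun j _ => i3 j)]
  refine integral_congr_ae (ae_of_all _ fun ω => ?_)
  have key := (hρ (Y ω)).polyaRecursion hγ n f g hf hg
  simp only
  rw [mul_left_comm, key, mul_add, Finset.mul_sum]
  congr 1
  ring

section Limit

variable {S T : Type*} [MeasurableSpace S] [MeasurableSpace T] {ι : Type*}
  {Ω : ι → Type*} [∀ i, MeasurableSpace (Ω i)] {P : ∀ i, Measure (Ω i)}
  [∀ i, IsProbabilityMeasure (P i)] {K : ι → ℕ} {a : ∀ i, ℕ → Ω i → T} {Y : ∀ i, Ω i → S}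
  {κ : Kernel S T} [IsMarkovKernel κ]

/-- Telescoping by `e * A - k * B = e * (A - B) + B * (e - k)`. The constant depends only on the
bounds of the functions, not on the index `i`. -/
lemma integral_abs_prod_empiricalMean_sub_le (h : ∀ i, CondIID (P i) (Y i) (a i) κ)
    (hY : ∀ i, Measurable (Y i)) (ha : ∀ i k, Measurable (a i k)) (hK : ∀ i, 0 < K i)
    (hs : List (T → ℝ)) (hhs : ∀ h ∈ hs, IsBoundedMeasurable h) :
    ∃ c, ∀ i, ∫ ω, |(hs.map fun h => empiricalMean (K i) h fun k => a i k ω).prod -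
      (hs.map fun h => ∫ x, h x ∂κ (Y i ω)).prod| ∂P i ≤ c / √(K i) := by
  induction hs with
  | nil => exact ⟨0, by simp⟩
  | cons f hs ih =>
    obtain ⟨c, hc⟩ := ih fun h hh => hhs h (by simp [hh])
    have hf := hhs f (by simp)
    obtain ⟨C, hC⟩ := hf.bounded
    have hκ : IsBoundedMeasurable fun y => (hs.map fun h => ∫ x, h x ∂κ y).prod :=
      IsBoundedMeasurable.list_prod (fun h y => ∫ x, h x ∂κ y) hs fun h hh =>
        (hhs h (by simp [hh])).integral_kernel κ
    obtain ⟨C', hC'⟩ := hκ.bounded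
    refine ⟨|C| * c + |C'| * (1 + (2 * C) ^ 2), fun i => ?_⟩
    have ha' : Measurable fun ω k => a i k ω := measurable_pi_lambda _ (ha i)
    have he : IsBoundedMeasurable fun ω =>
        (hs.map fun h => empiricalMean (K i) h fun k => a i k ω).prod :=
      IsBoundedMeasurable.list_prod (fun h ω => empiricalMean (K i) h fun k => a i k ω) hs
        fun h hh => ((hhs h (by simp [hh])).empiricalMean (K i)).comp ha'
    have hfe := (hf.empiricalMean (K i)).comp ha'
    have hfκ := (hf.integral_kernel κ).comp (hY i)
    have hκ' := hκ.comp (hY i)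
    have hpt : ∀ ω, |((f :: hs).map fun h => empiricalMean (K i) h fun k => a i k ω).prod -
        ((f :: hs).map fun h => ∫ x, h x ∂κ (Y i ω)).prod| ≤
        |C| * |(hs.map fun h => empiricalMean (K i) h fun k => a i k ω).prod -
          (hs.map fun h => ∫ x, h x ∂κ (Y i ω)).prod| +
        |C'| * |empiricalMean (K i) f (fun k => a i k ω) - ∫ x, f x ∂κ (Y i ω)| := by
      intro ω
      simp only [List.map_cons, List.prod_cons]
      set A := (hs.map fun h => empiricalMean (K i) h fun k => a i k ω).prod
      set B := (hs.map fun h => ∫ x, h x ∂κ (Y i ω)).prod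
      set e := empiricalMean (K i) f fun k => a i k ω
      set k := ∫ x, f x ∂κ (Y i ω)
      have h1 : |e| ≤ |C| := (abs_empiricalMean_le hC (hK i) _).trans (le_abs_self _)
      have h2 : |B| ≤ |C'| := (hC' (Y i ω)).trans (le_abs_self _)
      calc |e * A - k * B| = |e * (A - B) + B * (e - k)| := by ring_nf
        _ ≤ |e| * |A - B| + |B| * |e - k| := by
            rw [← abs_mul, ← abs_mul]; exact abs_add_le _ _
        _ ≤ _ := by gcongr
    have hl : IsBoundedMeasurable fun ω =>
        ((f :: hs).map fun h => empiricalMean (K i) h fun k => a i k ω).prod -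
        ((f :: hs).map fun h => ∫ x, h x ∂κ (Y i ω)).prod := by
      simpa using (hfe.mul he).sub (hfκ.mul hκ')
    have i1 := ((he.sub hκ').integrable (P i)).abs
    have i2 := ((hfe.sub hfκ).integrable (P i)).abs
    refine (integral_mono (hl.integrable (P i)).abs ((i1.const_mul |C|).add (i2.const_mul |C'|))
      hpt).trans ?_
    simp only [Pi.add_apply]
    rw [integral_add (i1.const_mul |C|) (i2.const_mul |C'|), integral_const_mul,
      integral_const_mul, add_div, mul_div_assoc, mul_div_assoc]
    gcongr
    · exact hc i
    · exact (h i).integral_abs_empiricalMean_sub_le (hY i) (ha i) hf hC (hK i)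

lemma tendsto_integral_prod_empiricalMean {l : Filter ι} (h : ∀ i, CondIID (P i) (Y i) (a i) κ)
    (hY : ∀ i, Measurable (Y i)) (ha : ∀ i k, Measurable (a i k)) (hK : ∀ i, 0 < K i)
    (hKl : Tendsto K l atTop) (hs : List (T → ℝ)) (hhs : ∀ h ∈ hs, IsBoundedMeasurable h) {x : ℝ}
    (hx : Tendsto (fun i => ∫ ω, (hs.map fun h => ∫ x, h x ∂κ (Y i ω)).prod ∂P i) l (𝓝 x)) :
    Tendsto (fun i => ∫ ω, (hs.map fun h => empiricalMean (K i) h fun k => a i k ω).prod ∂P i) l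
      (𝓝 x) := by
  obtain ⟨c, hc⟩ := integral_abs_prod_empiricalMean_sub_le h hY ha hK hs hhs
  have hlim : Tendsto (fun i => c / √(K i : ℝ)) l (𝓝 0) :=
    (Real.tendsto_sqrt_atTop.comp (tendsto_natCast_atTop_atTop.comp hKl)).const_div_atTop c
  have hdiff : Tendsto (fun i =>
      ∫ ω, (hs.map fun h => empiricalMean (K i) h fun k => a i k ω).prod ∂P i -
      ∫ ω, (hs.map fun h => ∫ x, h x ∂κ (Y i ω)).prod ∂P i) l (𝓝 0) := by
    refine squeeze_zero_norm (fun i => ?_) hlim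
    have i1 : IsBoundedMeasurable fun ω =>
        (hs.map fun h => empiricalMean (K i) h fun k => a i k ω).prod :=
      IsBoundedMeasurable.list_prod (fun h ω => empiricalMean (K i) h fun k => a i k ω) hs
        fun h hh => ((hhs h hh).empiricalMean (K i)).comp (measurable_pi_lambda _ (ha i))
    have i2 : IsBoundedMeasurable fun ω => (hs.map fun h => ∫ x, h x ∂κ (Y i ω)).prod :=
      IsBoundedMeasurable.list_prod (fun h ω => ∫ x, h x ∂κ (Y i ω)) hs fun h hh =>
        ((hhs h hh).integral_kernel κ).comp (hY i)
    rw [← integral_sub (i1.integrable _) (i2.integrable _)]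
    exact (norm_integral_le_integral_norm _).trans (hc i)
  simpa using hdiff.add hx

/-- If the atoms are conditionally i.i.d. with law `κ Y`, then a finite Dirichlet mixture over
them tends to the Dirichlet process with base distribution `κ Y`, provided that the mixed moments
of `κ Y` converge. -/
theorem tendsto_integral_prod_integral_mixture {l : Filter ι}
    (h : ∀ i, CondIID (P i) (Y i) (a i) κ) (hY : ∀ i, Measurable (Y i))
    (ha : ∀ i k, Measurable (a i k)) (hKl : Tendsto K l atTop) {γ α : ℝ} (hγ : 0 < γ)
    {β : ∀ i, Ω i → Fin (K i) → ℝ} {π : ∀ i, ℕ → Ω i → Fin (K i) → ℝ}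
    {B : ∀ i, Ω i → ProbabilityMeasure T} {D : ∀ i, ℕ → Ω i → ProbabilityMeasure T}
    (hfin : ∀ i, IsFiniteLevel (K i) γ α (P i) (a i) (β i) (π i) (B i) (D i))
    (hind : ∀ i, IndepFun (fun ω => (β i ω, fun r => π i r ω)) (fun ω k => a i k ω) (P i))
    {Ω' : Type*} [MeasurableSpace Ω'] {P' : Measure Ω'} [IsProbabilityMeasure P'] {Y' : Ω' → S}
    {Z : Ω' → ProbabilityMeasure T} {ρ : Kernel S (ProbabilityMeasure T)}
    (hρ : ∀ y, IsDirichletProcess γ (κ y) (ρ y)) (hZ : HasCondDistrib Z Y' ρ P')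
    {𝒜 : Set (T → ℝ)} (h𝒜 : ∀ f ∈ 𝒜, IsBoundedMeasurable f)
    (hmul : ∀ f ∈ 𝒜, ∀ g ∈ 𝒜, (fun x => f x * g x) ∈ 𝒜)
    (hbase : ∀ hs : List (T → ℝ), (∀ h ∈ hs, h ∈ 𝒜) →
      Tendsto (fun i => ∫ ω, (hs.map fun h => ∫ x, h x ∂κ (Y i ω)).prod ∂P i) l
        (𝓝 (∫ ω, (hs.map fun h => ∫ x, h x ∂κ (Y' ω)).prod ∂P')))
    (n : ℕ) (g : Fin n → T → ℝ) (hg : ∀ j, g j ∈ 𝒜) :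
    Tendsto (fun i => ∫ ω, ∏ j, ∫ x, g j x ∂(B i ω : Measure T) ∂P i) l
      (𝓝 (∫ ω, ∏ j, ∫ x, g j x ∂(Z ω : Measure T) ∂P')) := by
  have hK : ∀ i, 0 < K i := fun i => (hfin i).pos
  -- Each use of the recursion turns an integral against the mixture into an empirical mean of the
  -- atoms. The list `hs` collects these, matched in the limit by integrals against `κ Y'`. Once no
  -- integral against the mixture is left, the law of large numbers and `hbase` conclude.
  suffices H : ∀ (n : ℕ) (hs : List (T → ℝ)), (∀ h ∈ hs, h ∈ 𝒜) → ∀ g : Fin n → T → ℝ,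
      (∀ j, g j ∈ 𝒜) →
      Tendsto (fun i => ∫ ω, (hs.map fun h => empiricalMean (K i) h fun k => a i k ω).prod *
          ∏ j, ∫ x, g j x ∂(B i ω : Measure T) ∂P i) l
        (𝓝 (∫ ω, (hs.map fun h => ∫ x, h x ∂κ (Y' ω)).prod *
          ∏ j, ∫ x, g j x ∂(Z ω : Measure T) ∂P')) by
    simpa using H n [] (by simp) g hg
  intro n
  induction n with
  | zero =>
    intro hs hhs g _
    simpa using tendsto_integral_prod_empiricalMean h hY ha hK hKl hs (fun f hf => h𝒜 f (hhs f hf))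
      (hbase hs hhs)
  | succ n ih =>
    intro hs hhs g hg
    have hn : (0 : ℝ) < γ + n := by positivity
    have hU : ∀ i, IsBoundedMeasurable fun x : ℕ → T =>
        (hs.map fun h => empiricalMean (K i) h x).prod := fun i =>
      IsBoundedMeasurable.list_prod (empiricalMean (K i)) hs fun f hf =>
        (h𝒜 f (hhs f hf)).empiricalMean (K i)
    have hV : IsBoundedMeasurable fun y => (hs.map fun h => ∫ x, h x ∂κ y).prod :=
      IsBoundedMeasurable.list_prod (fun h y => ∫ x, h x ∂κ y) hs fun f hf =>
        (h𝒜 f (hhs f hf)).integral_kernel κ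
    have e := fun i => (hfin i).recursion hγ (ha i) (hind i) (h𝒜 _ (hg 0))
      (fun j : Fin n => h𝒜 _ (hg j.succ)) (hU i)
    have e' := HasCondDistrib.recursion hγ hρ hZ (h𝒜 _ (hg 0))
      (fun j : Fin n => h𝒜 _ (hg j.succ)) hV
    have h1 := ih (g 0 :: hs) (by simpa using ⟨hg 0, hhs⟩) (fun j => g j.succ) fun j => hg _
    simp only [List.map_cons, List.prod_cons] at h1
    have h2 := fun j => ih hs hhs (mulAt (fun j => g (Fin.succ j)) j (g 0))
      (mulAt_mem (p := (· ∈ 𝒜)) (fun j => hg j.succ) j (hmul _ (hg _) _ (hg _)))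
    have h3 := ((h1.const_mul γ).add (tendsto_finsetSum Finset.univ fun j _ => h2 j)).const_mul
      (γ + n)⁻¹
    simp only [Fin.prod_univ_succ]
    rw [← e', inv_mul_cancel_left₀ hn.ne'] at h3
    refine h3.congr fun i => ?_
    rw [← e i, inv_mul_cancel_left₀ hn.ne']

end Limit

/-! ### From bounded to integrable test functions -/

section Truncation

variable {X : Type*} [MeasurableSpace X]

/-- Truncation at levels `±M`. -/
noncomputable def truncate (M : ℕ) (f : X → ℝ) (x : X) : ℝ := max (-M) (min M (f x))

lemma isBoundedMeasurable_truncate {f : X → ℝ} (hf : Measurable f) (M : ℕ) :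
    IsBoundedMeasurable (truncate M f) where
  measurable := measurable_const.max (measurable_const.min hf)
  bounded := ⟨M, fun x => abs_le.mpr ⟨le_max_left _ _, max_le (by simp) (min_le_left _ _)⟩⟩

lemma abs_sub_truncate_le {X : Type*} (M : ℕ) (f : X → ℝ) (x : X) :
    |f x - truncate M f x| ≤ |f x| := by
  have hM : (0 : ℝ) ≤ M := Nat.cast_nonneg M
  unfold truncate
  rcases le_total (M : ℝ) (f x) with h | h
  · rw [min_eq_left h, max_eq_right (by linarith), abs_of_nonneg (by linarith),
      abs_of_nonneg (by linarith)]
    linarith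
  · rw [min_eq_right h]
    rcases le_total (-M : ℝ) (f x) with h' | h'
    · rw [max_eq_right h']
      simp
    · rw [max_eq_left h', abs_of_nonpos (by linarith), abs_of_nonpos (by linarith)]
      linarith

lemma truncate_eq_self {X : Type*} {M : ℕ} {f : X → ℝ} {x : X} (h : |f x| ≤ M) :
    truncate M f x = f x := by
  rw [abs_le] at h
  rw [truncate, min_eq_right h.2, max_eq_right h.1]

lemma tendsto_integral_abs_sub_truncate {m : Measure X} {f : X → ℝ} (hf : Measurable f)
    (hfi : Integrable f m) :
    Tendsto (fun M => ∫ x, |f x - truncate M f x| ∂m) atTop (𝓝 0) := by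
  have := tendsto_integral_of_dominated_convergence (μ := m)
    (F := fun M x => |f x - truncate M f x|) (f := fun _ => 0) (fun x => |f x|)
    (fun M => ((hf.sub (isBoundedMeasurable_truncate hf M).measurable).abs).aestronglyMeasurable)
    hfi.abs
    (fun M => ae_of_all _ fun x => by simpa using abs_sub_truncate_le M f x)
    (ae_of_all _ fun x => by
      obtain ⟨N, hN⟩ := exists_nat_ge |f x|
      refine tendsto_const_nhds.congr' ?_
      filter_upwards [eventually_ge_atTop N] with M hM
      rw [truncate_eq_self (hN.trans (by exact_mod_cast hM))]
      simp)
  simpa using this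

/-- If the mean of the random probability measure `G` is `m`, then integration against `G`
contracts the `L¹`-distances. -/
lemma integral_abs_integral_sub_le {Ω : Type*} [MeasurableSpace Ω] {P : Measure Ω}
    {G : Ω → ProbabilityMeasure X} (hG : Measurable G) {m : Measure X}
    (hm : P.bind (fun ω => (G ω : Measure X)) = m) {f g : X → ℝ} (hf : Measurable f)
    (hg : Measurable g) (hfi : Integrable f m) (hgi : Integrable g m) :
    Integrable (fun ω => ∫ x, f x ∂(G ω : Measure X) - ∫ x, g x ∂(G ω : Measure X)) P ∧
    ∫ ω, |∫ x, f x ∂(G ω : Measure X) - ∫ x, g x ∂(G ω : Measure X)| ∂P ≤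
      ∫ x, |f x - g x| ∂m := by
  have hG' : Measurable fun ω => (G ω : Measure X) := measurable_toMeasure.comp hG
  have hlin : ∀ {u : X → ℝ}, Measurable u →
      ∫⁻ x, ‖u x‖ₑ ∂m = ∫⁻ ω, ∫⁻ x, ‖u x‖ₑ ∂(G ω : Measure X) ∂P := fun hu => by
    rw [← hm, Measure.lintegral_bind hG'.aemeasurable hu.enorm.aemeasurable]
  have hfin : ∀ {u : X → ℝ}, Measurable u → Integrable u m →
      ∀ᵐ ω ∂P, Integrable u (G ω : Measure X) := fun {u} hu hui => by
    have h1 : ∫⁻ ω, ∫⁻ x, ‖u x‖ₑ ∂(G ω : Measure X) ∂P ≠ ∞ := by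
      rw [← hlin hu]; exact hui.2.ne
    have h2 : Measurable fun ω => ∫⁻ x, ‖u x‖ₑ ∂(G ω : Measure X) :=
      (Measure.measurable_lintegral hu.enorm).comp hG'
    filter_upwards [ae_lt_top h2 h1] with ω hω
    exact ⟨hu.aestronglyMeasurable, hω⟩
  have hmeas : Measurable fun ω =>
      ∫ x, f x ∂(G ω : Measure X) - ∫ x, g x ∂(G ω : Measure X) :=
    ((measurable_integral_probabilityMeasure hf).comp hG).sub
      ((measurable_integral_probabilityMeasure hg).comp hG)
  have hfg : Measurable fun x => f x - g x := hf.sub hg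
  have hle : ∫⁻ ω, ‖∫ x, f x ∂(G ω : Measure X) - ∫ x, g x ∂(G ω : Measure X)‖ₑ ∂P ≤
      ∫⁻ x, ‖f x - g x‖ₑ ∂m := by
    rw [hlin hfg]
    refine lintegral_mono_ae ?_
    filter_upwards [hfin hf hfi, hfin hg hgi] with ω h1 h2
    rw [← integral_sub h1 h2]
    exact enorm_integral_le_lintegral_enorm _
  have hlt := (hfi.sub hgi).2
  refine ⟨⟨hmeas.aestronglyMeasurable, hle.trans_lt hlt⟩, ?_⟩
  simp_rw [← Real.norm_eq_abs]
  rw [integral_norm_eq_lintegral_enorm hmeas.aestronglyMeasurable,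
    integral_norm_eq_lintegral_enorm hfg.aestronglyMeasurable]
  exact ENNReal.toReal_mono hlt.ne hle

/-- The bound involves only the Lipschitz constant and the common mean `m`, so it is uniform over a
family of random measures with that mean. -/
lemma abs_integral_lipschitz_integrals_sub_le {Ω : Type*} [MeasurableSpace Ω] {P : Measure Ω}
    [IsProbabilityMeasure P] {B : Ω → ProbabilityMeasure X} {D : ℕ → Ω → ProbabilityMeasure X}
    (hB : Measurable B) (hD : ∀ r, Measurable (D r)) {m : Measure X}
    (hmB : P.bind (fun ω => (B ω : Measure X)) = m)
    (hmD : ∀ r, P.bind (fun ω => (D r ω : Measure X)) = m)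
    {n : ℕ} (r : Fin n → Option ℕ) {g g' : Fin n → X → ℝ} (hg : ∀ j, Measurable (g j))
    (hg' : ∀ j, Measurable (g' j)) (hgi : ∀ j, Integrable (g j) m)
    (hgi' : ∀ j, Integrable (g' j) m) {F : (Fin n → ℝ) → ℝ} {L : ℝ≥0} (hF : LipschitzWith L F)
    {C : ℝ} (hC : ∀ x y, dist (F x) (F y) ≤ C) :
    |∫ ω, F (integrals B D r g ω) ∂P - ∫ ω, F (integrals B D r g' ω) ∂P| ≤
      L * ∑ j, ∫ x, |g j x - g' j x| ∂m := by
  have hFb : IsBoundedMeasurable F := by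
    refine ⟨hF.continuous.measurable, C + |F 0|, fun x => ?_⟩
    have := hC x 0
    rw [Real.dist_eq] at this
    have h2 := abs_add_le (F x - F 0) (F 0)
    rw [sub_add_cancel] at h2
    linarith
  have hi := hFb.comp (measurable_integrals hB hD r hg)
  have hi' := hFb.comp (measurable_integrals hB hD r hg')
  have hone : ∀ j, Integrable (fun ω => integrals B D r g ω j - integrals B D r g' ω j) P ∧
      ∫ ω, |integrals B D r g ω j - integrals B D r g' ω j| ∂P ≤ ∫ x, |g j x - g' j x| ∂m := by
    intro j
    unfold integrals
    cases r j with
    | none => exact integral_abs_integral_sub_le hB hmB (hg j) (hg' j) (hgi j) (hgi' j)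
    | some s => exact integral_abs_integral_sub_le (hD s) (hmD s) (hg j) (hg' j) (hgi j) (hgi' j)
  rw [← integral_sub (hi.integrable P) (hi'.integrable P)]
  calc |∫ ω, F (integrals B D r g ω) - F (integrals B D r g' ω) ∂P|
      ≤ ∫ ω, |F (integrals B D r g ω) - F (integrals B D r g' ω)| ∂P :=
        abs_integral_le_integral_abs
    _ ≤ ∫ ω, L * ∑ j, |integrals B D r g ω j - integrals B D r g' ω j| ∂P := by
        refine integral_mono ((hi.sub hi').integrable P).abs
          ((integrable_finsetSum _ fun j _ => (hone j).1.abs).const_mul _) fun ω => ?_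
        have h1 := hF.dist_le_mul (integrals B D r g ω) (integrals B D r g' ω)
        rw [Real.dist_eq] at h1
        refine h1.trans (mul_le_mul_of_nonneg_left ?_ L.2)
        refine (dist_pi_le_iff (Finset.sum_nonneg fun j _ => abs_nonneg _)).mpr fun j => ?_
        rw [Real.dist_eq]
        exact Finset.single_le_sum
          (f := fun j => |integrals B D r g ω j - integrals B D r g' ω j|)
          (fun j _ => abs_nonneg _) (Finset.mem_univ j)
    _ = L * ∑ j, ∫ ω, |integrals B D r g ω j - integrals B D r g' ω j| ∂P := by
        rw [integral_const_mul, integral_finsetSum _ fun j _ => (hone j).1.abs]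
    _ ≤ _ := mul_le_mul_of_nonneg_left (Finset.sum_le_sum fun j _ => (hone j).2) L.2

/-- Convergence for bounded measurable functions extends to functions which are integrable with
respect to the common mean of all the random measures. -/
theorem tendstoInDistribution_integrals_of_bounded {ι : Type*} {l : Filter ι}
    [l.IsCountablyGenerated] {Ω : ι → Type*} [∀ i, MeasurableSpace (Ω i)]
    {P : ∀ i, Measure (Ω i)} [∀ i, IsProbabilityMeasure (P i)]
    {B : ∀ i, Ω i → ProbabilityMeasure X} {D : ∀ i, ℕ → Ω i → ProbabilityMeasure X}
    (hB : ∀ i, Measurable (B i)) (hD : ∀ i r, Measurable (D i r))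
    {Ω' : Type*} [MeasurableSpace Ω'] {P' : Measure Ω'} [IsProbabilityMeasure P']
    {B' : Ω' → ProbabilityMeasure X} {D' : ℕ → Ω' → ProbabilityMeasure X}
    (hB' : Measurable B') (hD' : ∀ r, Measurable (D' r)) {m : Measure X} [IsFiniteMeasure m]
    (hmB : ∀ i, (P i).bind (fun ω => (B i ω : Measure X)) = m)
    (hmD : ∀ i r, (P i).bind (fun ω => (D i r ω : Measure X)) = m)
    (hmB' : P'.bind (fun ω => (B' ω : Measure X)) = m)
    (hmD' : ∀ r, P'.bind (fun ω => (D' r ω : Measure X)) = m)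
    {n : ℕ} (r : Fin n → Option ℕ)
    (h : ∀ g : Fin n → X → ℝ, (∀ j, IsBoundedMeasurable (g j)) →
      TendstoInDistribution (fun i => integrals (B i) (D i) r g) l (integrals B' D' r g) P P')
    {g : Fin n → X → ℝ} (hg : ∀ j, Measurable (g j)) (hgi : ∀ j, Integrable (g j) m) :
    TendstoInDistribution (fun i => integrals (B i) (D i) r g) l (integrals B' D' r g) P P' := by
  have hV := fun i => (measurable_integrals (hB i) (hD i) r hg).aemeasurable (μ := P i)
  have hV' := (measurable_integrals hB' hD' r hg).aemeasurable (μ := P')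
  -- Testing with bounded Lipschitz functions suffices; here the filter has to be countably
  -- generated.
  refine ⟨hV, hV', tendsto_iff_forall_lipschitz_integral_tendsto.mpr ?_⟩
  rintro F ⟨C, hC⟩ ⟨L, hL⟩
  have hFm := hL.continuous.measurable.aestronglyMeasurable (μ := P'.map (integrals B' D' r g))
  simp only [ProbabilityMeasure.coe_mk]
  rw [integral_map hV' hFm]
  simp_rw [fun i => integral_map (hV i)
    (hL.continuous.measurable.aestronglyMeasurable (μ := (P i).map (integrals (B i) (D i) r g)))]
  let g' : ℕ → Fin n → X → ℝ := fun M j => truncate M (g j)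
  have hg' := fun M j => isBoundedMeasurable_truncate (hg j) M
  have herr : Tendsto (fun M => L * ∑ j, ∫ x, |g j x - g' M j x| ∂m) atTop (𝓝 0) := by
    have := (tendsto_finsetSum Finset.univ fun j _ =>
      tendsto_integral_abs_sub_truncate (hg j) (hgi j)).const_mul (L : ℝ)
    simpa using this
  let Fb : (Fin n → ℝ) →ᵇ ℝ := BoundedContinuousFunction.mkOfBound ⟨F, hL.continuous⟩ C hC
  rw [Metric.tendsto_nhds]
  intro ε hε
  obtain ⟨M, hM⟩ := (Metric.tendsto_nhds.mp herr (ε / 4) (by linarith)).exists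
  have hlim := (tendstoInDistribution_iff_integral
    (fun i => (measurable_integrals (hB i) (hD i) r fun j => (hg' M j).measurable).aemeasurable)
    (measurable_integrals hB' hD' r fun j => (hg' M j).measurable).aemeasurable).mp
      (h (g' M) (hg' M)) Fb
  filter_upwards [Metric.tendsto_nhds.mp hlim (ε / 4) (by linarith)] with i hi
  have e1 := abs_integral_lipschitz_integrals_sub_le (hB i) (hD i) (hmB i) (hmD i) r hg
    (fun j => (hg' M j).measurable) hgi (fun j => (hg' M j).integrable m) hL hC
  have e2 := abs_integral_lipschitz_integrals_sub_le hB' hD' hmB' hmD' r hg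
    (fun j => (hg' M j).measurable) hgi (fun j => (hg' M j).integrable m) hL hC
  change |∫ ω, F (integrals (B i) (D i) r (g' M) ω) ∂P i -
    ∫ ω, F (integrals B' D' r (g' M) ω) ∂P'| < ε / 4 at hi
  rw [Real.dist_eq, sub_zero] at hM
  rw [Real.dist_eq]
  rw [abs_lt] at hM hi ⊢
  replace e1 := abs_le.mp e1
  replace e2 := abs_le.mp e2
  constructor <;> linarith [hM.1, hM.2, hi.1, hi.2, e1.1, e1.2, e2.1, e2.2]

end Truncation

/-! ### Means of random measures -/

lemma bind_eq_of_integral_eq {X Ω : Type*} [MeasurableSpace X] [MeasurableSpace Ω] {P : Measure Ω}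
    [IsProbabilityMeasure P] {G : Ω → ProbabilityMeasure X} (hG : Measurable G) {m : Measure X}
    [IsFiniteMeasure m]
    (h : ∀ f, IsBoundedMeasurable f → ∫ ω, ∫ x, f x ∂(G ω : Measure X) ∂P = ∫ x, f x ∂m) :
    P.bind (fun ω => (G ω : Measure X)) = m := by
  have hG' : Measurable fun ω => (G ω : Measure X) := measurable_toMeasure.comp hG
  ext A hA
  have h1 := h _ (IsBoundedMeasurable.indicator_one hA)
  have h2 : ∀ μ : Measure X, ∫ x, A.indicator (fun _ => (1 : ℝ)) x ∂μ = (μ A).toReal := fun μ =>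
    integral_indicator_one hA
  simp only [h2] at h1
  have h3 : Measurable fun ω => (G ω : Measure X) A := (Measure.measurable_coe hA).comp hG'
  rw [integral_toReal h3.aemeasurable
    (ae_of_all _ fun ω => measure_lt_top _ _)] at h1
  rw [Measure.bind_apply hA hG'.aemeasurable]
  refine (ENNReal.toReal_eq_toReal_iff' ?_ (measure_ne_top _ _)).mp h1
  refine ((lintegral_mono (g := fun _ => 1) fun ω => prob_le_one).trans_lt ?_).ne
  simp

lemma CondIID.integral_comp {Ω S T : Type*} [MeasurableSpace Ω] [MeasurableSpace S]
    [MeasurableSpace T] {P : Measure Ω} [IsProbabilityMeasure P] {Y : Ω → S} {X : ℕ → Ω → T}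
    {κ : Kernel S T} [IsMarkovKernel κ] (h : CondIID P Y X κ) (hY : Measurable Y)
    (hX : ∀ r, Measurable (X r)) (r : ℕ) {f : T → ℝ} (hf : IsBoundedMeasurable f) :
    ∫ ω, f (X r ω) ∂P = ∫ ω, ∫ x, f x ∂κ (Y ω) ∂P := by
  simpa using h.integral_prod hY hX {r} (IsBoundedMeasurable.const 1) (u := fun _ => f) fun _ => hf

lemma CondIID.integral_integral_eq {X Ω : Type*} [MeasurableSpace X] [MeasurableSpace Ω]
    {P : Measure Ω} [IsProbabilityMeasure P] {B : Ω → ProbabilityMeasure X}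
    {D : ℕ → Ω → ProbabilityMeasure X} {α : ℝ} (hα : 0 < α)
    {κ : Kernel (ProbabilityMeasure X) (ProbabilityMeasure X)} (hκ : IsDPKernel α κ)
    (h : CondIID P B D κ) (hB : Measurable B) (hD : ∀ r, Measurable (D r)) (r : ℕ) {f : X → ℝ}
    (hf : IsBoundedMeasurable f) :
    ∫ ω, ∫ x, f x ∂(D r ω : Measure X) ∂P = ∫ ω, ∫ x, f x ∂(B ω : Measure X) ∂P := by
  have := hκ.isMarkovKernel
  rw [h.integral_comp hB hD r hf.integral]
  simp_rw [fun ω => ((hκ (B ω)).polyaRecursion hα).integral_integral hα hf]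

lemma HasCondDistrib.integral_integral_eq {S T Ω : Type*} [MeasurableSpace S] [MeasurableSpace T]
    [MeasurableSpace Ω] {P : Measure Ω} [IsProbabilityMeasure P] {Y : Ω → S}
    {Z : Ω → ProbabilityMeasure T} {κ : Kernel S T} [IsMarkovKernel κ]
    {ρ : Kernel S (ProbabilityMeasure T)} {γ : ℝ} (hγ : 0 < γ)
    (hρ : ∀ y, IsDirichletProcess γ (κ y) (ρ y)) (h : HasCondDistrib Z Y ρ P)
    {f : T → ℝ} (hf : IsBoundedMeasurable f) :
    ∫ ω, ∫ x, f x ∂(Z ω : Measure T) ∂P = ∫ ω, ∫ x, f x ∂κ (Y ω) ∂P := by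
  have := HasCondDistrib.recursion hγ hρ h hf (g := Fin.elim0) (fun j => j.elim0)
    (IsBoundedMeasurable.const 1)
  simp at this
  exact this.resolve_right hγ.ne'

/-- The recursion with `n = 0`: the mean of the mixture is the expected empirical mean, so only the
individual laws of the atoms matter. -/
lemma IsFiniteLevel.integral_integral_eq {T Ω : Type*} [MeasurableSpace T] [MeasurableSpace Ω]
    {P : Measure Ω} [IsProbabilityMeasure P] {K : ℕ} {γ α : ℝ} {a : ℕ → Ω → T}
    {β : Ω → Fin K → ℝ} {π : ℕ → Ω → Fin K → ℝ} {B : Ω → ProbabilityMeasure T}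
    {D : ℕ → Ω → ProbabilityMeasure T} (h : IsFiniteLevel K γ α P a β π B D) (hγ : 0 < γ)
    (ha : ∀ k, Measurable (a k))
    (hind : IndepFun (fun ω => (β ω, fun r => π r ω)) (fun ω k => a k ω) P)
    {f : T → ℝ} (hf : IsBoundedMeasurable f) {c : ℝ} (hc : ∀ k, ∫ ω, f (a k ω) ∂P = c) :
    ∫ ω, ∫ x, f x ∂(B ω : Measure T) ∂P = c := by
  have hK : (K : ℝ) ≠ 0 := by exact_mod_cast h.pos.ne'
  have := h.recursion hγ ha hind hf (g := Fin.elim0) (fun j => j.elim0)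
    (IsBoundedMeasurable.const 1)
  simp at this
  rw [this.resolve_right hγ.ne']
  simp only [empiricalMean]
  rw [integral_div, integral_finsetSum _ fun (k : Fin K) _ => (hf.comp (ha k)).integrable P]
  simp [hc, mul_div_cancel_left₀ _ hK]

/-! ### Convergence of one level of the mixture -/

section Mixture

variable {S T : Type*} [MeasurableSpace S] [MeasurableSpace T] {ι : Type*} {l : Filter ι}
  {Ω : ι → Type*} [∀ i, MeasurableSpace (Ω i)] {P : ∀ i, Measure (Ω i)}
  [∀ i, IsProbabilityMeasure (P i)] {K : ι → ℕ} {a : ∀ i, ℕ → Ω i → T} {Y : ∀ i, Ω i → S}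
  {κ : Kernel S T} [IsMarkovKernel κ] {γ α : ℝ}
  {β : ∀ i, Ω i → Fin (K i) → ℝ} {π : ∀ i, ℕ → Ω i → Fin (K i) → ℝ}
  {B : ∀ i, Ω i → ProbabilityMeasure T} {D : ∀ i, ℕ → Ω i → ProbabilityMeasure T}
  {Ω' : Type*} [MeasurableSpace Ω'] {P' : Measure Ω'} [IsProbabilityMeasure P'] {Y' : Ω' → S}
  {B' : Ω' → ProbabilityMeasure T} {D' : ℕ → Ω' → ProbabilityMeasure T}
  {ρ : Kernel S (ProbabilityMeasure T)}
  {κ' : Kernel (ProbabilityMeasure T) (ProbabilityMeasure T)}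

theorem tendstoInDistribution_mixture
    (h : ∀ i, CondIID (P i) (Y i) (a i) κ) (hY : ∀ i, Measurable (Y i))
    (ha : ∀ i k, Measurable (a i k)) (hKl : Tendsto K l atTop) (hγ : 0 < γ) (hα : 0 < α)
    (hfin : ∀ i, IsFiniteLevel (K i) γ α (P i) (a i) (β i) (π i) (B i) (D i))
    (hind : ∀ i, IndepFun (fun ω => (β i ω, fun r => π i r ω)) (fun ω k => a i k ω) (P i))
    (hρ : ∀ y, IsDirichletProcess γ (κ y) (ρ y)) (hB' : Measurable B')
    (hZ : HasCondDistrib B' Y' ρ P') (hD' : ∀ r, Measurable (D' r)) (hκ' : IsDPKernel α κ')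
    (hBD' : CondIID P' B' D' κ')
    {𝒜 : Set (T → ℝ)} (h𝒜 : ∀ f ∈ 𝒜, IsBoundedMeasurable f)
    (hmul : ∀ f ∈ 𝒜, ∀ g ∈ 𝒜, (fun x => f x * g x) ∈ 𝒜)
    (hbase : ∀ hs : List (T → ℝ), (∀ h ∈ hs, h ∈ 𝒜) →
      Tendsto (fun i => ∫ ω, (hs.map fun h => ∫ x, h x ∂κ (Y i ω)).prod ∂P i) l
        (𝓝 (∫ ω, (hs.map fun h => ∫ x, h x ∂κ (Y' ω)).prod ∂P')))
    {n : ℕ} (r : Fin n → Option ℕ) (g : Fin n → T → ℝ) (hg : ∀ j, g j ∈ 𝒜) :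
    TendstoInDistribution (fun i => integrals (B i) (D i) r g) l (integrals B' D' r g) P P' :=
  tendstoInDistribution_integrals h𝒜 hmul hα hκ' (fun i => (hfin i).measurable_base)
    (fun i => (hfin i).measurable_group)
    (fun i => (hfin i).condIID hα (ha i) (hind i) hκ') hB' hD' hBD'
    (tendsto_integral_prod_integral_mixture h hY ha hKl hγ hfin hind hρ hZ h𝒜 hmul hbase) r g hg

/-- By `hbase` every `Y i` has the law of `Y'`, so the moments of `κ (Y i)` are constant in `i`. The
class `𝒜` can then consist of all bounded measurable functions, and `m`, the mean of `κ Y'`, is the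
mean of all base and group measures. -/
theorem tendstoInDistribution_mixture_of_integrable [l.IsCountablyGenerated]
    (h : ∀ i, CondIID (P i) (Y i) (a i) κ) (hY : ∀ i, Measurable (Y i))
    (ha : ∀ i k, Measurable (a i k)) (hKl : Tendsto K l atTop) (hγ : 0 < γ) (hα : 0 < α)
    (hfin : ∀ i, IsFiniteLevel (K i) γ α (P i) (a i) (β i) (π i) (B i) (D i))
    (hind : ∀ i, IndepFun (fun ω => (β i ω, fun r => π i r ω)) (fun ω k => a i k ω) (P i))
    (hρ : ∀ y, IsDirichletProcess γ (κ y) (ρ y)) (hB' : Measurable B')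
    (hZ : HasCondDistrib B' Y' ρ P') (hD' : ∀ r, Measurable (D' r)) (hκ' : IsDPKernel α κ')
    (hBD' : CondIID P' B' D' κ')
    (hbase : ∀ f : S → ℝ, IsBoundedMeasurable f → ∀ i, ∫ ω, f (Y i ω) ∂P i = ∫ ω, f (Y' ω) ∂P')
    {m : Measure T} [IsFiniteMeasure m]
    (hm : ∀ f, IsBoundedMeasurable f → ∫ ω, ∫ x, f x ∂κ (Y' ω) ∂P' = ∫ x, f x ∂m)
    {n : ℕ} (r : Fin n → Option ℕ) {g : Fin n → T → ℝ} (hg : ∀ j, Measurable (g j))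
    (hgi : ∀ j, Integrable (g j) m) :
    TendstoInDistribution (fun i => integrals (B i) (D i) r g) l (integrals B' D' r g) P P' := by
  have hB := fun i => (hfin i).measurable_base
  have hD := fun i => (hfin i).measurable_group
  have hBD := fun i => (hfin i).condIID hα (ha i) (hind i) hκ'
  have hmB : ∀ i f, IsBoundedMeasurable f →
      ∫ ω, ∫ x, f x ∂(B i ω : Measure T) ∂P i = ∫ x, f x ∂m := fun i f hf =>
    (hfin i).integral_integral_eq hγ (ha i) (hind i) hf fun k => by
      rw [(h i).integral_comp (hY i) (ha i) k hf, hbase _ (hf.integral_kernel κ), hm f hf]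
  have hmB' : ∀ f, IsBoundedMeasurable f →
      ∫ ω, ∫ x, f x ∂(B' ω : Measure T) ∂P' = ∫ x, f x ∂m := fun f hf => by
    rw [HasCondDistrib.integral_integral_eq hγ hρ hZ hf, hm f hf]
  refine tendstoInDistribution_integrals_of_bounded hB hD hB' hD'
    (fun i => bind_eq_of_integral_eq (hB i) (hmB i))
    (fun i s => bind_eq_of_integral_eq (hD i s) fun f hf => ?_)
    (bind_eq_of_integral_eq hB' hmB')
    (fun s => bind_eq_of_integral_eq (hD' s) fun f hf => ?_) r (fun g hg => ?_) hg hgi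
  · rw [(hBD i).integral_integral_eq hα hκ' (hB i) (hD i) s hf, hmB i f hf]
  · rw [hBD'.integral_integral_eq hα hκ' hB' hD' s hf, hmB' f hf]
  · refine tendstoInDistribution_mixture (𝒜 := {f | IsBoundedMeasurable f}) h hY ha hKl hγ hα hfin
      hind hρ hB' hZ hD' hκ' hBD' (fun _ hf => hf) (fun _ hf _ hg => hf.mul hg)
      (fun hs hhs => ?_) r g hg
    have hb := IsBoundedMeasurable.list_prod (fun h y => ∫ x, h x ∂κ y) hs fun h hh =>
      (show IsBoundedMeasurable h from hhs h hh).integral_kernel κ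
    exact tendsto_const_nhds.congr fun i => (hbase _ hb i).symm

end Mixture

/-! ### Atoms which are drawn from the group measures of the level below -/

/-- Continuous functions of the integrals of functions in `𝒯`. -/
def cylinderFunctions {X : Type*} [MeasurableSpace X] (𝒯 : Set (X → ℝ)) :
    Set (ProbabilityMeasure X → ℝ) :=
  {g | ∃ (m : ℕ) (f : Fin m → X → ℝ) (F : (Fin m → ℝ) →ᵇ ℝ), (∀ i, f i ∈ 𝒯) ∧
    ∀ μ, g μ = F fun i => ∫ y, f i y ∂(μ : Measure X)}

section Cylinder

variable {X : Type*} [MeasurableSpace X] {𝒯 : Set (X → ℝ)}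

lemma isBoundedMeasurable_of_mem_cylinderFunctions (h𝒯 : ∀ f ∈ 𝒯, Measurable f)
    {g : ProbabilityMeasure X → ℝ} (hg : g ∈ cylinderFunctions 𝒯) : IsBoundedMeasurable g := by
  obtain ⟨m, f, F, hf, hF⟩ := hg
  obtain rfl : g = _ := funext hF
  exact ⟨F.continuous.measurable.comp (measurable_pi_lambda _ fun i =>
    measurable_integral_probabilityMeasure (h𝒯 _ (hf i))), ‖F‖, fun μ => F.norm_coe_le_norm _⟩

lemma mul_mem_cylinderFunctions {g g' : ProbabilityMeasure X → ℝ} (hg : g ∈ cylinderFunctions 𝒯)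
    (hg' : g' ∈ cylinderFunctions 𝒯) : (fun μ => g μ * g' μ) ∈ cylinderFunctions 𝒯 := by
  obtain ⟨m, f, F, hf, hF⟩ := hg
  obtain ⟨m', f', F', hf', hF'⟩ := hg'
  let p : C(Fin (m + m') → ℝ, Fin m → ℝ) := ⟨fun x i => x (Fin.castAdd m' i), by fun_prop⟩
  let q : C(Fin (m + m') → ℝ, Fin m' → ℝ) := ⟨fun x i => x (Fin.natAdd m i), by fun_prop⟩
  refine ⟨m + m', Fin.append f f', F.compContinuous p * F'.compContinuous q, fun i => ?_,
    fun μ => ?_⟩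
  · refine Fin.addCases (fun j => ?_) (fun j => ?_) i
    · simpa using hf j
    · simpa using hf' j
  · simp [hF, hF', p, q]

/-- If the integrals against base and group measures converge, then so do the mixed moments of
cylinder functions under the law of the groups. -/
lemma tendsto_integral_prod_cylinder {ι : Type*} {l : Filter ι} {Ω : ι → Type*}
    [∀ i, MeasurableSpace (Ω i)] {P : ∀ i, Measure (Ω i)} [∀ i, IsProbabilityMeasure (P i)]
    {Y : ∀ i, Ω i → ProbabilityMeasure X} {A : ∀ i, ℕ → Ω i → ProbabilityMeasure X}
    {Ω' : Type*} [MeasurableSpace Ω'] {P' : Measure Ω'} [IsProbabilityMeasure P']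
    {Y' : Ω' → ProbabilityMeasure X} {A' : ℕ → Ω' → ProbabilityMeasure X}
    {κ : Kernel (ProbabilityMeasure X) (ProbabilityMeasure X)} [IsMarkovKernel κ]
    (hY : ∀ i, Measurable (Y i)) (hA : ∀ i k, Measurable (A i k))
    (hYA : ∀ i, CondIID (P i) (Y i) (A i) κ) (hY' : Measurable Y') (hA' : ∀ k, Measurable (A' k))
    (hYA' : CondIID P' Y' A' κ) (h𝒯 : ∀ f ∈ 𝒯, Measurable f)
    (hlim : ∀ (n : ℕ) (r : Fin n → Option ℕ) (g : Fin n → X → ℝ), (∀ j, g j ∈ 𝒯) →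
      TendstoInDistribution (fun i => integrals (Y i) (A i) r g) l (integrals Y' A' r g) P P')
    (hs : List (ProbabilityMeasure X → ℝ)) (hhs : ∀ h ∈ hs, h ∈ cylinderFunctions 𝒯) :
    Tendsto (fun i => ∫ ω, (hs.map fun h => ∫ x, h x ∂κ (Y i ω)).prod ∂P i) l
      (𝓝 (∫ ω, (hs.map fun h => ∫ x, h x ∂κ (Y' ω)).prod ∂P')) := by
  have hget : ∀ k : Fin hs.length, hs.get k ∈ cylinderFunctions 𝒯 := fun k =>
    hhs _ (List.get_mem hs k)
  choose m f F hf hF using hget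
  -- The functions of the list, continued by the constant `1`.
  let u : ℕ → ProbabilityMeasure X → ℝ := fun k => hs.getD k fun _ => 1
  have hu' : ∀ k : Fin hs.length, u k = hs.get k := fun k => by
    simp [u]
  have hu : ∀ k, IsBoundedMeasurable (u k) := fun k => by
    by_cases hk : k < hs.length
    · rw [hu' ⟨k, hk⟩]
      exact isBoundedMeasurable_of_mem_cylinderFunctions h𝒯 (hhs _ (List.get_mem hs _))
    · simpa [u, List.getD_eq_getElem?_getD, List.getElem?_eq_none (not_lt.mp hk)] using
        IsBoundedMeasurable.const 1
  have hprod : ∀ v : (ProbabilityMeasure X → ℝ) → ℝ,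
      (hs.map v).prod = ∏ k ∈ Finset.range hs.length, v (u k) := by
    intro v
    rw [Finset.prod_range, ← List.prod_ofFn]
    congr 1
    refine List.ext_getElem (by simp) fun k h1 h2 => ?_
    simp [u]
  -- All integrals inside all cylinder functions form one vector, in which those of the `k`-th
  -- function are taken against group `k`. Distinct groups keep the factors conditionally
  -- independent, so that `u k (A k)` averages to `∫ u k ∂κ Y`.
  obtain ⟨N, ⟨e⟩⟩ : ∃ N, Nonempty ((Σ k : Fin hs.length, Fin (m k)) ≃ Fin N) :=
    ⟨_, ⟨Fintype.equivFin _⟩⟩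
  let r : Fin N → Option ℕ := fun j => some ((e.symm j).1 : ℕ)
  let g : Fin N → X → ℝ := fun j => f (e.symm j).1 (e.symm j).2
  let p : ∀ k : Fin hs.length, C(Fin N → ℝ, Fin (m k) → ℝ) := fun k =>
    ⟨fun x i => x (e ⟨k, i⟩), by fun_prop⟩
  have hval : ∀ (x : Fin N → ℝ) (G : ℕ → ProbabilityMeasure X),
      (∀ j, x j = ∫ y, g j y ∂(G (e.symm j).1 : Measure X)) →
      (∏ k : Fin hs.length, (F k).compContinuous (p k)) x =
        ∏ k ∈ Finset.range hs.length, u k (G k) := by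
    intro x G hx
    rw [Finset.prod_range, BoundedContinuousFunction.coe_prod, Finset.prod_apply]
    refine Finset.prod_congr rfl fun k _ => ?_
    rw [hu', hF, BoundedContinuousFunction.compContinuous_apply]
    congr 1
    funext i
    exact (hx _).trans (congrArg (fun q : Σ k : Fin hs.length, Fin (m k) =>
      ∫ y, f q.1 q.2 y ∂(G q.1 : Measure X)) (e.symm_apply_apply ⟨k, i⟩))
  have hgm : ∀ j, Measurable (g j) := fun j => h𝒯 _ (hf _ _)
  have key := (tendstoInDistribution_iff_integral
    (fun i => (measurable_integrals (hY i) (hA i) r hgm).aemeasurable)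
    (measurable_integrals hY' hA' r hgm).aemeasurable).mp (hlim N r g fun j => hf _ _)
      (∏ k : Fin hs.length, (F k).compContinuous (p k))
  rw [integral_congr_ae (ae_of_all _ fun ω => hval (integrals Y' A' r g ω) (fun k => A' k ω)
    fun j => rfl)] at key
  replace key := key.congr fun i => integral_congr_ae (ae_of_all _ fun ω =>
    hval (integrals (Y i) (A i) r g ω) (fun k => A i k ω) fun j => rfl)
  have e1 := fun i => (hYA i).integral_prod (hY i) (hA i) (Finset.range hs.length)
    (IsBoundedMeasurable.const 1) hu
  have e2 := hYA'.integral_prod hY' hA' (Finset.range hs.length) (IsBoundedMeasurable.const 1) hu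
  simp only [one_mul] at e1 e2
  simp_rw [hprod]
  rw [← e2]
  exact key.congr fun i => e1 i

end Cylinder

/-! ### Mixtures over independent atoms and over groups -/

/-- Independent atoms are conditionally i.i.d. over a one-point space, so level `0` becomes an
instance of the general case. -/
lemma condIID_const {Ω T : Type*} [MeasurableSpace Ω] [MeasurableSpace T] {P : Measure Ω}
    {X : ℕ → Ω → T} {m : Measure T} (hX : ∀ k, Measurable (X k)) (hlaw : ∀ k, P.map (X k) = m)
    (hind : iIndepFun X P) : CondIID P (fun _ => ()) X (Kernel.const Unit m) := by
  intro s A B _ hB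
  have h1 := hind.measure_inter_preimage_eq_mul s (sets := B) fun r _ => hB r
  simp_rw [fun r => (Measure.map_apply (μ := P) (hX r) (hB r)).symm, hlaw] at h1
  simp only [Kernel.const_apply, lintegral_const, Measure.restrict_apply MeasurableSet.univ,
    Set.univ_inter]
  by_cases hA : () ∈ A
  · have hP : P Set.univ = 1 := hind.isProbabilityMeasure.measure_univ
    simp [hA, h1, hP]
  · simp [hA]

lemma hasCondDistrib_const {Ω T : Type*} [MeasurableSpace Ω] [MeasurableSpace T] {P : Measure Ω}
    [IsProbabilityMeasure P] {Z : Ω → T} (hZ : Measurable Z) :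
    HasCondDistrib Z (fun _ => ()) (Kernel.const Unit (P.map Z)) P where
  aemeasurable := (measurable_const.prodMk hZ).aemeasurable
  map_eq := by
    rw [Measure.compProd_const]
    exact (indepFun_iff_map_prod_eq_prod_map_map aemeasurable_const hZ.aemeasurable).mp
      (indepFun_const_left () Z)

lemma HasCondDistrib.map_eq_snd {Ω S T : Type*} [MeasurableSpace Ω] [MeasurableSpace S]
    [MeasurableSpace T] {P : Measure Ω} {Y : Ω → S} {Z : Ω → T} {ρ : Kernel S T}
    (h : HasCondDistrib Z Y ρ P) : P.map Z = (P.map Y ⊗ₘ ρ).snd := by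
  rw [← h.map_eq, Measure.snd_map_prodMk₀ h.aemeasurable_fst]

section Limit

variable {T : Type*} [MeasurableSpace T] {ι : Type*} {l : Filter ι}
  {Ω : ι → Type*} [∀ i, MeasurableSpace (Ω i)] {P : ∀ i, Measure (Ω i)}
  [∀ i, IsProbabilityMeasure (P i)] {K : ι → ℕ} {γ α : ℝ}
  {β : ∀ i, Ω i → Fin (K i) → ℝ} {π : ∀ i, ℕ → Ω i → Fin (K i) → ℝ}
  {Ω' : Type*} [MeasurableSpace Ω'] {P' : Measure Ω'} [IsProbabilityMeasure P']

/-- Finite mixtures over independent atoms tend to the hierarchical Dirichlet process. -/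
theorem tendstoInDistribution_mixture_iid [l.IsCountablyGenerated] {a : ∀ i, ℕ → Ω i → T}
    {B : ∀ i, Ω i → ProbabilityMeasure T} {D : ∀ i, ℕ → Ω i → ProbabilityMeasure T}
    {B' : Ω' → ProbabilityMeasure T} {D' : ℕ → Ω' → ProbabilityMeasure T}
    {m : Measure T} [IsProbabilityMeasure m]
    (ha : ∀ i k, Measurable (a i k)) (hlaw : ∀ i k, (P i).map (a i k) = m)
    (ha_ind : ∀ i, iIndepFun (a i) (P i)) (hKl : Tendsto K l atTop) (hγ : 0 < γ) (hα : 0 < α)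
    (hfin : ∀ i, IsFiniteLevel (K i) γ α (P i) (a i) (β i) (π i) (B i) (D i))
    (hind : ∀ i, IndepFun (fun ω => (β i ω, fun r => π i r ω)) (fun ω k => a i k ω) (P i))
    (hB' : Measurable B') (hlaw' : IsDirichletProcess γ m (P'.map B'))
    (hD' : ∀ r, Measurable (D' r)) {κ : Kernel (ProbabilityMeasure T) (ProbabilityMeasure T)}
    (hκ : IsDPKernel α κ) (hBD' : CondIID P' B' D' κ) {n : ℕ} (r : Fin n → Option ℕ)
    {g : Fin n → T → ℝ} (hg : ∀ j, Measurable (g j)) (hgi : ∀ j, Integrable (g j) m) :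
    TendstoInDistribution (fun i => integrals (B i) (D i) r g) l (integrals B' D' r g) P P' :=
  tendstoInDistribution_mixture_of_integrable (Y' := fun _ => ()) (ρ := Kernel.const Unit (P'.map B'))
    (fun i => condIID_const (ha i) (hlaw i) (ha_ind i)) (fun _ => measurable_const) ha hKl hγ hα
    hfin hind (fun _ => hlaw') hB' (hasCondDistrib_const hB') hD' hκ hBD'
    (fun f _ i => by simp) (fun f _ => by simp) r hg hgi

variable {A : ∀ i, ℕ → Ω i → ProbabilityMeasure T} {Y : ∀ i, Ω i → ProbabilityMeasure T}
  {B : ∀ i, Ω i → ProbabilityMeasure (ProbabilityMeasure T)}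
  {D : ∀ i, ℕ → Ω i → ProbabilityMeasure (ProbabilityMeasure T)}
  {A' : ℕ → Ω' → ProbabilityMeasure T} {Y' : Ω' → ProbabilityMeasure T}
  {B' : Ω' → ProbabilityMeasure (ProbabilityMeasure T)}
  {D' : ℕ → Ω' → ProbabilityMeasure (ProbabilityMeasure T)} {α₀ : ℝ}
  {κ : Kernel (ProbabilityMeasure T) (ProbabilityMeasure T)}
  {κ' : Kernel (ProbabilityMeasure (ProbabilityMeasure T))
    (ProbabilityMeasure (ProbabilityMeasure T))}

/-- Convergence at one level implies convergence of the finite mixtures over the groups of that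
level. -/
theorem tendstoInDistribution_mixture_groups {𝒯 : Set (T → ℝ)} (h𝒯 : ∀ f ∈ 𝒯, Measurable f)
    (hY : ∀ i, Measurable (Y i)) (hA : ∀ i k, Measurable (A i k)) (hα₀ : 0 < α₀)
    (hκ : IsDPKernel α₀ κ) (hYA : ∀ i, CondIID (P i) (Y i) (A i) κ)
    (hKl : Tendsto K l atTop) (hγ : 0 < γ) (hα : 0 < α)
    (hfin : ∀ i, IsFiniteLevel (K i) γ α (P i) (A i) (β i) (π i) (B i) (D i))
    (hind : ∀ i, IndepFun (fun ω => (β i ω, fun r => π i r ω)) (fun ω k => A i k ω) (P i))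
    (hY' : Measurable Y') (hA' : ∀ k, Measurable (A' k)) (hYA' : CondIID P' Y' A' κ)
    (hstep : IsNestedStep γ α₀ P' Y' B') (hB' : Measurable B') (hD' : ∀ r, Measurable (D' r))
    (hκ' : IsDPKernel α κ') (hBD' : CondIID P' B' D' κ')
    (hlim : ∀ (n : ℕ) (r : Fin n → Option ℕ) (g : Fin n → T → ℝ), (∀ j, g j ∈ 𝒯) →
      TendstoInDistribution (fun i => integrals (Y i) (A i) r g) l (integrals Y' A' r g) P P')
    {n : ℕ} (r : Fin n → Option ℕ) (g : Fin n → ProbabilityMeasure T → ℝ)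
    (hg : ∀ j, g j ∈ cylinderFunctions 𝒯) :
    TendstoInDistribution (fun i => integrals (B i) (D i) r g) l (integrals B' D' r g) P P' := by
  obtain ⟨κ₁, ρ, hκ₁, hρ, hZ⟩ := hstep
  obtain rfl := hκ₁.unique hα₀ hκ
  have := hκ.isMarkovKernel
  exact tendstoInDistribution_mixture hYA hY hA hKl hγ hα hfin hind hρ hB' hZ hD' hκ' hBD'
    (fun f hf => isBoundedMeasurable_of_mem_cylinderFunctions h𝒯 hf)
    (fun f hf g hg => mul_mem_cylinderFunctions hf hg)
    (tendsto_integral_prod_cylinder hY hA hYA hY' hA' hYA' h𝒯 hlim) r g hg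

/-- Finite mixtures over groups whose base measure already has the law of the limit. -/
theorem tendstoInDistribution_mixture_groups_of_map_eq [l.IsCountablyGenerated]
    (hY : ∀ i, Measurable (Y i)) (hA : ∀ i k, Measurable (A i k)) (hα₀ : 0 < α₀)
    (hκ : IsDPKernel α₀ κ) (hYA : ∀ i, CondIID (P i) (Y i) (A i) κ)
    (hKl : Tendsto K l atTop) (hγ : 0 < γ) (hα : 0 < α)
    (hfin : ∀ i, IsFiniteLevel (K i) γ α (P i) (A i) (β i) (π i) (B i) (D i))
    (hind : ∀ i, IndepFun (fun ω => (β i ω, fun r => π i r ω)) (fun ω k => A i k ω) (P i))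
    (hY' : Measurable Y') (hA' : ∀ k, Measurable (A' k)) (hYA' : CondIID P' Y' A' κ)
    (hstep : IsNestedStep γ α₀ P' Y' B') (hB' : Measurable B') (hD' : ∀ r, Measurable (D' r))
    (hκ' : IsDPKernel α κ') (hBD' : CondIID P' B' D' κ')
    (hlaw : ∀ i, (P i).map (Y i) = P'.map Y')
    {n : ℕ} (r : Fin n → Option ℕ) {g : Fin n → ProbabilityMeasure T → ℝ}
    (hg : ∀ j, Measurable (g j)) (hgi : ∀ j, Integrable (g j) (P'.map (A' 0))) :
    TendstoInDistribution (fun i => integrals (B i) (D i) r g) l (integrals B' D' r g) P P' := by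
  obtain ⟨κ₁, ρ, hκ₁, hρ, hZ⟩ := hstep
  obtain rfl := hκ₁.unique hα₀ hκ
  have := hκ.isMarkovKernel
  have := Measure.isProbabilityMeasure_map (μ := P') (hA' 0).aemeasurable
  refine tendstoInDistribution_mixture_of_integrable hYA hY hA hKl hγ hα hfin hind hρ hB' hZ hD'
    hκ' hBD' (fun f hf i => ?_) (m := P'.map (A' 0)) (fun f hf => ?_) r hg hgi
  · rw [← integral_map (hY i).aemeasurable hf.measurable.aestronglyMeasurable, hlaw,
      integral_map hY'.aemeasurable hf.measurable.aestronglyMeasurable]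
  · rw [integral_map (hA' 0).aemeasurable hf.measurable.aestronglyMeasurable,
      hYA'.integral_comp hY' hA' 0 hf]

end Limit

/-! ### The levels -/

section Levels

variable {Θ : Type u} [MeasurableSpace Θ]

instance isProbabilityMeasure_asBase (H : Measure Θ) [h : IsProbabilityMeasure H] :
    IsProbabilityMeasure (asBase H) := h

lemma measurable_asPoint {l : ℕ} :
    Measurable (asPoint : ProbabilityMeasure (Level Θ l) → Level Θ (l + 1)) := measurable_id

lemma IsTestFunction.measurable {H : Measure Θ} :
    ∀ {l : ℕ} {g : Level Θ l → ℝ}, IsTestFunction H l g → Measurable g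
  | 0, _, hg => hg.1
  | l + 1, _, hg => (isBoundedMeasurable_of_mem_cylinderFunctions (X := Level Θ l)
      (𝒯 := {f | IsTestFunction H l f}) (fun _ hf => hf.measurable) hg).measurable

section FiniteMixture

variable {L : ℕ} {K : ℕ → ℕ} {γ α : ℕ → ℝ} {H : Measure Θ} {Ω : Type*} [MeasurableSpace Ω]
  {P : Measure Ω} {φ : ℕ → Ω → Θ} {β : (l : ℕ) → Ω → Fin (K l) → ℝ}
  {π : (l : ℕ) → ℕ → Ω → Fin (K l) → ℝ} {G₀ : (l : ℕ) → Ω → ProbabilityMeasure (Level Θ l)}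
  {G : (l : ℕ) → ℕ → Ω → ProbabilityMeasure (Level Θ l)}

lemma IsFiniteMixture.measurable_atoms (h : IsFiniteMixture L K γ α H P φ β π G₀ G) :
    ∀ l ≤ L, ∀ k, Measurable (atoms φ G l k)
  | 0, _, k => h.measurable_atom k
  | l + 1, hl, k => measurable_asPoint.comp ((h.level l (by omega)).measurable_group k)

/-- The atoms of a level are a function of the `φ k` and the weights of the lower levels. -/
lemma IsFiniteMixture.exists_atoms_eq [IsProbabilityMeasure P]
    (h : IsFiniteMixture L K γ α H P φ β π G₀ G) (l : ℕ) (hl : l ≤ L) :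
    ∃ f : (ℕ → Θ) × ((j : Fin l) → (Fin (K j) → ℝ) × (ℕ → Fin (K j) → ℝ)) → ℕ → Level Θ l,
      Measurable f ∧ ∀ᵐ ω ∂P, (fun k => atoms φ G l k ω) =
        f ((fun k => φ k ω), fun j : Fin l => (β j ω, fun r => π j r ω)) := by
  induction l with
  | zero => exact ⟨Prod.fst, measurable_fst, ae_of_all _ fun ω => rfl⟩
  | succ l ih =>
    obtain ⟨f, hf, hfe⟩ := ih (by omega)
    have hΩ : Nonempty Ω := nonempty_of_isProbabilityMeasure P
    have : Nonempty (ProbabilityMeasure (Level Θ l)) := ⟨G₀ l hΩ.some⟩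
    obtain ⟨ρ, hρ, hρ'⟩ := exists_measurable_retraction (X := Level Θ l)
    -- Group `k` of level `l` is rebuilt from the atoms of that level and its own weights. The entry
    -- `Fin.last l` holds the weights of level `l`, the earlier entries those of the levels below.
    let F : (ℕ → Θ) × ((j : Fin (l + 1)) → (Fin (K j) → ℝ) × (ℕ → Fin (K j) → ℝ)) →
        ℕ → ProbabilityMeasure (Level Θ l) := fun p k =>
      ρ (atomicMeasure (f (p.1, fun j : Fin l => p.2 j.castSucc)) ((p.2 (Fin.last l)).2 k))
    have hF : Measurable F := by
      refine measurable_pi_lambda _ fun k => hρ.comp (measurable_atomicMeasure.comp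
        (Measurable.prodMk (hf.comp (Measurable.prodMk measurable_fst ?_)) ?_))
      · exact measurable_pi_lambda _ fun j => (measurable_pi_apply (Fin.castSucc j)).comp
          measurable_snd
      · exact (measurable_pi_apply k).comp (measurable_snd.comp
          ((measurable_pi_apply (Fin.last l)).comp measurable_snd))
    refine ⟨F, hF, ?_⟩
    filter_upwards [hfe, ae_all_iff.mpr (h.level l (by omega)).group_eq] with ω h1 h2
    funext k
    have h3 : (G l k ω : Measure (Level Θ l)) =
        atomicMeasure (fun k => atoms φ G l k ω) (π l k ω) := h2 k
    have h4 : G l k ω = ρ (atomicMeasure (fun k => atoms φ G l k ω) (π l k ω)) := by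
      rw [← h3, hρ']
    rw [h1] at h4
    exact h4

/-- Almost surely the atoms are a measurable function of the `φ k` and the lower weights, from which
the weights of level `l` are independent. -/
lemma IsFiniteMixture.indepFun_atoms [IsProbabilityMeasure P]
    (h : IsFiniteMixture L K γ α H P φ β π G₀ G) (l : ℕ) (hl : l ≤ L) :
    IndepFun (fun ω => (β l ω, fun r => π l r ω)) (fun ω k => atoms φ G l k ω) P := by
  obtain ⟨f, hf, hfe⟩ := h.exists_atoms_eq l hl
  exact ((h.weight_indep l hl).comp measurable_id hf).congr (ae_of_all _ fun _ => rfl)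
    (hfe.mono fun ω hω => hω.symm)

end FiniteMixture

section NestedHDP

variable {L : ℕ} {γ α : ℕ → ℝ} {H : Measure Θ} [IsProbabilityMeasure H]

/-- The laws of the base measures of a nested hierarchical Dirichlet process are determined by its
parameters. -/
lemma IsNestedHDP.map_eq (hγ : ∀ l ≤ L, 0 < γ l) (hα : ∀ l ≤ L, 0 < α l)
    {Ω Ω' : Type*} [MeasurableSpace Ω] [MeasurableSpace Ω'] {P : Measure Ω} {P' : Measure Ω'}
    [IsProbabilityMeasure P] [IsProbabilityMeasure P']
    {G₀ : (l : ℕ) → Ω → ProbabilityMeasure (Level Θ l)}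
    {G : (l : ℕ) → ℕ → Ω → ProbabilityMeasure (Level Θ l)}
    {G₀' : (l : ℕ) → Ω' → ProbabilityMeasure (Level Θ l)}
    {G' : (l : ℕ) → ℕ → Ω' → ProbabilityMeasure (Level Θ l)}
    (h : IsNestedHDP L γ α H P G₀ G) (h' : IsNestedHDP L γ α H P' G₀' G') (l : ℕ) (hl : l ≤ L) :
    P.map (G₀ l) = P'.map (G₀' l) := by
  induction l with
  | zero => exact h.base_zero.unique (hγ 0 hl) h'.base_zero
  | succ l ih =>
    obtain ⟨κ, ρ, hκ, hρ, hZ⟩ := h.base_succ l (by omega)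
    obtain ⟨κ', ρ', hκ', hρ', hZ'⟩ := h'.base_succ l (by omega)
    obtain rfl := hκ.unique (hα l (by omega)) hκ'
    have := hκ.isMarkovKernel
    obtain rfl : ρ = ρ' := by
      ext1 μ
      exact (hρ μ).unique (hγ _ hl) (hρ' μ)
    have : IsMarkovKernel ρ := ⟨fun μ => (hρ μ).isProbabilityMeasure⟩
    have e1 := HasCondDistrib.map_eq_snd hZ
    have e2 := HasCondDistrib.map_eq_snd hZ'
    rw [← ih (by omega)] at e2
    exact e1.trans e2.symm

variable {ι : Type*} {𝓕 : Filter ι} {K : ι → ℕ → ℕ}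
  {Ω : Type v} [MeasurableSpace Ω] {P : Measure Ω} [IsProbabilityMeasure P]
  {G₀ : (l : ℕ) → Ω → ProbabilityMeasure (Level Θ l)}
  {G : (l : ℕ) → ℕ → Ω → ProbabilityMeasure (Level Θ l)}

/-- Induction on the level. At level `0` the law of the atoms is fixed, which admits integrable test
functions. Above it that law varies with the mixture, and the convergence of base and groups one
level below controls its moments on cylinder functions. -/
theorem IsNestedHDP.tendstoInDistribution_of_isFiniteMixture [𝓕.IsCountablyGenerated]
    (hγ : ∀ l ≤ L, 0 < γ l) (hα : ∀ l ≤ L, 0 < α l)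
    (hK : ∀ l ≤ L, Tendsto (fun i => K i l) 𝓕 atTop) (hG : IsNestedHDP L γ α H P G₀ G)
    {Ω' : ι → Type w} [∀ i, MeasurableSpace (Ω' i)] {P' : ∀ i, Measure (Ω' i)}
    [∀ i, IsProbabilityMeasure (P' i)] {φ : ∀ i, ℕ → Ω' i → Θ}
    {β : ∀ i, (l : ℕ) → Ω' i → Fin (K i l) → ℝ}
    {π : ∀ i, (l : ℕ) → ℕ → Ω' i → Fin (K i l) → ℝ}
    {G₀' : ∀ i, (l : ℕ) → Ω' i → ProbabilityMeasure (Level Θ l)}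
    {G' : ∀ i, (l : ℕ) → ℕ → Ω' i → ProbabilityMeasure (Level Θ l)}
    (hmix : ∀ i, IsFiniteMixture L (K i) γ α H (P' i) (φ i) (β i) (π i) (G₀' i) (G' i))
    (l : ℕ) (hl : l ≤ L) (n : ℕ) (r : Fin n → Option ℕ) (g : Fin n → Level Θ l → ℝ)
    (hg : ∀ j, IsTestFunction H l (g j)) :
    TendstoInDistribution (fun i => integrals (G₀' i l) (G' i l) r g) 𝓕
      (integrals (G₀ l) (G l) r g) P' P := by
  induction l generalizing n with
  | zero =>
    obtain ⟨κ, hκ, hBD⟩ := hG.group 0 hl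
    exact tendstoInDistribution_mixture_iid (T := Level Θ 0) (m := asBase H)
      (fun i => (hmix i).measurable_atom) (fun i => (hmix i).atom_law)
      (fun i => (hmix i).atom_indep) (hK 0 hl) (hγ 0 hl) (hα 0 hl) (fun i => (hmix i).level 0 hl)
      (fun i => (hmix i).indepFun_atoms 0 hl) (hG.measurable_base 0 hl) hG.base_zero
      (hG.measurable_group 0 hl) hκ hBD r (fun j => (hg j).1) fun j => (hg j).2
  | succ l ih =>
    have hl' : l ≤ L := by omega
    obtain ⟨κ, hκ, hYA⟩ := hG.group l hl'
    obtain ⟨κ', hκ', hBD⟩ := hG.group (l + 1) hl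
    have hfin := fun i => (hmix i).level l hl'
    exact tendstoInDistribution_mixture_groups (T := Level Θ l)
      (𝒯 := {f | IsTestFunction H l f}) (fun _ hf => hf.measurable)
      (fun i => (hfin i).measurable_base) (fun i => (hfin i).measurable_group) (hα l hl') hκ
      (fun i => (hfin i).condIID (hα l hl') ((hmix i).measurable_atoms l hl')
        ((hmix i).indepFun_atoms l hl') hκ)
      (hK _ hl) (hγ _ hl) (hα _ hl) (fun i => (hmix i).level (l + 1) hl)
      (fun i => (hmix i).indepFun_atoms (l + 1) hl) (hG.measurable_base l hl')
      (hG.measurable_group l hl') hYA (hG.base_succ l hl) (hG.measurable_base _ hl)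
      (hG.measurable_group _ hl) hκ' hBD (fun n r g hg => ih hl' n r g hg) r g hg

/-- The parameters determine the law of the base measure of level `l`, so it is the same for every
index and for the limit. -/
theorem IsNestedHDP.tendstoInDistribution_of_isFiniteLevel [𝓕.IsCountablyGenerated]
    (hγ : ∀ l ≤ L, 0 < γ l) (hα : ∀ l ≤ L, 0 < α l)
    (hK : ∀ l ≤ L, Tendsto (fun i => K i l) 𝓕 atTop) (hG : IsNestedHDP L γ α H P G₀ G)
    {l : ℕ} (hl : l < L)
    {Ω' : ι → Type w} [∀ i, MeasurableSpace (Ω' i)] {P' : ∀ i, Measure (Ω' i)}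
    [∀ i, IsProbabilityMeasure (P' i)]
    {G₀' : ∀ i, (l : ℕ) → Ω' i → ProbabilityMeasure (Level Θ l)}
    {G' : ∀ i, (l : ℕ) → ℕ → Ω' i → ProbabilityMeasure (Level Θ l)}
    {β : ∀ i, Ω' i → Fin (K i (l + 1)) → ℝ} {π : ∀ i, ℕ → Ω' i → Fin (K i (l + 1)) → ℝ}
    {B : ∀ i, Ω' i → ProbabilityMeasure (Level Θ (l + 1))}
    {D : ∀ i, ℕ → Ω' i → ProbabilityMeasure (Level Θ (l + 1))}
    (hG' : ∀ i, IsNestedHDP L γ α H (P' i) (G₀' i) (G' i))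
    (hfin : ∀ i, IsFiniteLevel (K i (l + 1)) (γ (l + 1)) (α (l + 1)) (P' i)
      (fun k ω => asPoint (G' i l k ω)) (β i) (π i) (B i) (D i))
    (hind : ∀ i, IndepFun (fun ω => (β i ω, fun r => π i r ω))
      (fun ω k => asPoint (G' i l k ω)) (P' i))
    {n : ℕ} (r : Fin n → Option ℕ) (g : Fin n → Level Θ (l + 1) → ℝ)
    (hg : ∀ j, Measurable (g j) ∧ Integrable (g j) (P.map fun ω => asPoint (G l 0 ω))) :
    TendstoInDistribution (fun i => integrals (B i) (D i) r g) 𝓕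
      (integrals (G₀ (l + 1)) (G (l + 1)) r g) P' P := by
  obtain ⟨κ, hκ, hYA⟩ := hG.group l hl.le
  obtain ⟨κ', hκ', hBD⟩ := hG.group (l + 1) hl
  exact tendstoInDistribution_mixture_groups_of_map_eq (T := Level Θ l)
    (fun i => (hG' i).measurable_base l hl.le) (fun i => (hG' i).measurable_group l hl.le)
    (hα l hl.le) hκ
    (fun i => by
      obtain ⟨κ₁, hκ₁, hYA₁⟩ := (hG' i).group l hl.le
      rwa [hκ₁.unique (hα l hl.le) hκ] at hYA₁)
    (hK _ hl) (hγ _ hl) (hα _ hl) hfin hind (hG.measurable_base l hl.le)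
    (hG.measurable_group l hl.le) hYA (hG.base_succ l hl) (hG.measurable_base _ hl)
    (hG.measurable_group _ hl) hκ' hBD (fun i => (hG' i).map_eq hγ hα hG l hl.le) r
    (fun j => (hg j).1) fun j => (hg j).2

end NestedHDP

end Levels

/-! ### The theorem -/

lemma TendstoInDistribution.mono_left {ι E : Type*} [TopologicalSpace E] [MeasurableSpace E]
    [OpensMeasurableSpace E] {l l' : Filter ι} (hl : l ≤ l') {Ω : ι → Type*}
    [∀ i, MeasurableSpace (Ω i)] {P : ∀ i, Measure (Ω i)} [∀ i, IsProbabilityMeasure (P i)]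
    {Ω' : Type*} [MeasurableSpace Ω'] {P' : Measure Ω'} [IsProbabilityMeasure P']
    {V : ∀ i, Ω i → E} {V' : Ω' → E} (h : TendstoInDistribution V l' V' P P') :
    TendstoInDistribution V l V' P P' :=
  ⟨h.forall_aemeasurable, h.aemeasurable_limit, h.tendsto.mono_left hl⟩

theorem theorem1 {Θ : Type u} [MeasurableSpace Θ] (H : Measure Θ) [IsProbabilityMeasure H]
    (L : ℕ) (γ α : ℕ → ℝ) (hγ : ∀ l ≤ L, 0 < γ l) (hα : ∀ l ≤ L, 0 < α l)
    -- the numbers of atoms, all of which tend to infinity jointly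
    {ι : Type*} (𝓕 : Filter ι) (K : ι → ℕ → ℕ)
    (hK : ∀ l ≤ L, Tendsto (fun i => K i l) 𝓕 atTop)
    -- the limit
    {Ω : Type v} [MeasurableSpace Ω] (P : Measure Ω) [IsProbabilityMeasure P]
    (G₀ : (l : ℕ) → Ω → ProbabilityMeasure (Level Θ l))
    (G : (l : ℕ) → ℕ → Ω → ProbabilityMeasure (Level Θ l))
    (hG : IsNestedHDP L γ α H P G₀ G) :
    -- joint limit: all levels are finite mixtures
    (∀ (Ω' : ι → Type w) [∀ i, MeasurableSpace (Ω' i)] (P' : ∀ i, Measure (Ω' i))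
        [∀ i, IsProbabilityMeasure (P' i)]
        (φ : ∀ i, ℕ → Ω' i → Θ)
        (β : ∀ i, (l : ℕ) → Ω' i → Fin (K i l) → ℝ)
        (π : ∀ i, (l : ℕ) → ℕ → Ω' i → Fin (K i l) → ℝ)
        (G₀' : ∀ i, (l : ℕ) → Ω' i → ProbabilityMeasure (Level Θ l))
        (G' : ∀ i, (l : ℕ) → ℕ → Ω' i → ProbabilityMeasure (Level Θ l)),
        (∀ i, IsFiniteMixture L (K i) γ α H (P' i) (φ i) (β i) (π i) (G₀' i) (G' i)) →
        ∀ l ≤ L, ∀ (n : ℕ) (r : Fin n → Option ℕ) (g : Fin n → Level Θ l → ℝ),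
          (∀ j, IsTestFunction H l (g j)) →
          TendstoInDistribution (fun i => integrals (G₀' i l) (G' i l) r g) 𝓕
            (integrals (G₀ l) (G l) r g) P' P) ∧
    -- successive limits: level `l + 1` is a finite mixture over the groups of the limit at level `l`
    (∀ l < L, ∀ (Ω' : ι → Type w) [∀ i, MeasurableSpace (Ω' i)] (P' : ∀ i, Measure (Ω' i))
        [∀ i, IsProbabilityMeasure (P' i)]
        (G₀' : ∀ i, (l : ℕ) → Ω' i → ProbabilityMeasure (Level Θ l))
        (G' : ∀ i, (l : ℕ) → ℕ → Ω' i → ProbabilityMeasure (Level Θ l))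
        (β : ∀ i, Ω' i → Fin (K i (l + 1)) → ℝ)
        (π : ∀ i, ℕ → Ω' i → Fin (K i (l + 1)) → ℝ)
        (B : ∀ i, Ω' i → ProbabilityMeasure (Level Θ (l + 1)))
        (D : ∀ i, ℕ → Ω' i → ProbabilityMeasure (Level Θ (l + 1))),
        (∀ i, IsNestedHDP L γ α H (P' i) (G₀' i) (G' i)) →
        (∀ i, IsFiniteLevel (K i (l + 1)) (γ (l + 1)) (α (l + 1)) (P' i)
          (fun k ω => asPoint (G' i l k ω)) (β i) (π i) (B i) (D i)) →
        (∀ i, IndepFun (fun ω => (β i ω, fun r => π i r ω))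
          (fun ω k => asPoint (G' i l k ω)) (P' i)) →
        ∀ (n : ℕ) (r : Fin n → Option ℕ) (g : Fin n → Level Θ (l + 1) → ℝ),
          (∀ j, Measurable (g j) ∧ Integrable (g j) (P.map fun ω => asPoint (G l 0 ω))) →
          TendstoInDistribution (fun i => integrals (B i) (D i) r g) 𝓕
            (integrals (G₀ (l + 1)) (G (l + 1)) r g) P' P) := by
  -- The coarsest filter along which all `K i l` with `l ≤ L` tend to infinity. Unlike an arbitrary
  -- `𝓕` it is countably generated, being a finite infimum of preimages of `atTop` on `ℕ`, and
  -- convergence along it implies convergence along `𝓕`.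
  let 𝓖 : Filter ι := ⨅ l : Fin (L + 1), comap (fun i => K i l) atTop
  have h𝓖 : 𝓕 ≤ 𝓖 := le_iInf fun l => (hK l (by omega)).le_comap
  have hK' : ∀ l ≤ L, Tendsto (fun i => K i l) 𝓖 atTop := fun l hl =>
    tendsto_iff_comap.mpr (iInf_le _ (⟨l, by omega⟩ : Fin (L + 1)))
  have : 𝓖.IsCountablyGenerated := iInf.isCountablyGenerated _
  refine ⟨?_, ?_⟩
  · intro Ω' _ P' _ φ β π G₀' G' hmix l hl n r g hg
    exact TendstoInDistribution.mono_left h𝓖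
      (hG.tendstoInDistribution_of_isFiniteMixture hγ hα hK' hmix l hl n r g hg)
  · intro l hl Ω' _ P' _ G₀' G' β π B D hG' hfin hind n r g hg
    exact TendstoInDistribution.mono_left h𝓖
      (hG.tendstoInDistribution_of_isFiniteLevel hγ hα hK' hl hG' hfin hind r g hg)
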